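/- **Reshetnyak formula for rank-2 symmetric tensor fields.** Let $n\ge 2$, $s\in\mathbb R$, $t>-n/2$, and let $f=(f_{ij})\in\mathcal S(\mathbb R^n;S^2\mathbb R^n)$ be a symmetric tensor field with complex-valued Schwartz components. On $T\mathbb S^{n-1}=\{(x,\xi)\in\mathbb R^n\times\mathbb R^n:\ |\xi|=1,\ \langle x,\xi\rangle=0\}$ put $$(I^kf)(x,\xi)=\int_{-\infty}^\infty t^k f_{ij}(x+t\xi)\,\xi^i\xi^j\,dt\qquad(k=0,1,2)$$ (summation over repeated upper and lower indices; $\xi^i=\xi_i$, $\Xi^i=\Xi_i$, etc.). Fourier transforms are $$\hat g(y)=(2\pi)^{-n/2}\int_{\mathbb R^n}e^{-i\langle y,x\rangle}g(x)\,dx,\qquad \hat\varphi(y,\xi)=(2\pi)^{-(n-1)/2}\int_{\xi^\perp}e^{-i\langle y,x\rangle}\varphi(x,\xi)\,dx,\quad (y,\xi)\in T\mathbb S^{n-1},$$ and the norms and inner products are $$\|f\|^2_{H^s_t(\mathbb R^n;S^2\mathbb R^n)}=\sum_{i,j}\int_{\mathbb R^n}|y|^{2t}(1+|y|^2)^{s-t}|\hat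 f_{ij}(y)|^2\,dy,$$ $$(\varphi,\psi)_{H^{s}_{t}}=\frac1{2\pi}\int_{\mathbb S^{n-1}}\int_{\xi^\perp}|y|^{2t}(1+|y|^2)^{s-t}\,\hat\varphi(y,\xi)\,\overline{\hat\psi(y,\xi)}\,dy\,d\xi,\qquad \|\varphi\|_{H^s_t}^2=(\varphi,\varphi)_{H^s_t}.$$ Let $X_i,\Xi_i$ be the derivations on $T\mathbb S^{n-1}$ given by the restrictions to $T\mathbb S^{n-1}$ of the vector fields (tangent to it) $$\tilde X_i=\frac{\partial}{\partial x^i}-\xi_i\xi^p\frac{\partial}{\partial x^p},\qquad \tilde\Xi_i=\frac{\partial}{\partial\xi^i}-x_i\xi^p\frac{\partial}{\partial x^p}-\xi_i\xi^p\frac{\partial}{\partial\xi^p},$$ and let $Z,Q,W$ be the operators defined by (inverse Fourier transform on the hyperplanes $\xi^\perp$ of) $$\widehat{Z\varphi}=\frac{y^i}{|y|}\,\Xi_i\hat\varphi,\qquad \widehat{Q\varphi}=\frac{y^iy^j}{|y|^2}\,\Xi_i\Xi_j\hat\varphi,\qquad \widehat{W\varphi}=\frac{y^i}{|y|}\,X_i\hat\varphi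 .$$ Let $$a_n=\frac{\Gamma\big((n-1)/2\big)}{2\pi^{(n-1)/2}}.$$ Then all integrals defining the norms and inner products below converge absolutely (moreover, all $H^{s+r}_{t+r}$ pairings, $r\ge1/2$, between the functions on $T\mathbb S^{n-1}$ occurring below do), and $$ \begin{aligned} \|f\|^2_{H^s_t(\mathbb R^n;S^{2}\mathbb R^{n})}=\frac{a_n}{4}\Big[&\|I^2f\|^2_{H^{s+5/2}_{t+5/2}} +4\,\mathrm{Im}\big(I^2f,Z(I^1f)\big)_{H^{s+2}_{t+2}} +2\sum_i\|\Xi_i(I^1f)\|^2_{H^{s+3/2}_{t+3/2}}\\ &+2\|I^1f\|^2_{H^{s+3/2}_{t+3/2}} +2\|Z(I^1f)\|^2_{H^{s+3/2}_{t+3/2}} +2\,\mathrm{Re}\big(I^2f,W(I^0f)\big)_{H^{s+2}_{t+2}}\\ &-4\,\mathrm{Re}\big(I^2f,I^0f\big)_{H^{s+3/2}_{t+3/2}} -2\,\mathrm{Re}\big(I^2f,Q(I^0f)\big)_{H^{s+3/2}_{t+3/2}}\\ &-4\,\mathrm{Re}\big(\Xi^i(I^1f),x_iI^0f\big)_{H^{s+3/2}_{t+3/2}}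 +8\,\mathrm{Im}\big(Z(I^1f),I^0f\big)_{H^{s+1}_{t+1}}\\ &+4\,\mathrm{Im}\big(I^1f,Z(I^0f)\big)_{H^{s+1}_{t+1}} +4\,\mathrm{Im}\big(\Xi^i(I^1f),Z\Xi_i(I^0f)\big)_{H^{s+1}_{t+1}}\\ &+\sum_i\|x_iI^0f\|^2_{H^{s+3/2}_{t+3/2}} -2\,\mathrm{Im}\big(x^iI^0f,Z\Xi_i(I^0f)\big)_{H^{s+1}_{t+1}}\\ &-4\,\mathrm{Re}\big(W(I^0f),I^0f\big)_{H^{s+1}_{t+1}} +\sum_{i,j}\|\Xi_i\Xi_j(I^0f)\|^2_{H^{s+1/2}_{t+1/2}}\\ &+4\,\mathrm{Re}\big(\Xi^i\Xi_i(I^0f), I^0f\big)_{H^{s+1/2}_{t+1/2}} +\sum_i\|\Xi_i(I^0f)\|^2_{H^{s+1/2}_{t+1/2}} +4n\|I^0f\|^2_{H^{s+1/2}_{t+1/2}}\Big]. \end{aligned} $$ -/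

import Mathlib

open MeasureTheory Filter Topology Module

open scoped SchwartzMap ComplexConjugate

noncomputable section

namespace RayTransform

/-! ### The Fourier transform on a Euclidean space

`V` is any finite-dimensional real inner product space (below: `ℝⁿ` or a hyperplane `ξ^⊥`),
with its Lebesgue measure. -/

/-- Lebesgue measure of a finite-dimensional Euclidean space (unit cubes have measure one). -/
def lebesgue (V : Type*) [NormedAddCommGroup V] [InnerProductSpace ℝ V] [FiniteDimensional ℝ V]
    [MeasurableSpace V] [BorelSpace V] : Measure V := volume

/-- The normalizing factor `(2π)^{-d/2}`, where `d = dim V`. -/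
def fourierConst (V : Type*) [NormedAddCommGroup V] [InnerProductSpace ℝ V] : ℂ :=
  (((2 * Real.pi) ^ (-(finrank ℝ V : ℝ) / 2) : ℝ) : ℂ)

/-- `(2π)^{-d/2} ∫_V e^{-i⟨y,x⟩} g(x) dx`. -/
def fourierInt {V : Type*} [NormedAddCommGroup V] [InnerProductSpace ℝ V] [FiniteDimensional ℝ V]
    [MeasurableSpace V] [BorelSpace V] (g : V → ℂ) (y : V) : ℂ :=
  fourierConst V * ∫ x, Complex.exp (-Complex.I * (inner ℝ y x : ℝ)) * g x ∂(lebesgue V)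

/-- `(2π)^{-d/2} ∫_V e^{i⟨y,x⟩} g(y) dy`. -/
def fourierInvInt {V : Type*} [NormedAddCommGroup V] [InnerProductSpace ℝ V]
    [FiniteDimensional ℝ V] [MeasurableSpace V] [BorelSpace V] (g : V → ℂ) (x : V) : ℂ :=
  fourierConst V * ∫ y, Complex.exp (Complex.I * (inner ℝ y x : ℝ)) * g y ∂(lebesgue V)

/-- The Fourier transform `ĝ(y) = (2π)^{-d/2} ∫_V e^{-i⟨y,x⟩} g(x) dx`, the integral being taken
in the sense of Gaussian summation, `lim_{ε → 0+} (2π)^{-d/2} ∫_V e^{-i⟨y,x⟩} e^{-ε|x|²} g(x) dx`.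
For an integrable `g` this is the ordinary integral (`fourier_eq_fourierInt`). The summation is
only needed for functions that are not integrable but are inverse Fourier transforms of integrable
functions; for these see `fourier_fourierInvInt`. -/
def fourier {V : Type*} [NormedAddCommGroup V] [InnerProductSpace ℝ V] [FiniteDimensional ℝ V]
    [MeasurableSpace V] [BorelSpace V] (g : V → ℂ) (y : V) : ℂ :=
  limUnder (𝓝[>] (0 : ℝ)) fun ε : ℝ =>
    fourierInt (fun x => Complex.exp (-(ε : ℂ) * (‖x‖ : ℂ) ^ 2) * g x) y

/-- On integrable functions the Fourier transform is the usual absolutely convergent integral. -/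
theorem fourier_eq_fourierInt {V : Type*} [NormedAddCommGroup V] [InnerProductSpace ℝ V]
    [FiniteDimensional ℝ V] [MeasurableSpace V] [BorelSpace V] {g : V → ℂ}
    (hg : Integrable g (lebesgue V)) (y : V) : fourier g y = fourierInt g y := by
  refine Tendsto.limUnder_eq ?_
  unfold fourierInt
  refine Tendsto.const_mul _ ?_
  refine tendsto_integral_filter_of_dominated_convergence (fun x => ‖g x‖) ?_ ?_ hg.norm ?_
  · refine Eventually.of_forall fun ε => ?_
    refine AEStronglyMeasurable.mul (Continuous.aestronglyMeasurable (by fun_prop)) ?_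
    exact AEStronglyMeasurable.mul (Continuous.aestronglyMeasurable (by fun_prop)) hg.1
  · filter_upwards [self_mem_nhdsWithin] with ε hε
    refine Eventually.of_forall fun x => ?_
    have h1 : ‖Complex.exp (-Complex.I * (inner ℝ y x : ℝ))‖ = 1 := by
      rw [Complex.norm_exp]; simp
    have h2 : ‖Complex.exp (-(ε : ℂ) * (‖x‖ : ℂ) ^ 2)‖ ≤ 1 := by
      rw [Complex.norm_exp]
      have : (-(ε : ℂ) * (‖x‖ : ℂ) ^ 2).re = -(ε * ‖x‖ ^ 2) := by
        have : (-(ε : ℂ) * (‖x‖ : ℂ) ^ 2) = ((-(ε * ‖x‖ ^ 2) : ℝ) : ℂ) := by push_cast; ring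
        rw [this, Complex.ofReal_re]
      rw [this, Real.exp_le_one_iff]
      have : 0 < ε := hε
      have : 0 ≤ ε * ‖x‖ ^ 2 := by positivity
      linarith
    rw [norm_mul, norm_mul, h1, one_mul]
    exact mul_le_of_le_one_left (norm_nonneg _) h2
  · refine Eventually.of_forall fun x => ?_
    refine Tendsto.const_mul _ ?_
    have : Continuous fun ε : ℝ => Complex.exp (-(ε : ℂ) * (‖x‖ : ℂ) ^ 2) * g x := by fun_prop
    have h := (this.tendsto 0).mono_left (nhdsWithin_le_nhds (s := Set.Ioi (0 : ℝ)))
    simpa using h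

/-- Fourier inversion: the Fourier transform of the inverse Fourier integral of an integrable `g`
is `g`, at each point of continuity of `g`. -/
theorem fourier_fourierInvInt {V : Type*} [NormedAddCommGroup V] [InnerProductSpace ℝ V]
    [FiniteDimensional ℝ V] [MeasurableSpace V] [BorelSpace V] {g : V → ℂ}
    (hg : Integrable g (lebesgue V)) {y : V} (hy : ContinuousAt g y) :
    fourier (fourierInvInt g) y = g y := by
  refine Tendsto.limUnder_eq ?_
  have hc : Tendsto (fun ε : ℝ => (4 * Real.pi ^ 2 * ε)⁻¹) (𝓝[>] (0 : ℝ)) atTop := by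
    refine tendsto_inv_nhdsGT_zero.comp ?_
    refine tendsto_nhdsWithin_of_tendsto_nhds_of_eventually_within _ ?_ ?_
    · have : Continuous fun ε : ℝ => 4 * Real.pi ^ 2 * ε := by fun_prop
      have h := (this.tendsto 0).mono_left (nhdsWithin_le_nhds (s := Set.Ioi (0 : ℝ)))
      simpa using h
    · filter_upwards [self_mem_nhdsWithin] with ε hε
      have : 0 < ε := hε
      exact Set.mem_Ioi.2 (by positivity)
  have hg' : Integrable g volume := hg
  refine ((Real.tendsto_integral_gaussian_smul' hg' hy).comp hc).congr' ?_
  filter_upwards [self_mem_nhdsWithin] with ε hε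
  have hε : 0 < ε := hε
  have hpi := Real.pi_pos
  simp only [Function.comp, fourierInt, fourierInvInt, lebesgue]
  have key : ∀ w : V, ∫ x : V, Complex.exp (-(ε : ℂ) * (‖x‖ : ℂ) ^ 2
      + Complex.I * (inner ℝ (w - y) x : ℝ)) =
      (Real.pi / ε : ℂ) ^ (finrank ℝ V / 2 : ℂ) *
        Complex.exp (-(‖y - w‖ : ℂ) ^ 2 / (4 * ε)) := by
    intro w
    rw [GaussianFourier.integral_cexp_neg_mul_sq_norm_add (by simpa using hε), norm_sub_rev]
    simp
  have hconst : fourierConst V * fourierConst V * (Real.pi / ε : ℂ) ^ (finrank ℝ V / 2 : ℂ) =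
      (Real.pi * ((4 * Real.pi ^ 2 * ε)⁻¹ : ℝ) : ℂ) ^ (finrank ℝ V / 2 : ℂ) := by
    have e1 : (Real.pi / ε : ℂ) ^ (finrank ℝ V / 2 : ℂ)
        = (((Real.pi / ε) ^ ((finrank ℝ V : ℝ) / 2) : ℝ) : ℂ) := by
      rw [Complex.ofReal_cpow (by positivity)]; push_cast; rfl
    have e2 : (Real.pi * ((4 * Real.pi ^ 2 * ε)⁻¹ : ℝ) : ℂ) ^ (finrank ℝ V / 2 : ℂ)
        = (((Real.pi * (4 * Real.pi ^ 2 * ε)⁻¹) ^ ((finrank ℝ V : ℝ) / 2) : ℝ) : ℂ) := by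
      rw [Complex.ofReal_cpow (by positivity)]; push_cast; rfl
    rw [e1, e2, fourierConst, ← Complex.ofReal_mul, ← Complex.ofReal_mul]
    congr 1
    rw [neg_div, Real.rpow_neg (by positivity), ← Real.inv_rpow (by positivity),
      ← Real.mul_rpow (by positivity) (by positivity),
      ← Real.mul_rpow (by positivity) (by positivity)]
    congr 1
    field_simp
    norm_num
  have hint : Integrable (Function.uncurry fun x w : V =>
      Complex.exp (-(ε : ℂ) * (‖x‖ : ℂ) ^ 2 + Complex.I * (inner ℝ (w - y) x : ℝ)) * g w)
      (volume.prod volume) := by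
    have h0 : Integrable (fun x : V => Complex.exp (-(ε : ℂ) * (‖x‖ : ℂ) ^ 2)) := by
      have := GaussianFourier.integrable_cexp_neg_mul_sq_norm_add
        (V := V) (b := (ε : ℂ)) (by simpa using hε) 0 0
      simpa using this
    have h1 := h0.mul_prod hg'
    refine h1.bdd_mul (c := 1) (f := fun p : V × V =>
      Complex.exp (Complex.I * (inner ℝ (p.2 - y) p.1 : ℝ)))
      (Continuous.aestronglyMeasurable (by fun_prop)) ?_ |>.congr ?_
    · refine Eventually.of_forall fun p => ?_
      rw [Complex.norm_exp]; simp
    · refine Eventually.of_forall fun p => ?_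
      simp only [Function.uncurry, Complex.exp_add]
      ring
  have swap := integral_integral_swap hint
  calc ∫ w : V, ((Real.pi * ((4 * Real.pi ^ 2 * ε)⁻¹ : ℝ) : ℂ) ^ (finrank ℝ V / 2 : ℂ) *
          Complex.exp (-Real.pi ^ 2 * ((4 * Real.pi ^ 2 * ε)⁻¹ : ℝ) * (‖y - w‖ : ℂ) ^ 2)) • g w
      = ∫ w : V, fourierConst V * fourierConst V * ∫ x : V,
          Complex.exp (-(ε : ℂ) * (‖x‖ : ℂ) ^ 2 + Complex.I * (inner ℝ (w - y) x : ℝ)) * g w := by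
        refine integral_congr_ae (Eventually.of_forall fun w => ?_)
        simp only
        rw [integral_mul_const, key w, ← hconst, smul_eq_mul]
        have : -(Real.pi : ℂ) ^ 2 * ((4 * Real.pi ^ 2 * ε)⁻¹ : ℝ) * (‖y - w‖ : ℂ) ^ 2
            = -(‖y - w‖ : ℂ) ^ 2 / (4 * ε) := by
          have h1 : (Real.pi : ℂ) ≠ 0 := by exact_mod_cast hpi.ne'
          have h2 : (ε : ℂ) ≠ 0 := by exact_mod_cast hε.ne'
          push_cast
          field_simp
        rw [this]
        ring
    _ = fourierConst V * fourierConst V * ∫ x : V, ∫ w : V,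
          Complex.exp (-(ε : ℂ) * (‖x‖ : ℂ) ^ 2 + Complex.I * (inner ℝ (w - y) x : ℝ)) * g w := by
        rw [integral_const_mul, swap]
    _ = _ := by
        rw [mul_assoc, ← integral_const_mul]
        congr 1
        refine integral_congr_ae (Eventually.of_forall fun x => ?_)
        simp only
        have : ∀ w : V, Complex.exp (-(ε : ℂ) * (‖x‖ : ℂ) ^ 2
              + Complex.I * (inner ℝ (w - y) x : ℝ)) * g w
            = (Complex.exp (-Complex.I * (inner ℝ y x : ℝ)) *
                Complex.exp (-(ε : ℂ) * (‖x‖ : ℂ) ^ 2)) *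
              (Complex.exp (Complex.I * (inner ℝ w x : ℝ)) * g w) := by
          intro w
          rw [← Complex.exp_add, ← mul_assoc, ← Complex.exp_add]
          congr 2
          rw [inner_sub_left]; push_cast; ring
        simp only [this]
        rw [integral_const_mul]
        ring

/-! ### The manifold `T𝕊^{n-1}` and the vector fields `X_i`, `Ξ_i` -/

/-- `ℝⁿ` with its Euclidean structure. -/
abbrev Rn (n : ℕ) : Type := EuclideanSpace ℝ (Fin n)

/-- `T𝕊^{n-1} = {(x, ξ) ∈ ℝⁿ × ℝⁿ : |ξ| = 1, ⟨ξ, x⟩ = 0}`. -/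
abbrev TS (n : ℕ) : Type := {p : Rn n × Rn n // ‖p.2‖ = 1 ∧ inner ℝ p.2 p.1 = 0}

/-- The hyperplane `ξ^⊥`. -/
abbrev hyperplane {n : ℕ} (ξ : Rn n) : Submodule ℝ (Rn n) := (Submodule.span ℝ {ξ})ᗮ

/-- The point `(x, ξ)` of `T𝕊^{n-1}`, for a unit vector `ξ` and `x ∈ ξ^⊥`. -/
def TS.mk {n : ℕ} (ξ : Rn n) (hξ : ‖ξ‖ = 1) (x : hyperplane ξ) : TS n :=
  ⟨((x : Rn n), ξ), hξ, Submodule.mem_orthogonal_singleton_iff_inner_right.1 x.2⟩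

/-- The point `x ∈ ξ^⊥` of the fibre over `ξ`, for `(x, ξ) ∈ T𝕊^{n-1}`. -/
def TS.fibre {n : ℕ} (p : TS n) : hyperplane p.1.2 :=
  ⟨p.1.1, Submodule.mem_orthogonal_singleton_iff_inner_right.2 p.2.2⟩

/-- The retraction `(x, ξ) ↦ (x - ⟨ξ,x⟩ξ/|ξ|², ξ/|ξ|)` of `ℝⁿ × (ℝⁿ ∖ {0})` onto `T𝕊^{n-1}`. -/
def retract {n : ℕ} (p : Rn n × Rn n) : Rn n × Rn n :=
  (p.1 - (inner ℝ p.2 p.1 / ‖p.2‖ ^ 2) • p.2, ‖p.2‖⁻¹ • p.2)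

theorem retract_mem {n : ℕ} (p : Rn n × Rn n) (hp : p.2 ≠ 0) :
    ‖(retract p).2‖ = 1 ∧ inner ℝ (retract p).2 (retract p).1 = 0 := by
  have h : ‖p.2‖ ≠ 0 := norm_ne_zero_iff.2 hp
  constructor
  · simp [retract, norm_smul, h]
  · simp only [retract, inner_smul_left, inner_sub_right, inner_smul_right,
      real_inner_self_eq_norm_sq]
    simp only [conj_trivial]
    field_simp
    ring

open Classical in
/-- The extension `ψ(x, ξ) = φ(x - ⟨ξ,x⟩ξ/|ξ|², ξ/|ξ|)` of a function `φ` on `T𝕊^{n-1}` to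
`ℝⁿ × (ℝⁿ ∖ {0})`. -/
def extend {n : ℕ} (φ : TS n → ℂ) (p : Rn n × Rn n) : ℂ :=
  if hp : p.2 ≠ 0 then φ ⟨retract p, retract_mem p hp⟩ else 0

/-- The vector field `X̃_i = ∂/∂x^i - ξ_i ξ^p ∂/∂x^p`. -/
def fieldX {n : ℕ} (i : Fin n) (p : Rn n × Rn n) : Rn n × Rn n :=
  (EuclideanSpace.single i 1 - p.2 i • p.2, 0)

/-- The vector field `Ξ̃_i = ∂/∂ξ^i - x_i ξ^p ∂/∂x^p - ξ_i ξ^p ∂/∂ξ^p`. -/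
def fieldXi {n : ℕ} (i : Fin n) (p : Rn n × Rn n) : Rn n × Rn n :=
  (-(p.1 i • p.2), EuclideanSpace.single i 1 - p.2 i • p.2)

/-- The derivation `X_i` on `T𝕊^{n-1}`: the derivative along the restriction of `X̃_i`, which is
tangent to `T𝕊^{n-1}`. Any extension of `φ` that is differentiable at the point may be used in
place of `extend φ` (`opX_eq`). -/
def opX {n : ℕ} (i : Fin n) (φ : TS n → ℂ) (p : TS n) : ℂ :=
  fderiv ℝ (extend φ) p.1 (fieldX i p.1)

/-- The derivation `Ξ_i` on `T𝕊^{n-1}`: the derivative along the restriction of `Ξ̃_i`, which is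
tangent to `T𝕊^{n-1}`. Any extension of `φ` that is differentiable at the point may be used in
place of `extend φ` (`opXi_eq`). -/
def opXi {n : ℕ} (i : Fin n) (φ : TS n → ℂ) (p : TS n) : ℂ :=
  fderiv ℝ (extend φ) p.1 (fieldXi i p.1)

theorem retract_differentiableAt {n : ℕ} (q : Rn n × Rn n) (hq : q.2 ≠ 0) :
    DifferentiableAt ℝ (retract (n := n)) q := by
  have hn0 : ‖q.2‖ ≠ 0 := norm_ne_zero_iff.2 hq
  have hdn : DifferentiableAt ℝ (fun q : Rn n × Rn n => ‖q.2‖) q :=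
    DifferentiableAt.norm ℝ differentiableAt_snd hq
  have h1 : DifferentiableAt ℝ (fun q : Rn n × Rn n => inner ℝ q.2 q.1 / ‖q.2‖ ^ 2) q := by
    simp only [div_eq_mul_inv]
    exact (DifferentiableAt.inner ℝ differentiableAt_snd differentiableAt_fst).fun_mul
      ((hdn.fun_pow 2).fun_inv (pow_ne_zero 2 hn0))
  exact DifferentiableAt.prodMk
    (differentiableAt_fst.fun_sub (h1.fun_smul differentiableAt_snd))
    ((hdn.fun_inv hn0).fun_smul differentiableAt_snd)

theorem retract_hasDerivAt {n : ℕ} (x ξ a b : Rn n) (hξ : ‖ξ‖ = 1) (hx : inner ℝ ξ x = 0)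
    (h2 : inner ℝ ξ b = 0) (h1 : inner ℝ ξ a + inner ℝ b x = 0) :
    HasDerivAt (fun r : ℝ => retract (x + r • a, ξ + r • b)) (a, b) 0 := by
  have hl1 : HasDerivAt (fun r : ℝ => x + r • a) a 0 := by
    simpa using ((hasDerivAt_id (0 : ℝ)).smul_const a).const_add x
  have hl2 : HasDerivAt (fun r : ℝ => ξ + r • b) b 0 := by
    simpa using ((hasDerivAt_id (0 : ℝ)).smul_const b).const_add ξ
  have hn2 : HasDerivAt (fun r : ℝ => ‖ξ + r • b‖ ^ 2) 0 0 := by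
    have := hl2.norm_sq
    simpa [h2] using this
  have hn1 : HasDerivAt (fun r : ℝ => ‖ξ + r • b‖) 0 0 := by
    have := hn2.sqrt (by simp [hξ])
    simpa [Real.sqrt_sq] using this
  have hin : HasDerivAt (fun r : ℝ => inner ℝ (ξ + r • b) (x + r • a)) 0 0 := by
    have := hl2.inner ℝ hl1
    simpa [h1] using this
  have hq : HasDerivAt (fun r : ℝ => inner ℝ (ξ + r • b) (x + r • a) / ‖ξ + r • b‖ ^ 2) 0 0 := by
    have := hin.fun_div hn2 (by simp [hξ])
    simpa [hξ, hx] using this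
  have hr1 : HasDerivAt (fun r : ℝ => x + r • a -
      (inner ℝ (ξ + r • b) (x + r • a) / ‖ξ + r • b‖ ^ 2) • (ξ + r • b)) a 0 := by
    have := hl1.fun_sub (hq.fun_smul hl2)
    simpa [hx, hξ] using this
  have hr2 : HasDerivAt (fun r : ℝ => ‖ξ + r • b‖⁻¹ • (ξ + r • b)) b 0 := by
    have := (hn1.fun_inv (by simp [hξ])).fun_smul hl2
    simpa [hx, hξ] using this
  exact hr1.prodMk hr2

theorem fderiv_extend_eq {n : ℕ} (φ : TS n → ℂ) (Ψ : Rn n × Rn n → ℂ) (h : ∀ q : TS n, Ψ q.1 = φ q)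
    (p : TS n) (hd : DifferentiableAt ℝ Ψ p.1) (v : Rn n × Rn n) (h2 : inner ℝ p.1.2 v.2 = 0)
    (h1 : inner ℝ p.1.2 v.1 + inner ℝ v.2 p.1.1 = 0) :
    fderiv ℝ (extend φ) p.1 v = fderiv ℝ Ψ p.1 v := by
  have hξ := p.2.1
  have hx := p.2.2
  generalize p.1 = q at *
  have hξ0 : q.2 ≠ 0 := by
    intro h0
    simp [h0] at hξ
  have hfix : retract q = q := by simp [retract, hξ, hx]
  have heq : extend φ =ᶠ[𝓝 q] Ψ ∘ retract := by
    have : ∀ᶠ q' : Rn n × Rn n in 𝓝 q, q'.2 ≠ 0 := continuous_snd.continuousAt.eventually_ne hξ0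
    filter_upwards [this] with q' hq
    simp [extend, hq, ← h]
  have hdr := retract_differentiableAt q hξ0
  have hline : HasDerivAt (fun r : ℝ => q + r • v) v 0 := by
    simpa using ((hasDerivAt_id (0 : ℝ)).smul_const v).const_add q
  have hr' : HasDerivAt (fun r : ℝ => retract (q + r • v)) (fderiv ℝ retract q v) 0 := by
    have hdr' : HasFDerivAt (retract (n := n)) (fderiv ℝ retract q) (q + (0 : ℝ) • v) := by
      simpa using hdr.hasFDerivAt
    exact hdr'.comp_hasDerivAt 0 hline
  have hv : fderiv ℝ retract q v = v :=
    hr'.unique (retract_hasDerivAt q.1 q.2 v.1 v.2 hξ hx h2 h1)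
  have hd' : DifferentiableAt ℝ Ψ (retract q) := by rw [hfix]; exact hd
  rw [heq.fderiv_eq, fderiv_comp _ hd' hdr, ContinuousLinearMap.comp_apply, hv, hfix]

/-- `X_i φ` may be computed from any extension of `φ` that is differentiable at the point. -/
theorem opX_eq {n : ℕ} (i : Fin n) (φ : TS n → ℂ) (Ψ : Rn n × Rn n → ℂ)
    (h : ∀ q : TS n, Ψ q.1 = φ q) (p : TS n) (hd : DifferentiableAt ℝ Ψ p.1) :
    opX i φ p = fderiv ℝ Ψ p.1 (fieldX i p.1) := by
  refine fderiv_extend_eq φ Ψ h p hd _ ?_ ?_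
  · simp [fieldX]
  · simp [fieldX, inner_sub_right, inner_smul_right, p.2.1, EuclideanSpace.inner_single_right]

/-- `Ξ_i φ` may be computed from any extension of `φ` that is differentiable at the point. -/
theorem opXi_eq {n : ℕ} (i : Fin n) (φ : TS n → ℂ) (Ψ : Rn n × Rn n → ℂ)
    (h : ∀ q : TS n, Ψ q.1 = φ q) (p : TS n) (hd : DifferentiableAt ℝ Ψ p.1) :
    opXi i φ p = fderiv ℝ Ψ p.1 (fieldXi i p.1) := by
  refine fderiv_extend_eq φ Ψ h p hd _ ?_ ?_
  · simp [fieldXi, inner_sub_right, inner_smul_right, p.2.1, EuclideanSpace.inner_single_right]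
  · simp [fieldXi, inner_sub_left, inner_smul_left, inner_smul_right, p.2.1, p.2.2,
      EuclideanSpace.inner_single_left]

/-- Multiplication by the coordinate `x_i`. -/
def mulX {n : ℕ} (i : Fin n) (φ : TS n → ℂ) (p : TS n) : ℂ := (p.1.1 i : ℂ) * φ p

/-! ### Fourier transform on `T𝕊^{n-1}` and the operators `Z`, `Q`, `W` -/

/-- `φ̂(y, ξ) = (2π)^{-(n-1)/2} ∫_{ξ^⊥} e^{-i⟨y,x⟩} φ(x, ξ) dx`. -/
def hat {n : ℕ} (φ : TS n → ℂ) (p : TS n) : ℂ :=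
  fourier (fun x : hyperplane p.1.2 => φ (TS.mk p.1.2 p.2.1 x)) p.fibre

/-- The inverse transform `(2π)^{-(n-1)/2} ∫_{ξ^⊥} e^{i⟨y,x⟩} g(y, ξ) dy`. -/
def invHat {n : ℕ} (g : TS n → ℂ) (p : TS n) : ℂ :=
  fourierInvInt (fun y : hyperplane p.1.2 => g (TS.mk p.1.2 p.2.1 y)) p.fibre

/-- If `g(·, ξ)` is integrable on `ξ^⊥` and continuous at `y`, then `invHat g` is a function whose
Fourier transform is `g` at `(y, ξ)`. -/
theorem hat_invHat {n : ℕ} (g : TS n → ℂ) (p : TS n)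
    (hg : Integrable (fun y : hyperplane p.1.2 => g (TS.mk p.1.2 p.2.1 y)) (lebesgue _))
    (hy : ContinuousAt (fun y : hyperplane p.1.2 => g (TS.mk p.1.2 p.2.1 y)) p.fibre) :
    hat (invHat g) p = g p :=
  fourier_fourierInvInt hg hy

/-- The operator `Z`: the Fourier transform of `Zφ` is `(y^i/|y|) Ξ_i φ̂`. -/
def opZ {n : ℕ} (φ : TS n → ℂ) : TS n → ℂ :=
  invHat fun p => ∑ i, ((p.1.1 i / ‖p.1.1‖ : ℝ) : ℂ) * opXi i (hat φ) p

/-- The operator `Q`: `y^i y^j Ξ_i Ξ_j φ̂` is `|y|²` times the Fourier transform of `Qφ`. -/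
def opQ {n : ℕ} (φ : TS n → ℂ) : TS n → ℂ :=
  invHat fun p => ∑ i, ∑ j,
    ((p.1.1 i * p.1.1 j / ‖p.1.1‖ ^ 2 : ℝ) : ℂ) * opXi i (opXi j (hat φ)) p

/-- The operator `W`: `y^i X_i φ̂` is `|y|` times the Fourier transform of `Wφ`. -/
def opW {n : ℕ} (φ : TS n → ℂ) : TS n → ℂ :=
  invHat fun p => ∑ i, ((p.1.1 i / ‖p.1.1‖ : ℝ) : ℂ) * opX i (hat φ) p

/-! ### The `H^s_t` norms -/

/-- The integrand of the squared `H^s_t(ℝⁿ)` norm, `|y|^{2t} (1+|y|²)^{s-t} |f̂(y)|²`. -/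
def sobolevDensity {n : ℕ} (s t : ℝ) (f : Rn n → ℂ) (y : Rn n) : ℝ :=
  ‖y‖ ^ (2 * t) * (1 + ‖y‖ ^ 2) ^ (s - t) * ‖fourier f y‖ ^ 2

/-- `‖f‖²_{H^s_t(ℝⁿ; S²ℝⁿ)} = ∑_{i,j} ‖f_{ij}‖²_{H^s_t(ℝⁿ)}`. -/
def tensorNormSq {n : ℕ} (s t : ℝ) (f : Fin n → Fin n → 𝓢(Rn n, ℂ)) : ℝ :=
  ∑ i, ∑ j, ∫ y, sobolevDensity s t (f i j) y ∂(lebesgue (Rn n))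

/-- The unit sphere `𝕊^{n-1}`. -/
abbrev Sph (n : ℕ) : Type := Metric.sphere (0 : Rn n) 1

/-- The surface measure `dξ` on `𝕊^{n-1}`. -/
def surface (n : ℕ) : Measure (Sph n) := (lebesgue (Rn n)).toSphere

/-- The point `(y, ξ)` of `T𝕊^{n-1}`, for `ξ ∈ 𝕊^{n-1}` and `y ∈ ξ^⊥`. -/
def TS.ofSphere {n : ℕ} (ξ : Sph n) (y : hyperplane (ξ : Rn n)) : TS n :=
  TS.mk (ξ : Rn n) (by simp) y

/-- The integrand of the `H^s_t(T𝕊^{n-1})` inner product,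
`|y|^{2t} (1+|y|²)^{s-t} φ̂(y,ξ) conj(ψ̂(y,ξ))`. -/
def pairDensity {n : ℕ} (s t : ℝ) (φ ψ : TS n → ℂ) (ξ : Sph n) (y : hyperplane (ξ : Rn n)) : ℂ :=
  ((‖y‖ ^ (2 * t) * (1 + ‖y‖ ^ 2) ^ (s - t) : ℝ) : ℂ) *
    (hat φ (TS.ofSphere ξ y) * conj (hat ψ (TS.ofSphere ξ y)))

/-- The inner product
`(φ, ψ)_{H^s_t} = (2π)⁻¹ ∫_{𝕊^{n-1}} ∫_{ξ^⊥} |y|^{2t} (1+|y|²)^{s-t} φ̂ conj(ψ̂) dy dξ`. -/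
def pair {n : ℕ} (s t : ℝ) (φ ψ : TS n → ℂ) : ℂ :=
  ((1 / (2 * Real.pi) : ℝ) : ℂ) *
    ∫ ξ, ∫ y, pairDensity s t φ ψ ξ y ∂(lebesgue (hyperplane (ξ : Rn n))) ∂(surface n)

/-- The double integral in `pair s t φ ψ` converges absolutely. -/
def PairConverges {n : ℕ} (s t : ℝ) (φ ψ : TS n → ℂ) : Prop :=
  (∀ᵐ ξ ∂(surface n), Integrable (pairDensity s t φ ψ ξ) (lebesgue (hyperplane (ξ : Rn n)))) ∧
  Integrable (fun ξ : Sph n => ∫ y, pairDensity s t φ ψ ξ y ∂(lebesgue (hyperplane (ξ : Rn n))))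
    (surface n) ∧
  Integrable (fun ξ : Sph n => ∫ y, ‖pairDensity s t φ ψ ξ y‖ ∂(lebesgue (hyperplane (ξ : Rn n))))
    (surface n)

/-- `‖φ‖²_{H^s_t} = (2π)⁻¹ ∫_{𝕊^{n-1}} ∫_{ξ^⊥} |y|^{2t} (1+|y|²)^{s-t} |φ̂(y,ξ)|² dy dξ`. -/
def normSq {n : ℕ} (s t : ℝ) (φ : TS n → ℂ) : ℝ :=
  1 / (2 * Real.pi) *
    ∫ ξ, ∫ y, ‖y‖ ^ (2 * t) * (1 + ‖y‖ ^ 2) ^ (s - t) * ‖hat φ (TS.ofSphere ξ y)‖ ^ 2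
      ∂(lebesgue (hyperplane (ξ : Rn n))) ∂(surface n)

/-! ### Momentum ray transforms -/

/-- `(I^k f)(x, ξ) = ∫_{-∞}^{∞} t^k f_{ij}(x + tξ) ξ^i ξ^j dt` on `T𝕊^{n-1}`. -/
def momentRay {n : ℕ} (k : ℕ) (f : Fin n → Fin n → 𝓢(Rn n, ℂ)) (p : TS n) : ℂ :=
  ∫ t : ℝ, (t : ℂ) ^ k *
    ∑ i, ∑ j, f i j (p.1.1 + t • p.1.2) * (p.1.2 i : ℂ) * (p.1.2 j : ℂ)

/-- `a_n = Γ((n-1)/2) / (2 π^{(n-1)/2})`. -/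
def constA (n : ℕ) : ℝ :=
  Real.Gamma (((n : ℝ) - 1) / 2) / (2 * Real.pi ^ (((n : ℝ) - 1) / 2))

/-- The functions on `T𝕊^{n-1}` that enter the Reshetnyak formula. -/
def formulaTerms {n : ℕ} (I0 I1 I2 : TS n → ℂ) : Set (TS n → ℂ) :=
  {I0, I1, I2, opZ I0, opZ I1, opQ I0, opW I0} ∪
    Set.range (fun i => mulX i I0) ∪ Set.range (fun i => opXi i I0) ∪
    Set.range (fun i => opXi i I1) ∪ Set.range (fun i => opZ (opXi i I0)) ∪
    Set.range (fun ij : Fin n × Fin n => opXi ij.1 (opXi ij.2 I0))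

end RayTransform

end

open RayTransform

noncomputable section

namespace RayTransform

open scoped FourierTransform LineDeriv

variable {n : ℕ}

/-! ### Coordinate multiplication, partial derivatives and the Fourier transform on `𝓢(ℝⁿ)` -/

/-! Put F = √(2π) f̂. The formula is an identity between integrals over pairs (y, ξ) with y ⊥ ξ, and
it already holds between the integrands. What remains is an integration formula that recovers ∫ h(y)
dy from such pairs.

Fourier side. By the slice theorem `fourierInt_ray`, the transform on ξ^⊥ of the ray transform of g
is √(2π) ĝ(y). On the line z = x + tξ one has t = ⟨ξ, z⟩, so a power of t is a coordinate
multiplication and becomes iξ^l∂_l: the transform of I^k f is i^k (ξ·∂)^k F(ξ, ξ). The derivation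
Ξ_i moves z by an infinitesimal rotation, and rotations commute with the Fourier transform, so Ξ_i
does too (`RayRep.opXi`); multiplication by x_i becomes iX_i (`RayRep.mulX`). The operators Z, Q, W
contract with y/|y|, which is bounded and continuous off y = 0, so they act as expected there
(`hasSymbol_invHat`). Hence for y ≠ 0 every function in the formula has as its transform an explicit
contraction of the 2-jet of F at y with ξ and y.

Pointwise identity. Ξ_iΞ_j I⁰ contributes 2F_ij plus terms containing derivatives of F and
contractions with ξ. The other summands of the formula are what is needed to cancel the derivatives
and restore the contractions, and the bracket equals 4∑|F_ij(y)|². The identity is proved in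
polarized form as linear algebra (`reshetnyak_polar`), then applied to a jet and its complex
conjugate (`reshetnyak_pointwise`).

Integration. Shifting both orders by (m+1)/2 multiplies the weight by |y|·|y|^m
(`isFlagIntegral_pair`): the powers |y|^m enter the pointwise identity and one factor |y| is common
to all terms. That factor is what a_n ∫∫ |y| h(y) dy dξ = ∫ h(y) dy requires
(`constA_mul_integral_flagMeasure`). The latter comes from the Gaussian average of h(y) δ_ε(⟨y, η⟩)
over (y, η), computed in both orders as ε → 0: integrating in η first yields π^{(n-1)/2}/|y|,
integrating in y first yields ½Γ((n-1)/2) times the integral over orthogonal pairs. Finally |F|² =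
2π|f̂|² cancels the factor 1/(2π) of the norms. -/

theorem coord_hasTemperateGrowth (q : Fin n) :
    (fun z : Rn n => (z q : ℂ)).HasTemperateGrowth :=
  (Complex.ofRealCLM.comp (EuclideanSpace.proj q : Rn n →L[ℝ] ℝ)).hasTemperateGrowth

/-- Multiplication of a Schwartz function by the coordinate `z_q`. -/
def coordMul (q : Fin n) : 𝓢(Rn n, ℂ) →L[ℂ] 𝓢(Rn n, ℂ) :=
  SchwartzMap.smulLeftCLM ℂ (fun z : Rn n => (z q : ℂ))

theorem coordMul_apply (q : Fin n) (g : 𝓢(Rn n, ℂ)) (z : Rn n) :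
    coordMul q g z = (z q : ℂ) * g z := by
  simp [coordMul, SchwartzMap.smulLeftCLM_apply_apply (coord_hasTemperateGrowth q)]

/-- The partial derivative `∂_q` of a Schwartz function. -/
def partialD (q : Fin n) (g : 𝓢(Rn n, ℂ)) : 𝓢(Rn n, ℂ) :=
  ∂_{(EuclideanSpace.single q (1 : ℝ) : Rn n)} g

theorem partialD_apply (q : Fin n) (g : 𝓢(Rn n, ℂ)) (x : Rn n) :
    partialD q g x = fderiv ℝ g x (EuclideanSpace.single q 1) :=
  SchwartzMap.lineDerivOp_apply_eq_fderiv _ _ _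

theorem eq_sum_single (v : Rn n) : v = ∑ q, v q • (EuclideanSpace.single q 1 : Rn n) := by
  simpa using ((EuclideanSpace.basisFun (Fin n) ℝ).sum_repr v).symm

theorem fderiv_schwartz_apply (g : 𝓢(Rn n, ℂ)) (x v : Rn n) :
    fderiv ℝ g x v = ∑ q, (v q : ℂ) * partialD q g x := by
  conv_lhs => rw [eq_sum_single v]
  simp [map_sum, partialD_apply]

/-- The Fourier transform `(2π)^{-n/2} ∫ e^{-i⟨y,x⟩} g(x) dx` on Schwartz functions. -/
def sFourier (g : 𝓢(Rn n, ℂ)) : 𝓢(Rn n, ℂ) :=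
  fourierConst (Rn n) • SchwartzMap.compCLMOfContinuousLinearEquiv ℂ
    (ContinuousLinearEquiv.smulLeft (R₁ := ℝ) (M₁ := Rn n)
      (Units.mk0 (2 * Real.pi)⁻¹ (by positivity))) (𝓕 g)

theorem sFourier_apply' (g : 𝓢(Rn n, ℂ)) (y : Rn n) :
    sFourier g y = fourierConst (Rn n) * 𝓕 g ((2 * Real.pi)⁻¹ • y) := by
  rfl

theorem sFourier_apply (g : 𝓢(Rn n, ℂ)) (y : Rn n) : sFourier g y = fourierInt g y := by
  rw [sFourier_apply', SchwartzMap.fourier_coe, Real.fourier_eq', fourierInt, lebesgue]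
  congr 1
  refine integral_congr_ae (Eventually.of_forall fun x => ?_)
  simp only [smul_eq_mul]
  congr 2
  rw [inner_smul_right, real_inner_comm]
  have := Real.pi_ne_zero
  push_cast
  field_simp

theorem fourier_schwartz (g : 𝓢(Rn n, ℂ)) (y : Rn n) : fourier g y = sFourier g y := by
  rw [sFourier_apply, fourier_eq_fourierInt (g.integrable (μ := volume))]

theorem coordMul_eq (q : Fin n) (g : 𝓢(Rn n, ℂ)) : coordMul q g =
    SchwartzMap.smulLeftCLM ℂ (inner ℝ · (EuclideanSpace.single q 1 : Rn n)) g := by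
  ext z
  have : (inner ℝ · (EuclideanSpace.single q 1 : Rn n)).HasTemperateGrowth := by fun_prop
  rw [SchwartzMap.smulLeftCLM_apply_apply this, coordMul_apply]
  simp [EuclideanSpace.inner_single_right]

theorem sFourier_coordMul (q : Fin n) (g : 𝓢(Rn n, ℂ)) (y : Rn n) :
    sFourier (coordMul q g) y = Complex.I * partialD q (sFourier g) y := by
  have h := SchwartzMap.lineDerivOp_fourier_eq g (EuclideanSpace.single q 1 : Rn n)
  rw [← coordMul_eq] at h
  -- The chain rule for the dilation by (2π)⁻¹ supplies the factor that turns the -2πi of Mathlib's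
  -- normalization into -i.
  have h1 : partialD q (sFourier g) y = fourierConst (Rn n) * ((2 * Real.pi)⁻¹ : ℝ) *
      (∂_{(EuclideanSpace.single q (1 : ℝ) : Rn n)} (𝓕 g)) ((2 * Real.pi)⁻¹ • y) := by
    rw [partialD, sFourier, LineDeriv.lineDerivOp_smul,
      SchwartzMap.lineDerivOp_compCLMOfContinuousLinearEquiv]
    have e : (ContinuousLinearEquiv.smulLeft (R₁ := ℝ) (M₁ := Rn n)
        (Units.mk0 (2 * Real.pi)⁻¹ (by positivity))) (EuclideanSpace.single q (1 : ℝ)) =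
        (2 * Real.pi)⁻¹ • (EuclideanSpace.single q (1 : ℝ) : Rn n) := rfl
    rw [e, LineDeriv.lineDerivOp_left_smul]
    change fourierConst (Rn n) * (((2 * Real.pi)⁻¹ : ℝ) • _) = _
    rw [Complex.real_smul, mul_assoc]
    rfl
  rw [h1, h, sFourier_apply', FourierTransform.fourier_smul]
  have := Real.pi_ne_zero
  simp only [smul_apply, smul_eq_mul]
  push_cast
  field_simp
  rw [Complex.I_sq]
  ring

theorem sFourier_partialD (q : Fin n) (g : 𝓢(Rn n, ℂ)) (y : Rn n) :
    sFourier (partialD q g) y = Complex.I * (y q : ℂ) * sFourier g y := by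
  have h := SchwartzMap.fourier_lineDerivOp_eq g (EuclideanSpace.single q 1 : Rn n)
  rw [← coordMul_eq] at h
  rw [sFourier_apply', sFourier_apply', partialD, h]
  have := Real.pi_ne_zero
  simp [coordMul_apply]
  field_simp

end RayTransform

end

noncomputable section

namespace RayTransform

open scoped FourierTransform LineDeriv

variable {n : ℕ}

/-! ### The ray transform of a Schwartz function -/

theorem schwartz_decay {V F : Type*} [NormedAddCommGroup V] [NormedSpace ℝ V]
    [NormedAddCommGroup F] [NormedSpace ℝ F] (g : 𝓢(V, F)) (k : ℕ) :
    ∃ C : ℝ, 0 < C ∧ ∀ x, (1 + ‖x‖) ^ k * ‖g x‖ ≤ C := by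
  refine ⟨2 ^ k * ((Finset.Iic (k, 0)).sup fun m => SchwartzMap.seminorm ℝ m.1 m.2) g + 1,
    by positivity, fun x => ?_⟩
  have := SchwartzMap.one_add_le_sup_seminorm_apply (𝕜 := ℝ) (m := (k, 0)) (k := k) (n := 0)
    le_rfl le_rfl g x
  rw [norm_iteratedFDeriv_zero] at this
  linarith

/-- The integral of `g` along the line `t ↦ x + tξ`. -/
def ray (g : 𝓢(Rn n, ℂ)) (q : Rn n × Rn n) : ℂ := ∫ t : ℝ, g (q.1 + t • q.2)

/-- Within distance 1/2 of a pair with unit direction the direction keeps length at least 1/2, so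
the line still escapes linearly. The bound is uniform over this neighbourhood, as differentiation
under the integral sign requires. -/
theorem one_add_abs_le (q q' : Rn n × Rn n) (hq : ‖q.2‖ = 1) (h : ‖q' - q‖ ≤ 1 / 2) (t : ℝ) :
    1 + |t| ≤ (2 * ‖q.1‖ + 3) * (1 + ‖q'.1 + t • q'.2‖) := by
  have h1 : ‖q'.1 - q.1‖ ≤ 1 / 2 := (norm_fst_le (q' - q)).trans h
  have h2 : ‖q'.2 - q.2‖ ≤ 1 / 2 := (norm_snd_le (q' - q)).trans h
  have h3 : 1 / 2 ≤ ‖q'.2‖ := by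
    have := norm_sub_norm_le q.2 q'.2
    rw [norm_sub_rev] at this
    linarith
  have h4 : ‖q'.1‖ ≤ ‖q.1‖ + 1 / 2 := by
    have := norm_sub_norm_le q'.1 q.1
    linarith
  have h5 : |t| * ‖q'.2‖ ≤ ‖q'.1 + t • q'.2‖ + ‖q'.1‖ := by
    have := norm_sub_le (q'.1 + t • q'.2) q'.1
    rwa [add_sub_cancel_left, norm_smul, Real.norm_eq_abs] at this
  have h6 : |t| * (1 / 2) ≤ |t| * ‖q'.2‖ := by gcongr
  have := norm_nonneg (q'.1 + t • q'.2)
  have := norm_nonneg q.1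
  nlinarith

/-- Three powers of decay are spent: one on the factor 1 + |t| that appears when the direction is
differentiated, two on integrability in t. -/
theorem schwartz_line_bound {F : Type*} [NormedAddCommGroup F] [NormedSpace ℝ F]
    (g : 𝓢(Rn n, F)) (q : Rn n × Rn n) (hq : ‖q.2‖ = 1) :
    ∃ C : ℝ, 0 < C ∧ ∀ q' : Rn n × Rn n, ‖q' - q‖ ≤ 1 / 2 → ∀ t : ℝ,
      (1 + |t|) * ‖g (q'.1 + t • q'.2)‖ ≤ C * (1 + ‖t‖) ^ (-2 : ℝ) := by
  obtain ⟨C, hC, h⟩ := schwartz_decay g 3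
  refine ⟨(2 * ‖q.1‖ + 3) ^ 3 * C, by positivity, fun q' hq' t => ?_⟩
  have h1 := one_add_abs_le q q' hq hq' t
  have h2 := h (q'.1 + t • q'.2)
  have ht : 0 < 1 + |t| := by positivity
  rw [Real.norm_eq_abs, Real.rpow_neg ht.le, ← div_eq_mul_inv, le_div_iff₀ (by positivity)]
  rw [show (2 : ℝ) = ((2 : ℕ) : ℝ) by norm_num, Real.rpow_natCast]
  calc (1 + |t|) * ‖g (q'.1 + t • q'.2)‖ * (1 + |t|) ^ 2
      = (1 + |t|) ^ 3 * ‖g (q'.1 + t • q'.2)‖ := by ring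
    _ ≤ ((2 * ‖q.1‖ + 3) * (1 + ‖q'.1 + t • q'.2‖)) ^ 3 * ‖g (q'.1 + t • q'.2)‖ := by gcongr
    _ = (2 * ‖q.1‖ + 3) ^ 3 * ((1 + ‖q'.1 + t • q'.2‖) ^ 3 * ‖g (q'.1 + t • q'.2)‖) := by ring
    _ ≤ _ := by push_cast; gcongr

theorem integrable_line_bound (C : ℝ) : Integrable (fun t : ℝ => C * (1 + ‖t‖) ^ (-2 : ℝ)) :=
  (integrable_one_add_norm (by simp)).const_mul C

theorem integrable_line {F : Type*} [NormedAddCommGroup F] [NormedSpace ℝ F]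
    (g : 𝓢(Rn n, F)) (q : Rn n × Rn n) (hq : ‖q.2‖ = 1) :
    Integrable (fun t : ℝ => g (q.1 + t • q.2)) := by
  obtain ⟨C, hC, h⟩ := schwartz_line_bound g q hq
  refine (integrable_line_bound C).mono' (Continuous.aestronglyMeasurable (by fun_prop))
    (Eventually.of_forall fun t => ?_)
  refine le_trans ?_ (h q (by simp) t)
  exact le_mul_of_one_le_left (norm_nonneg _) (by linarith [abs_nonneg t])

/-- The derivative of `q ↦ g (q.1 + t q.2)`. -/
def rayFDeriv (g : 𝓢(Rn n, ℂ)) (q : Rn n × Rn n) (t : ℝ) : Rn n × Rn n →L[ℝ] ℂ :=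
  (SchwartzMap.fderivCLM ℝ (Rn n) ℂ g (q.1 + t • q.2)).comp
    (ContinuousLinearMap.fst ℝ (Rn n) (Rn n) + t • ContinuousLinearMap.snd ℝ (Rn n) (Rn n))

theorem norm_rayFDeriv_le (g : 𝓢(Rn n, ℂ)) (q : Rn n × Rn n) (t : ℝ) :
    ‖rayFDeriv g q t‖ ≤ (1 + |t|) * ‖SchwartzMap.fderivCLM ℝ (Rn n) ℂ g (q.1 + t • q.2)‖ := by
  refine (ContinuousLinearMap.opNorm_comp_le _ _).trans ?_
  rw [mul_comm]
  gcongr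
  refine (norm_add_le _ _).trans ?_
  rw [norm_smul, Real.norm_eq_abs]
  have h1 := ContinuousLinearMap.norm_fst_le (𝕜 := ℝ) (E := Rn n) (F := Rn n)
  have h2 := ContinuousLinearMap.norm_snd_le (𝕜 := ℝ) (E := Rn n) (F := Rn n)
  have := mul_le_mul_of_nonneg_left h2 (abs_nonneg t)
  linarith

theorem continuous_rayFDeriv (g : 𝓢(Rn n, ℂ)) (q : Rn n × Rn n) :
    Continuous (rayFDeriv g q) := by
  unfold rayFDeriv
  have h1 : Continuous fun t : ℝ => SchwartzMap.fderivCLM ℝ (Rn n) ℂ g (q.1 + t • q.2) := by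
    fun_prop
  exact h1.clm_comp (by fun_prop)

theorem integrable_rayFDeriv (g : 𝓢(Rn n, ℂ)) (q : Rn n × Rn n) (hq : ‖q.2‖ = 1) :
    Integrable (rayFDeriv g q) := by
  obtain ⟨C, hC, h⟩ := schwartz_line_bound (SchwartzMap.fderivCLM ℝ (Rn n) ℂ g) q hq
  exact (integrable_line_bound C).mono' (continuous_rayFDeriv g q).aestronglyMeasurable
    (Eventually.of_forall fun t => (norm_rayFDeriv_le g q t).trans (h q (by simp) t))

/-- Differentiation under the integral sign. `ray g` is defined for all pairs of vectors and so is a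
differentiable extension off T𝕊^{n-1}, of the kind that `opXi_eq` asks for. -/
theorem hasFDerivAt_ray (g : 𝓢(Rn n, ℂ)) (q : Rn n × Rn n) (hq : ‖q.2‖ = 1) :
    HasFDerivAt (ray g) (∫ t, rayFDeriv g q t) q := by
  obtain ⟨C, hC, h⟩ := schwartz_line_bound (SchwartzMap.fderivCLM ℝ (Rn n) ℂ g) q hq
  refine hasFDerivAt_integral_of_dominated_of_fderiv_le (s := Metric.closedBall q (1 / 2))
    (bound := fun t => C * (1 + ‖t‖) ^ (-2 : ℝ))
    (F := fun q t => g (q.1 + t • q.2)) (F' := rayFDeriv g)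
    (Metric.closedBall_mem_nhds _ (by norm_num)) ?_ (integrable_line g q hq) ?_ ?_
    (integrable_line_bound C) ?_
  · exact Eventually.of_forall fun q' => Continuous.aestronglyMeasurable (by fun_prop)
  · exact (continuous_rayFDeriv g q).aestronglyMeasurable
  · refine Eventually.of_forall fun t q' hq' => ?_
    exact (norm_rayFDeriv_le g q' t).trans (h q' (by simpa [dist_eq_norm] using hq') t)
  · refine Eventually.of_forall fun t q' _ => ?_
    have h1 : HasFDerivAt (fun q : Rn n × Rn n => q.1 + t • q.2)
        (ContinuousLinearMap.fst ℝ (Rn n) (Rn n) + t • ContinuousLinearMap.snd ℝ (Rn n) (Rn n)) q' :=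
      hasFDerivAt_fst.add (hasFDerivAt_snd.const_smul t)
    exact (g.hasFDerivAt (q'.1 + t • q'.2)).comp q' h1

theorem fderiv_ray (g : 𝓢(Rn n, ℂ)) (q : Rn n × Rn n) (hq : ‖q.2‖ = 1) (v : Rn n × Rn n) :
    fderiv ℝ (ray g) q v = ∫ t : ℝ, fderiv ℝ g (q.1 + t • q.2) (v.1 + t • v.2) := by
  rw [(hasFDerivAt_ray g q hq).fderiv,
    ContinuousLinearMap.integral_apply (integrable_rayFDeriv g q hq)]
  rfl

/-! ### Splitting `ℝⁿ` into a hyperplane and its normal line -/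

/-- The measurable equivalence `(x, t) ↦ x + tξ` of `ξ^⊥ × ℝ` and `ℝⁿ`. -/
def splitEquiv (ξ : Rn n) (hξ : ‖ξ‖ = 1) : hyperplane ξ × ℝ ≃ᵐ Rn n :=
  (MeasurableEquiv.prodComm.trans ((MeasurableEquiv.prodCongr
    (LinearIsometryEquiv.toSpanUnitSingleton ξ hξ).toMeasurableEquiv
    (MeasurableEquiv.refl (hyperplane ξ))).trans (MeasurableEquiv.toLp 2 _))).trans
      (Submodule.span ℝ {ξ}).orthogonalDecomposition.symm.toMeasurableEquiv

theorem splitEquiv_apply (ξ : Rn n) (hξ : ‖ξ‖ = 1) (p : hyperplane ξ × ℝ) :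
    splitEquiv ξ hξ p = (p.1 : Rn n) + p.2 • ξ := by
  simp only [splitEquiv, MeasurableEquiv.prodCongr, MeasurableEquiv.trans_apply,
    LinearIsometryEquiv.coe_toMeasurableEquiv, Submodule.orthogonalDecomposition_symm_apply]
  exact add_comm _ _

theorem measurePreserving_splitEquiv (ξ : Rn n) (hξ : ‖ξ‖ = 1) :
    MeasurePreserving (splitEquiv ξ hξ) ((volume : Measure (hyperplane ξ)).prod volume) volume := by
  have h1 : MeasurePreserving (MeasurableEquiv.prodComm : hyperplane ξ × ℝ ≃ᵐ ℝ × hyperplane ξ)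
      ((volume : Measure (hyperplane ξ)).prod (volume : Measure ℝ))
      ((volume : Measure ℝ).prod volume) := Measure.measurePreserving_swap
  have h2 := ((LinearIsometryEquiv.toSpanUnitSingleton ξ hξ).measurePreserving).prod
    (MeasurePreserving.id (volume : Measure (hyperplane ξ)))
  have h3 := WithLp.volume_preserving_toLp (Submodule.span ℝ {ξ}) (hyperplane ξ)
  have h4 := (Submodule.span ℝ {ξ}).orthogonalDecomposition.symm.measurePreserving
  exact h4.comp (h3.comp (h2.comp h1))

theorem finrank_hyperplane_add_one {ξ : Rn n} (hξ : ‖ξ‖ = 1) :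
    finrank ℝ (hyperplane ξ) + 1 = n := by
  have h0 : ξ ≠ 0 := by rintro rfl; simp at hξ
  have h1 := Submodule.finrank_add_finrank_orthogonal (Submodule.span ℝ {ξ})
  rw [finrank_span_singleton h0, finrank_euclideanSpace_fin] at h1
  change 1 + finrank ℝ (hyperplane ξ) = n at h1
  omega

/-- The hyperplane has one dimension less, which is the source of every √(2π) below. -/
theorem fourierConst_hyperplane (ξ : Rn n) (hξ : ‖ξ‖ = 1) :
    fourierConst (hyperplane ξ) = (Real.sqrt (2 * Real.pi) : ℂ) * fourierConst (Rn n) := by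
  have hd := finrank_hyperplane_add_one hξ
  have hd' : (finrank ℝ (hyperplane ξ) : ℝ) = n - 1 := by
    have : ((finrank ℝ (hyperplane ξ) + 1 : ℕ) : ℝ) = n := by exact_mod_cast hd
    push_cast at this
    linarith
  rw [fourierConst, fourierConst, ← Complex.ofReal_mul, hd', finrank_euclideanSpace_fin,
    Real.sqrt_eq_rpow, ← Real.rpow_add (by positivity)]
  congr 2
  ring

theorem integrable_schwartz_split (g : 𝓢(Rn n, ℂ)) (ξ : Rn n) (hξ : ‖ξ‖ = 1) :
    Integrable (fun p : hyperplane ξ × ℝ => g ((p.1 : Rn n) + p.2 • ξ))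
      ((volume : Measure (hyperplane ξ)).prod volume) := by
  have := (measurePreserving_splitEquiv ξ hξ).integrable_comp_emb (g := g)
    (splitEquiv ξ hξ).measurableEmbedding
  have h := this.2 (g.integrable (μ := volume))
  refine h.congr (Eventually.of_forall fun p => ?_)
  simp [splitEquiv_apply]

theorem integrable_ray (g : 𝓢(Rn n, ℂ)) (ξ : Rn n) (hξ : ‖ξ‖ = 1) :
    Integrable (fun x : hyperplane ξ => ray g ((x : Rn n), ξ)) (lebesgue _) :=
  (integrable_schwartz_split g ξ hξ).integral_prod_left

/-- The Fourier slice theorem for the ray transform. -/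
theorem fourierInt_ray (g : 𝓢(Rn n, ℂ)) (ξ : Rn n) (hξ : ‖ξ‖ = 1) (y : hyperplane ξ) :
    fourierInt (fun x : hyperplane ξ => ray g ((x : Rn n), ξ)) y =
      (Real.sqrt (2 * Real.pi) : ℂ) * sFourier g y := by
  rw [sFourier_apply, fourierInt, fourierInt, fourierConst_hyperplane ξ hξ, mul_assoc]
  congr 2
  -- Since y ⊥ ξ, the phase is constant along each line and leaves the inner integral.
  have hyξ : inner ℝ (y : Rn n) ξ = 0 := by
    rw [real_inner_comm]
    exact Submodule.mem_orthogonal_singleton_iff_inner_right.1 y.2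
  have hint := integrable_schwartz_split g ξ hξ
  have e := (measurePreserving_splitEquiv ξ hξ).integral_comp
    (splitEquiv ξ hξ).measurableEmbedding
    (fun z => Complex.exp (-Complex.I * (inner ℝ (y : Rn n) z : ℝ)) * g z)
  rw [lebesgue, lebesgue, ← e, integral_prod]
  · refine integral_congr_ae (Eventually.of_forall fun x => ?_)
    simp only [ray, splitEquiv_apply]
    rw [← integral_const_mul]
    refine integral_congr_ae (Eventually.of_forall fun t => ?_)
    simp [inner_add_right, inner_smul_right, hyξ]
  · refine hint.bdd_mul (c := 1) (f := fun p : hyperplane ξ × ℝ =>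
      Complex.exp (-Complex.I * (inner ℝ (y : Rn n) (splitEquiv ξ hξ p) : ℝ)))
      ?_ ?_ |>.congr (Eventually.of_forall fun p => by simp [splitEquiv_apply])
    · simp only [splitEquiv_apply]
      exact Continuous.aestronglyMeasurable (by fun_prop)
    · refine Eventually.of_forall fun p => ?_
      rw [Complex.norm_exp]; simp

end RayTransform

end

noncomputable section

namespace RayTransform

open scoped ContDiff

variable {n : ℕ}

/-! ### Sums of ray transforms with coefficients depending on the direction -/

/-- `RayRep φ Ψ`: the function `φ` on `T𝕊^{n-1}` is a finite sum of functions
`p(ξ) ∫ g(x + tξ) dt` with `p` smooth and `g` Schwartz, and `Ψ` is the corresponding sum of the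
functions `p(ξ) √(2π) ĝ(y)`. -/
inductive RayRep : (TS n → ℂ) → (Rn n × Rn n → ℂ) → Prop
  | mul_ray (p : Rn n → ℂ) (hp : ContDiff ℝ ∞ p) (g : 𝓢(Rn n, ℂ)) :
      RayRep (fun q => p q.1.2 * ray g q.1)
        (fun z => p z.2 * ((Real.sqrt (2 * Real.pi) : ℂ) * sFourier g z.1))
  | add {φ₁ φ₂ Ψ₁ Ψ₂} : RayRep φ₁ Ψ₁ → RayRep φ₂ Ψ₂ →
      RayRep (fun q => φ₁ q + φ₂ q) (fun z => Ψ₁ z + Ψ₂ z)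

theorem inner_fibre (q : TS n) : inner ℝ q.1.1 q.1.2 = 0 := by
  rw [real_inner_comm]; exact q.2.2

theorem sum_mul_eq_zero (q : TS n) : ∑ i, (q.1.2 i : ℂ) * (q.1.1 i : ℂ) = 0 := by
  have h := inner_fibre q
  simp only [PiLp.inner_apply, RCLike.inner_apply, conj_trivial] at h
  exact_mod_cast h

theorem sum_sq_eq_one (q : TS n) : ∑ i, (q.1.2 i : ℂ) * (q.1.2 i : ℂ) = 1 := by
  have h : inner ℝ q.1.2 q.1.2 = (1 : ℝ) := by rw [real_inner_self_eq_norm_sq, q.2.1]; norm_num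
  simp only [PiLp.inner_apply, RCLike.inner_apply, conj_trivial] at h
  exact_mod_cast h

namespace RayRep

variable {φ φ₁ φ₂ : TS n → ℂ} {Ψ Ψ₁ Ψ₂ : Rn n × Rn n → ℂ}

theorem zero : RayRep (fun _ : TS n => 0) (fun _ => 0) := by
  simpa using mul_ray (n := n) (fun _ => 0) contDiff_const 0

theorem mul_dir (h : RayRep φ Ψ) {p : Rn n → ℂ} (hp : ContDiff ℝ ∞ p) :
    RayRep (fun q => p q.1.2 * φ q) (fun z => p z.2 * Ψ z) := by
  induction h with
  | mul_ray p' hp' g =>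
    simpa only [mul_assoc] using mul_ray (fun ξ => p ξ * p' ξ) (hp.mul hp') g
  | add _ _ h₁ h₂ => simpa only [mul_add] using h₁.add h₂

theorem neg (h : RayRep φ Ψ) : RayRep (fun q => -φ q) (fun z => -Ψ z) := by
  simpa using h.mul_dir (p := fun _ => -1) contDiff_const

theorem sub (h₁ : RayRep φ₁ Ψ₁) (h₂ : RayRep φ₂ Ψ₂) :
    RayRep (fun q => φ₁ q - φ₂ q) (fun z => Ψ₁ z - Ψ₂ z) := by
  simpa only [sub_eq_add_neg] using h₁.add h₂.neg

theorem sum {ι : Type*} (s : Finset ι) {φ : ι → TS n → ℂ} {Ψ : ι → Rn n × Rn n → ℂ}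
    (h : ∀ i, RayRep (φ i) (Ψ i)) :
    RayRep (fun q => ∑ i ∈ s, φ i q) (fun z => ∑ i ∈ s, Ψ i z) := by
  classical
  induction s using Finset.induction_on with
  | empty => simpa using zero
  | insert a s ha ih => simpa only [Finset.sum_insert ha] using (h a).add ih

theorem contDiff (h : RayRep φ Ψ) : ContDiff ℝ ∞ Ψ := by
  induction h with
  | mul_ray p hp g =>
    exact (hp.comp contDiff_snd).mul (contDiff_const.mul (((sFourier g).smooth ⊤).comp contDiff_fst))
  | add _ _ h₁ h₂ => exact h₁.add h₂

theorem differentiable (h : RayRep φ Ψ) : Differentiable ℝ Ψ :=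
  h.contDiff.differentiable (by simp)

/-- `opXi` is defined through an extension of φ, so its additivity needs extensions known to be
differentiable at the points of T𝕊^{n-1}. -/
theorem exists_extension (h : RayRep φ Ψ) : ∃ Φ : Rn n × Rn n → ℂ,
    (∀ q : TS n, Φ q.1 = φ q) ∧ ∀ q : TS n, DifferentiableAt ℝ Φ q.1 := by
  induction h with
  | mul_ray p hp g =>
    refine ⟨fun z => p z.2 * ray g z, fun _ => rfl, fun q => ?_⟩
    have h1 : DifferentiableAt ℝ p q.1.2 := hp.differentiable (by simp) _
    exact (h1.comp q.1 differentiableAt_snd).mul (hasFDerivAt_ray g q.1 q.2.1).differentiableAt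
  | add _ _ h₁ h₂ =>
    obtain ⟨Φ₁, e₁, d₁⟩ := h₁
    obtain ⟨Φ₂, e₂, d₂⟩ := h₂
    exact ⟨fun z => Φ₁ z + Φ₂ z, fun q => by simp [e₁, e₂], fun q => (d₁ q).add (d₂ q)⟩

theorem integrable_fibre (h : RayRep φ Ψ) (ξ : Rn n) (hξ : ‖ξ‖ = 1) :
    Integrable (fun x : hyperplane ξ => φ (TS.mk ξ hξ x)) (lebesgue _) := by
  induction h with
  | mul_ray p hp g => exact (integrable_ray g ξ hξ).const_mul (p ξ)
  | add _ _ h₁ h₂ => exact h₁.add h₂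

/-- The slice theorem applied term by term: a coefficient p(ξ) is constant on the fibre, and
integrability on the fibre makes the Gaussian summation in `fourier` superfluous. -/
theorem hat_eq (h : RayRep φ Ψ) (q : TS n) : hat φ q = Ψ q.1 := by
  rw [hat, fourier_eq_fourierInt (h.integrable_fibre _ _)]
  induction h with
  | mul_ray p hp g =>
    have := fourierInt_ray g q.1.2 q.2.1 q.fibre
    change fourierInt (fun x : hyperplane q.1.2 => p q.1.2 * ray g ((x : Rn n), q.1.2)) _ =
      p q.1.2 * (_ * sFourier g (q.fibre : Rn n))
    rw [← this, fourierInt, fourierInt, mul_left_comm (p q.1.2),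
      ← integral_const_mul (p q.1.2)]
    congr 1
    refine integral_congr_ae (Eventually.of_forall fun x => ?_)
    simp only
    ring
  | add h₁' h₂' h₁ h₂ =>
    refine Eq.trans ?_ (congrArg₂ (· + ·) h₁ h₂)
    simp only
    rw [fourierInt, fourierInt, fourierInt, ← mul_add, ← integral_add]
    · simp only [mul_add]
    · refine (h₁'.integrable_fibre q.1.2 q.2.1).bdd_mul (c := 1)
        (Continuous.aestronglyMeasurable (by fun_prop)) (Eventually.of_forall fun x => ?_)
      rw [Complex.norm_exp]; simp
    · refine (h₂'.integrable_fibre q.1.2 q.2.1).bdd_mul (c := 1)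
        (Continuous.aestronglyMeasurable (by fun_prop)) (Eventually.of_forall fun x => ?_)
      rw [Complex.norm_exp]; simp

theorem hat_eq_fun (h : RayRep φ Ψ) : hat φ = fun q => Ψ q.1 := funext h.hat_eq

/-- Schwartz decay in the fibre variable, uniformly in the direction. -/
theorem decay (h : RayRep φ Ψ) (k : ℕ) :
    ∃ C : ℝ, 0 < C ∧ ∀ z : Rn n × Rn n, ‖z.2‖ = 1 → (1 + ‖z.1‖) ^ k * ‖Ψ z‖ ≤ C := by
  induction h with
  | mul_ray p hp g =>
    obtain ⟨C, hC, h⟩ := schwartz_decay (sFourier g) k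
    -- The coefficient depends on the direction only, so compactness of the sphere bounds it.
    obtain ⟨B, hB⟩ := (isCompact_sphere (0 : Rn n) 1).exists_bound_of_continuousOn
      hp.continuous.continuousOn
    refine ⟨(|B| + 1) * (Real.sqrt (2 * Real.pi) + 1) * C, by positivity, fun z hz => ?_⟩
    rw [norm_mul, norm_mul, Complex.norm_real, Real.norm_eq_abs, abs_of_nonneg (Real.sqrt_nonneg _)]
    have h1 : ‖p z.2‖ ≤ |B| + 1 := by
      have := hB z.2 (by simp [hz])
      linarith [le_abs_self B]
    calc _ = ‖p z.2‖ * Real.sqrt (2 * Real.pi) * ((1 + ‖z.1‖) ^ k * ‖sFourier g z.1‖) := by ring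
      _ ≤ _ := by
        gcongr
        · linarith
        · exact h z.1
  | add _ _ h₁ h₂ =>
    obtain ⟨C₁, hC₁, h₁⟩ := h₁
    obtain ⟨C₂, hC₂, h₂⟩ := h₂
    refine ⟨C₁ + C₂, by positivity, fun z hz => ?_⟩
    refine le_trans ?_ (add_le_add (h₁ z hz) (h₂ z hz))
    rw [← mul_add]
    gcongr
    exact norm_add_le _ _

/-- The rotation field `z_q ∂_i - z_i ∂_q` on Schwartz functions. -/
def _root_.RayTransform.rot (q i : Fin n) (g : 𝓢(Rn n, ℂ)) : 𝓢(Rn n, ℂ) :=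
  coordMul q (partialD i g) - coordMul i (partialD q g)

end RayRep

/-! ### Rotation fields, coordinates and the line parameter under the ray transform -/

theorem sFourier_sub (g₁ g₂ : 𝓢(Rn n, ℂ)) (y : Rn n) :
    sFourier (g₁ - g₂) y = sFourier g₁ y - sFourier g₂ y := by
  simp [sFourier, sub_eq_add_neg, FourierTransform.fourier_add, FourierTransform.fourier_neg]

theorem partialD_eq_of_forall {g h : 𝓢(Rn n, ℂ)} {c : ℂ} {j : Fin n}
    (e : ∀ y, g y = c * (y j : ℂ) * h y) (q : Fin n) (y : Rn n) :
    partialD q g y = c * ((if q = j then 1 else 0) * h y + (y j : ℂ) * partialD q h y) := by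
  have e' : (g : Rn n → ℂ) = fun y => c * (y j : ℂ) * h y := funext e
  have h1 : HasFDerivAt (fun y : Rn n => (y j : ℂ))
      (Complex.ofRealCLM.comp (EuclideanSpace.proj j : Rn n →L[ℝ] ℝ)) y :=
    (Complex.ofRealCLM.comp (EuclideanSpace.proj j : Rn n →L[ℝ] ℝ)).hasFDerivAt
  have h2 : HasFDerivAt (fun y : Rn n => c * (y j : ℂ) * h y) _ y :=
    (h1.const_mul c).mul (h.hasFDerivAt y)
  rw [partialD_apply, e', h2.fderiv, partialD_apply]
  by_cases hqj : q = j
  · subst hqj; simp; ring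
  · simp [hqj, Ne.symm hqj]; ring

/-- The Fourier transform commutes with rotations, hence with their generators. -/
theorem sFourier_rot (q i : Fin n) (g : 𝓢(Rn n, ℂ)) (y : Rn n) :
    sFourier (rot q i g) y =
      (y q : ℂ) * partialD i (sFourier g) y - (y i : ℂ) * partialD q (sFourier g) y := by
  rw [rot, sFourier_sub, sFourier_coordMul, sFourier_coordMul,
    partialD_eq_of_forall (sFourier_partialD i g), partialD_eq_of_forall (sFourier_partialD q g)]
  -- The Kronecker terms of the two product rules coincide and cancel in the difference.
  have : (if q = i then (1 : ℂ) else 0) = if i = q then 1 else 0 := by simp only [eq_comm]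
  rw [this]
  linear_combination ((y i : ℂ) * partialD q (sFourier g) y
    - (y q : ℂ) * partialD i (sFourier g) y) * Complex.I_sq

/-- With z = x + tξ, the field Ξ_i moves z with velocity ⟨ξ, z⟩e_i - z_iξ, an infinitesimal
rotation. The parameter t enters only through z, because t = ⟨ξ, z⟩ on T𝕊^{n-1}. -/
theorem fieldXi_ray_arg (i : Fin n) (q : TS n) (t : ℝ) :
    (fieldXi i q.1).1 + t • (fieldXi i q.1).2 =
      inner ℝ q.1.2 (q.1.1 + t • q.1.2) • EuclideanSpace.single i 1 -
        (q.1.1 + t • q.1.2) i • q.1.2 := by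
  have h1 : inner ℝ q.1.2 (q.1.1 + t • q.1.2) = t := by
    rw [inner_add_right, q.2.2, inner_smul_right, real_inner_self_eq_norm_sq, q.2.1]; norm_num
  rw [h1]
  simp only [fieldXi, smul_sub, PiLp.add_apply, PiLp.smul_apply, add_smul, smul_eq_mul, mul_smul]
  abel

/-- Because no explicit t survives in the velocity, the derivative is again a sum of ray transforms
of Schwartz functions with coefficients in ξ. -/
theorem fderiv_ray_fieldXi (i : Fin n) (g : 𝓢(Rn n, ℂ)) (q : TS n) :
    fderiv ℝ (ray g) q.1 (fieldXi i q.1) = ∑ k, (q.1.2 k : ℂ) * ray (rot k i g) q.1 := by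
  rw [fderiv_ray g q.1 q.2.1]
  simp only [ray, ← integral_const_mul]
  rw [← integral_finsetSum]
  · refine integral_congr_ae (Eventually.of_forall fun t => ?_)
    simp only [fieldXi_ray_arg]
    generalize q.1.1 + t • q.1.2 = z
    rw [map_sub, map_smul, map_smul, ← partialD_apply, fderiv_schwartz_apply]
    simp only [rot, sub_apply, coordMul_apply, mul_sub, Finset.sum_sub_distrib]
    simp only [PiLp.inner_apply, RCLike.inner_apply, conj_trivial, Complex.real_smul]
    push_cast
    rw [Finset.sum_mul, Finset.mul_sum]
    congr 1 <;> refine Finset.sum_congr rfl fun k _ => ?_ <;> ring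
  · exact fun k _ => (integrable_line (rot k i g) q.1 q.2.1).const_mul _

/-- On the line z = x + tξ one has x_i = z_i - ξ_i⟨ξ, z⟩. -/
theorem ray_coordMul (i : Fin n) (g : 𝓢(Rn n, ℂ)) (q : TS n) :
    (q.1.1 i : ℂ) * ray g q.1 = ray (coordMul i g) q.1 -
      ∑ k, (q.1.2 i : ℂ) * (q.1.2 k : ℂ) * ray (coordMul k g) q.1 := by
  simp only [ray, ← integral_const_mul]
  rw [← integral_finsetSum, ← integral_sub]
  · refine integral_congr_ae (Eventually.of_forall fun t => ?_)
    simp only [coordMul_apply, PiLp.add_apply, PiLp.smul_apply, smul_eq_mul]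
    push_cast
    have h1 : ∑ k, (q.1.2 i : ℂ) * (q.1.2 k : ℂ) * (((q.1.1 k : ℂ) + t * (q.1.2 k : ℂ)) *
        g (q.1.1 + t • q.1.2)) = (q.1.2 i : ℂ) * (∑ k, (q.1.2 k : ℂ) * (q.1.1 k : ℂ)
          + t * ∑ k, (q.1.2 k : ℂ) * (q.1.2 k : ℂ)) * g (q.1.1 + t • q.1.2) := by
      rw [Finset.mul_sum, ← Finset.sum_add_distrib, Finset.mul_sum, Finset.sum_mul]
      refine Finset.sum_congr rfl fun k _ => ?_
      ring
    rw [h1, sum_mul_eq_zero, sum_sq_eq_one]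
    ring
  · exact integrable_line (coordMul i g) q.1 q.2.1
  · exact integrable_finsetSum _ fun k _ =>
      (integrable_line (coordMul k g) q.1 q.2.1).const_mul _
  · exact fun k _ => (integrable_line (coordMul k g) q.1 q.2.1).const_mul _

/-- This is t = ⟨ξ, x + tξ⟩, which reduces momentum transforms to ray transforms of coordinate
multiples. -/
theorem parameter_mul (g : 𝓢(Rn n, ℂ)) (q : TS n) (t : ℝ) :
    (t : ℂ) * g (q.1.1 + t • q.1.2) =
      ∑ k, (q.1.2 k : ℂ) * coordMul k g (q.1.1 + t • q.1.2) := by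
  simp only [coordMul_apply, PiLp.add_apply, PiLp.smul_apply, smul_eq_mul, ← mul_assoc]
  rw [← Finset.sum_mul]
  push_cast
  have h1 : ∑ k, (q.1.2 k : ℂ) * ((q.1.1 k : ℂ) + t * (q.1.2 k : ℂ)) =
      ∑ k, (q.1.2 k : ℂ) * (q.1.1 k : ℂ) + t * ∑ k, (q.1.2 k : ℂ) * (q.1.2 k : ℂ) := by
    rw [Finset.mul_sum, ← Finset.sum_add_distrib]
    refine Finset.sum_congr rfl fun k _ => ?_
    ring
  rw [h1, sum_mul_eq_zero, sum_sq_eq_one]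
  ring

/-! ### Stability of sums of ray transforms under Ξ_i and under multiplication by x_i -/

namespace RayRep

variable {φ φ₁ φ₂ : TS n → ℂ} {Ψ Ψ₁ Ψ₂ : Rn n × Rn n → ℂ}

theorem contDiff_coord (i : Fin n) : ContDiff ℝ ∞ (fun ξ : Rn n => (ξ i : ℂ)) :=
  (Complex.ofRealCLM.comp (EuclideanSpace.proj i : Rn n →L[ℝ] ℝ)).contDiff

theorem ray_rep (g : 𝓢(Rn n, ℂ)) : RayRep (fun q => ray g q.1)
    (fun z => (Real.sqrt (2 * Real.pi) : ℂ) * sFourier g z.1) := by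
  simpa using mul_ray (fun _ => 1) contDiff_const g

theorem fderiv_mul_sFourier {p : Rn n → ℂ} (hp : ContDiff ℝ ∞ p) (c : ℂ) (F : 𝓢(Rn n, ℂ))
    (z v : Rn n × Rn n) : fderiv ℝ (fun z : Rn n × Rn n => p z.2 * (c * F z.1)) z v =
      fderiv ℝ p z.2 v.2 * (c * F z.1) + p z.2 * (c * ∑ k, (v.1 k : ℂ) * partialD k F z.1) := by
  have h1 : HasFDerivAt (fun z : Rn n × Rn n => p z.2) _ z :=
    (hp.differentiable (by simp) z.2).hasFDerivAt.comp z hasFDerivAt_snd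
  have h2 : HasFDerivAt (fun z : Rn n × Rn n => F z.1) _ z :=
    (F.hasFDerivAt z.1).comp z hasFDerivAt_fst
  have h3 : HasFDerivAt (fun z : Rn n × Rn n => p z.2 * (c * F z.1)) _ z :=
    h1.mul (h2.const_mul c)
  rw [h3.fderiv]
  simp [← fderiv_schwartz_apply]
  ring

/-- Ξ_i commutes with the fibrewise Fourier transform. The symbol produced agrees with the
derivative of Ψ on T𝕊^{n-1} only, since the relation ⟨ξ, y⟩ = 0 is used. -/
theorem opXi (h : RayRep φ Ψ) (i : Fin n) : ∃ Ψ', RayRep (opXi i φ) Ψ' ∧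
    ∀ q : TS n, Ψ' q.1 = fderiv ℝ Ψ q.1 (fieldXi i q.1) := by
  induction h with
  | mul_ray p hp g =>
    have hp' : ContDiff ℝ ∞ fun ξ : Rn n => fderiv ℝ p ξ (EuclideanSpace.single i 1 - ξ i • ξ) := by
      refine (hp.fderiv_right (m := ∞) (by simp)).clm_apply ?_
      have : ContDiff ℝ ∞ (fun ξ : Rn n => ξ i) := (EuclideanSpace.proj i : Rn n →L[ℝ] ℝ).contDiff
      exact contDiff_const.sub (this.smul contDiff_id)
    have H := (mul_ray _ hp' g).add ((sum Finset.univ fun k =>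
      (ray_rep (rot k i g)).mul_dir (contDiff_coord k)).mul_dir hp)
    refine ⟨_, Eq.subst (motive := fun φ => RayRep φ _) ?_ H, fun q => ?_⟩
    · ext q
      symm
      rw [opXi_eq i _ (fun z => p z.2 * ray g z) (fun _ => rfl) q]
      · have h1 : HasFDerivAt (fun z : Rn n × Rn n => p z.2) _ q.1 :=
          (hp.differentiable (by simp) q.1.2).hasFDerivAt.comp q.1 hasFDerivAt_snd
        have h2 := (hasFDerivAt_ray g q.1 q.2.1)
        have h3 : HasFDerivAt (fun z : Rn n × Rn n => p z.2 * ray g z) _ q.1 := h1.mul h2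
        rw [h3.fderiv, ← h2.fderiv]
        simp only [add_apply, smul_apply,
          fderiv_ray_fieldXi]
        simp [fieldXi]
        ring
      · have h1 : DifferentiableAt ℝ p q.1.2 := hp.differentiable (by simp) _
        exact (h1.comp q.1 differentiableAt_snd).mul (hasFDerivAt_ray g q.1 q.2.1).differentiableAt
    · rw [fderiv_mul_sFourier hp]
      simp only [sFourier_rot]
      congr 2
      rw [Finset.mul_sum]
      -- Of the rotation term, the part with ξ^k y_k sums to zero; the part with -y_i ξ^k is the
      -- derivative along the first component of the field.
      have e1 : ∀ k, (q.1.2 k : ℂ) * ((Real.sqrt (2 * Real.pi) : ℂ) *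
          ((q.1.1 k : ℂ) * partialD i (sFourier g) q.1.1
            - (q.1.1 i : ℂ) * partialD k (sFourier g) q.1.1)) =
          ((q.1.2 k : ℂ) * (q.1.1 k : ℂ)) * ((Real.sqrt (2 * Real.pi) : ℂ) *
            partialD i (sFourier g) q.1.1) + (Real.sqrt (2 * Real.pi) : ℂ) *
            (((fieldXi i q.1).1 k : ℝ) * partialD k (sFourier g) q.1.1) := by
        intro k
        simp [fieldXi]
        ring
      simp only [e1]
      rw [Finset.sum_add_distrib, ← Finset.sum_mul, sum_mul_eq_zero, zero_mul, zero_add]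
  | @add φ₁ φ₂ Ψ₁ Ψ₂ h₁' h₂' h₁ h₂ =>
    obtain ⟨Ψ₁', r₁, e₁⟩ := h₁
    obtain ⟨Ψ₂', r₂, e₂⟩ := h₂
    refine ⟨_, Eq.subst (motive := fun φ => RayRep φ _) ?_ (r₁.add r₂), fun q => ?_⟩
    · ext q
      symm
      obtain ⟨Φ₁, E₁, D₁⟩ := h₁'.exists_extension
      obtain ⟨Φ₂, E₂, D₂⟩ := h₂'.exists_extension
      rw [opXi_eq i φ₁ Φ₁ E₁ q (D₁ q), opXi_eq i φ₂ Φ₂ E₂ q (D₂ q),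
        opXi_eq i _ (fun z => Φ₁ z + Φ₂ z) (fun q => by simp [E₁, E₂]) q ((D₁ q).add (D₂ q)),
        fderiv_fun_add (D₁ q) (D₂ q)]
      rfl
    · rw [fderiv_fun_add (h₁'.differentiable _) (h₂'.differentiable _), e₁, e₂]
      rfl

/-- In the fibre, x_i is the projected coordinate z_i - ξ_iξ^k z_k. Its Fourier counterpart is i
times differentiation along the projected vector e_i - ξ_iξ, which is X_i. -/
theorem mulX (h : RayRep φ Ψ) (i : Fin n) : ∃ Ψ', RayRep (mulX i φ) Ψ' ∧
    ∀ q : TS n, Ψ' q.1 = Complex.I * fderiv ℝ Ψ q.1 (fieldX i q.1) := by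
  induction h with
  | mul_ray p hp g =>
    have H := ((ray_rep (coordMul i g)).sub (sum Finset.univ fun k =>
      (ray_rep (coordMul k g)).mul_dir ((contDiff_coord i).mul (contDiff_coord k)))).mul_dir hp
    refine ⟨_, Eq.subst (motive := fun φ => RayRep φ _) ?_ H, fun q => ?_⟩
    · ext q
      symm
      rw [← ray_coordMul, RayTransform.mulX]
      ring
    · rw [fderiv_mul_sFourier hp]
      simp only [sFourier_coordMul]
      rw [← fderiv_schwartz_apply]
      simp only [fieldX, map_sub, map_smul, map_zero, zero_mul, zero_add]
      rw [← partialD_apply, fderiv_schwartz_apply]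
      simp only [Complex.real_smul, mul_sub, Finset.mul_sum]
      congr 1
      · ring
      · refine Finset.sum_congr rfl fun k _ => ?_
        ring
  | @add φ₁ φ₂ Ψ₁ Ψ₂ h₁' h₂' h₁ h₂ =>
    obtain ⟨Ψ₁', r₁, e₁⟩ := h₁
    obtain ⟨Ψ₂', r₂, e₂⟩ := h₂
    refine ⟨_, Eq.subst (motive := fun φ => RayRep φ _) ?_ (r₁.add r₂), fun q => ?_⟩
    · ext q
      symm
      simp [RayTransform.mulX, mul_add]
    · rw [fderiv_fun_add (h₁'.differentiable _) (h₂'.differentiable _), e₁, e₂, ← mul_add]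
      rfl

end RayRep

end RayTransform

end

noncomputable section

namespace RayTransform

open scoped ContDiff

variable {n : ℕ}

/-! ### Fourier transforms of the momentum ray transforms and of their derivatives -/

/-- `F_{ij}(y) u^i v^j`. -/
def form0 (F : Fin n → Fin n → 𝓢(Rn n, ℂ)) (y u v : Rn n) : ℂ :=
  ∑ i, ∑ j, (u i : ℂ) * (v j : ℂ) * F i j y

/-- `w^k ∂_k F_{ij}(y) u^i v^j`. -/
def form1 (F : Fin n → Fin n → 𝓢(Rn n, ℂ)) (y w u v : Rn n) : ℂ :=
  ∑ k, (w k : ℂ) * form0 (fun i j => partialD k (F i j)) y u v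

/-- `w^k z^l ∂_k ∂_l F_{ij}(y) u^i v^j`. -/
def form2 (F : Fin n → Fin n → 𝓢(Rn n, ℂ)) (y w z u v : Rn n) : ℂ :=
  ∑ l, (z l : ℂ) * form1 (fun i j => partialD l (F i j)) y w u v

/-! ### Linearity and symmetry of the contractions -/

section Forms

variable (F : Fin n → Fin n → 𝓢(Rn n, ℂ)) (y : Rn n)

theorem form0_symm (hF : ∀ i j, F i j = F j i) (u v : Rn n) : form0 F y u v = form0 F y v u := by
  rw [form0, form0, Finset.sum_comm]
  refine Finset.sum_congr rfl fun i _ => Finset.sum_congr rfl fun j _ => ?_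
  rw [hF, mul_comm (u j : ℂ)]

theorem form1_symm (hF : ∀ i j, F i j = F j i) (w u v : Rn n) :
    form1 F y w u v = form1 F y w v u := by
  rw [form1, form1]
  refine Finset.sum_congr rfl fun k _ => ?_
  rw [form0_symm _ _ (fun i j => by rw [hF])]

theorem form0_sub_smul (u u' v : Rn n) (s : ℝ) :
    form0 F y (u - s • u') v = form0 F y u v - s * form0 F y u' v := by
  simp only [form0, Finset.mul_sum, ← Finset.sum_sub_distrib]
  refine Finset.sum_congr rfl fun i _ => Finset.sum_congr rfl fun j _ => ?_
  simp only [PiLp.sub_apply, PiLp.smul_apply, smul_eq_mul]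
  push_cast
  ring

theorem form1_sub_smul (w u u' v : Rn n) (s : ℝ) :
    form1 F y w (u - s • u') v = form1 F y w u v - s * form1 F y w u' v := by
  simp only [form1, form0_sub_smul, Finset.mul_sum, ← Finset.sum_sub_distrib]
  exact Finset.sum_congr rfl fun i _ => by ring

theorem form1_sub_smul_dir (w w' u v : Rn n) (s : ℝ) :
    form1 F y (w - s • w') u v = form1 F y w u v - s * form1 F y w' u v := by
  simp only [form1, Finset.mul_sum, ← Finset.sum_sub_distrib]
  refine Finset.sum_congr rfl fun i _ => ?_
  simp only [PiLp.sub_apply, PiLp.smul_apply, smul_eq_mul]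
  push_cast
  ring

theorem form1_neg_smul_dir (w u v : Rn n) (s : ℝ) :
    form1 F y (-(s • w)) u v = -(s * form1 F y w u v) := by
  simp only [form1, Finset.mul_sum, ← Finset.sum_neg_distrib]
  refine Finset.sum_congr rfl fun i _ => ?_
  simp only [PiLp.neg_apply, PiLp.smul_apply, smul_eq_mul]
  push_cast
  ring

theorem form2_neg_smul_dir (w z u v : Rn n) (s : ℝ) :
    form2 F y (-(s • w)) z u v = -(s * form2 F y w z u v) := by
  simp only [form2, form1_neg_smul_dir, Finset.mul_sum, ← Finset.sum_neg_distrib]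
  exact Finset.sum_congr rfl fun i _ => by ring

theorem form0_single (j : Fin n) (v : Rn n) :
    form0 F y (EuclideanSpace.single j 1) v = ∑ k, F j k y * (v k : ℂ) := by
  rw [form0, Finset.sum_eq_single j]
  · simp [mul_comm]
  · intro i _ hij
    simp [hij]
  · simp

theorem form0_single_single (i j : Fin n) :
    form0 F y (EuclideanSpace.single i 1) (EuclideanSpace.single j 1) = F i j y := by
  rw [form0_single, Finset.sum_eq_single j]
  · simp
  · intro k _ hk
    simp [hk]
  · simp

theorem sum_form0_single (u v : Rn n) :
    ∑ i, (u i : ℂ) * form0 F y (EuclideanSpace.single i 1) v = form0 F y u v := by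
  simp only [form0_single, Finset.mul_sum]
  exact Finset.sum_congr rfl fun i _ => Finset.sum_congr rfl fun j _ => by ring

theorem sum_form1_single (w u v : Rn n) :
    ∑ i, (u i : ℂ) * form1 F y w (EuclideanSpace.single i 1) v = form1 F y w u v := by
  simp only [form1, Finset.mul_sum]
  rw [Finset.sum_comm]
  refine Finset.sum_congr rfl fun k _ => ?_
  rw [← sum_form0_single, Finset.mul_sum]
  exact Finset.sum_congr rfl fun i _ => by ring

theorem form1_single (k : Fin n) (u v : Rn n) :
    form1 F y (EuclideanSpace.single k 1) u v = form0 (fun i j => partialD k (F i j)) y u v := by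
  rw [form1, Finset.sum_eq_single k]
  · simp
  · intro i _ hi
    simp [hi]
  · simp

theorem sum_form1_single_dir (w u v : Rn n) :
    ∑ i, (w i : ℂ) * form1 F y (EuclideanSpace.single i 1) u v = form1 F y w u v := by
  simp only [form1_single]
  rfl

end Forms

/-! ### Derivatives of the contractions along curves -/

section Derivatives

variable (F : Fin n → Fin n → 𝓢(Rn n, ℂ))

theorem hasDerivAt_coord {x : ℝ → Rn n} {x' : Rn n} {r : ℝ} (h : HasDerivAt x x' r) (i : Fin n) :
    HasDerivAt (fun r => (x r i : ℂ)) (x' i : ℂ) r :=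
  (Complex.ofRealCLM.comp (EuclideanSpace.proj i : Rn n →L[ℝ] ℝ)).hasFDerivAt.comp_hasDerivAt r h

theorem hasDerivAt_schwartz_comp (g : 𝓢(Rn n, ℂ)) {x : ℝ → Rn n} {x' : Rn n} {r : ℝ}
    (h : HasDerivAt x x' r) :
    HasDerivAt (fun r => g (x r)) (∑ k, (x' k : ℂ) * partialD k g (x r)) r := by
  rw [← fderiv_schwartz_apply]
  exact (g.hasFDerivAt (x r)).comp_hasDerivAt r h

/-- Motion of the base point raises the jet order by one; motion of a vector argument replaces it by
its velocity. -/
theorem hasDerivAt_form0 {x u v : ℝ → Rn n} {x' u' v' : Rn n} {r : ℝ} (hx : HasDerivAt x x' r)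
    (hu : HasDerivAt u u' r) (hv : HasDerivAt v v' r) :
    HasDerivAt (fun r => form0 F (x r) (u r) (v r))
      (form1 F (x r) x' (u r) (v r) + form0 F (x r) u' (v r) + form0 F (x r) (u r) v') r := by
  unfold form0
  have H := HasDerivAt.fun_sum (u := Finset.univ) fun i _ => HasDerivAt.fun_sum (u := Finset.univ)
    fun j _ => ((hasDerivAt_coord hu i).fun_mul (hasDerivAt_coord hv j)).fun_mul
      (hasDerivAt_schwartz_comp (F i j) hx)
  refine H.congr_deriv ?_
  have e : form1 F (x r) x' (u r) (v r) = ∑ i, ∑ j, (u r i : ℂ) * (v r j : ℂ) *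
      ∑ k, (x' k : ℂ) * partialD k (F i j) (x r) := by
    simp only [form1, form0, Finset.mul_sum]
    rw [Finset.sum_comm]
    refine Finset.sum_congr rfl fun i _ => ?_
    rw [Finset.sum_comm]
    exact Finset.sum_congr rfl fun j _ => Finset.sum_congr rfl fun k _ => by ring
  rw [e]
  simp only [← Finset.sum_add_distrib]
  exact Finset.sum_congr rfl fun i _ => Finset.sum_congr rfl fun j _ => by ring

theorem hasDerivAt_form1 {x w u v : ℝ → Rn n} {x' w' u' v' : Rn n} {r : ℝ} (hx : HasDerivAt x x' r)
    (hw : HasDerivAt w w' r) (hu : HasDerivAt u u' r) (hv : HasDerivAt v v' r) :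
    HasDerivAt (fun r => form1 F (x r) (w r) (u r) (v r))
      (form2 F (x r) x' (w r) (u r) (v r) + form1 F (x r) w' (u r) (v r)
        + form1 F (x r) (w r) u' (v r) + form1 F (x r) (w r) (u r) v') r := by
  have H := HasDerivAt.fun_sum (u := Finset.univ) fun k _ => (hasDerivAt_coord hw k).fun_mul
    (hasDerivAt_form0 (fun i j => partialD k (F i j)) hx hu hv)
  refine H.congr_deriv ?_
  rw [form1, form1, form1, form2, ← Finset.sum_add_distrib, ← Finset.sum_add_distrib,
    ← Finset.sum_add_distrib]
  exact Finset.sum_congr rfl fun k _ => by ring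

theorem contDiff_form0_comp {E : Type*} [NormedAddCommGroup E] [NormedSpace ℝ E]
    {x u v : E → Rn n} (hx : ContDiff ℝ ∞ x) (hu : ContDiff ℝ ∞ u) (hv : ContDiff ℝ ∞ v) :
    ContDiff ℝ ∞ (fun z => form0 F (x z) (u z) (v z)) := by
  unfold form0
  refine ContDiff.sum fun i _ => ContDiff.sum fun j _ => ?_
  exact (((RayRep.contDiff_coord i).comp hu).mul ((RayRep.contDiff_coord j).comp hv)).mul
    (((F i j).smooth ⊤).comp hx)

theorem contDiff_form1_comp {E : Type*} [NormedAddCommGroup E] [NormedSpace ℝ E]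
    {x w u v : E → Rn n} (hx : ContDiff ℝ ∞ x) (hw : ContDiff ℝ ∞ w) (hu : ContDiff ℝ ∞ u)
    (hv : ContDiff ℝ ∞ v) : ContDiff ℝ ∞ (fun z => form1 F (x z) (w z) (u z) (v z)) := by
  unfold form1
  exact ContDiff.sum fun k _ => ((RayRep.contDiff_coord k).comp hw).mul
    (contDiff_form0_comp _ hx hu hv)

/-- A directional derivative is computed on a straight line, so the one-variable product rules for
the contractions apply. -/
theorem fderiv_eq_of_hasDerivAt {E : Rn n × Rn n → ℂ} {z v : Rn n × Rn n}
    (hE : DifferentiableAt ℝ E z) {e : ℂ}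
    (h : HasDerivAt (fun r : ℝ => E (z.1 + r • v.1, z.2 + r • v.2)) e 0) : fderiv ℝ E z v = e := by
  have hl : HasDerivAt (fun r : ℝ => (z.1 + r • v.1, z.2 + r • v.2)) v 0 := by
    have h1 : HasDerivAt (fun r : ℝ => z.1 + r • v.1) v.1 0 := by
      simpa using ((hasDerivAt_id (0 : ℝ)).smul_const v.1).const_add z.1
    have h2 : HasDerivAt (fun r : ℝ => z.2 + r • v.2) v.2 0 := by
      simpa using ((hasDerivAt_id (0 : ℝ)).smul_const v.2).const_add z.2
    exact h1.prodMk h2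
  have hE' : HasFDerivAt E (fderiv ℝ E z) (z.1 + (0 : ℝ) • v.1, z.2 + (0 : ℝ) • v.2) := by
    simpa using hE.hasFDerivAt
  exact (hE'.comp_hasDerivAt 0 hl).unique h

theorem hasDerivAt_line (x v : Rn n) : HasDerivAt (fun r : ℝ => x + r • v) v 0 := by
  simpa using ((hasDerivAt_id (0 : ℝ)).smul_const v).const_add x

end Derivatives

/-! ### Explicit Fourier transforms of the functions in the formula -/

section Hat

theorem form0_congr_mul {F G : Fin n → Fin n → 𝓢(Rn n, ℂ)} {c : ℂ}
    (h : ∀ i j y, G i j y = c * F i j y) (y u v : Rn n) : form0 G y u v = c * form0 F y u v := by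
  simp only [form0, h, Finset.mul_sum]
  exact Finset.sum_congr rfl fun i _ => Finset.sum_congr rfl fun j _ => by ring

theorem partialD_congr_mul {F G : 𝓢(Rn n, ℂ)} {c : ℂ} (h : ∀ y, G y = c * F y) (k : Fin n)
    (y : Rn n) : partialD k G y = c * partialD k F y := by
  have e : (G : Rn n → ℂ) = fun y => c * F y := funext h
  rw [partialD_apply, partialD_apply, e, fderiv_const_mul F.differentiableAt]
  rfl

theorem form1_congr_mul {F G : Fin n → Fin n → 𝓢(Rn n, ℂ)} {c : ℂ}
    (h : ∀ i j y, G i j y = c * F i j y) (y w u v : Rn n) :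
    form1 G y w u v = c * form1 F y w u v := by
  simp only [form1, Finset.mul_sum]
  refine Finset.sum_congr rfl fun k _ => ?_
  rw [form0_congr_mul (fun i j y => partialD_congr_mul (h i j) k y)]
  ring

/-- The tensor field `√(2π) f̂`. -/
def hatField (f : Fin n → Fin n → 𝓢(Rn n, ℂ)) (i j : Fin n) : 𝓢(Rn n, ℂ) :=
  (Real.sqrt (2 * Real.pi) : ℂ) • sFourier (f i j)

theorem hatField_apply (f : Fin n → Fin n → 𝓢(Rn n, ℂ)) (i j : Fin n) (y : Rn n) :
    hatField f i j y = (Real.sqrt (2 * Real.pi) : ℂ) * sFourier (f i j) y := rfl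

variable (f : Fin n → Fin n → 𝓢(Rn n, ℂ))

theorem hatField_coordMul (l i j : Fin n) (y : Rn n) :
    hatField (fun i j => coordMul l (f i j)) i j y = Complex.I * partialD l (hatField f i j) y := by
  rw [partialD_congr_mul (hatField_apply f i j), hatField_apply, sFourier_coordMul]
  ring

theorem integrable_momentRay (q : TS n) {k : ℕ} (hk : k ≤ 1) :
    Integrable (fun t : ℝ => (t : ℂ) ^ k *
      ∑ i, ∑ j, f i j (q.1.1 + t • q.1.2) * (q.1.2 i : ℂ) * (q.1.2 j : ℂ)) := by
  simp only [Finset.mul_sum]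
  refine integrable_finsetSum _ fun i _ => integrable_finsetSum _ fun j _ => ?_
  obtain ⟨C, hC, h⟩ := schwartz_line_bound (f i j) q.1 q.2.1
  have h1 : Integrable (fun t : ℝ => (t : ℂ) ^ k * f i j (q.1.1 + t • q.1.2)) := by
    refine (integrable_line_bound C).mono' (Continuous.aestronglyMeasurable (by fun_prop))
      (Eventually.of_forall fun t => ?_)
    refine le_trans ?_ (h q.1 (by simp) t)
    rw [norm_mul, norm_pow, Complex.norm_real, Real.norm_eq_abs]
    gcongr
    interval_cases k
    · simp
    · simp
  refine ((h1.mul_const (q.1.2 i : ℂ)).mul_const (q.1.2 j : ℂ)).congr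
    (Eventually.of_forall fun t => ?_)
  simp only
  ring

/-- One factor t is replaced by ξ^l z_l, so that I⁰, I¹, I² are treated successively. The case k ≤ 1
covers all that occur. -/
theorem momentRay_succ (q : TS n) {k : ℕ} (hk : k ≤ 1) : momentRay (k + 1) f q =
    ∑ l, (q.1.2 l : ℂ) * momentRay k (fun i j => coordMul l (f i j)) q := by
  simp only [momentRay, ← integral_const_mul]
  rw [← integral_finsetSum]
  · refine integral_congr_ae (Eventually.of_forall fun t => ?_)
    simp only
    have e : ∀ l, (q.1.2 l : ℂ) * ((t : ℂ) ^ k * ∑ i, ∑ j, coordMul l (f i j)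
        (q.1.1 + t • q.1.2) * (q.1.2 i : ℂ) * (q.1.2 j : ℂ)) = ∑ i, ∑ j,
          (t : ℂ) ^ k * ((q.1.2 i : ℂ) * (q.1.2 j : ℂ)) *
            ((q.1.2 l : ℂ) * coordMul l (f i j) (q.1.1 + t • q.1.2)) := fun l => by
      simp only [Finset.mul_sum]
      exact Finset.sum_congr rfl fun i _ => Finset.sum_congr rfl fun j _ => by ring
    simp only [e]
    symm
    rw [Finset.sum_comm, Finset.mul_sum]
    refine Finset.sum_congr rfl fun i _ => ?_
    rw [Finset.sum_comm, Finset.mul_sum]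
    refine Finset.sum_congr rfl fun j _ => ?_
    rw [← Finset.mul_sum, ← parameter_mul]
    ring
  · exact fun l _ => (integrable_momentRay (fun i j => coordMul l (f i j)) q hk).const_mul _

theorem momentRay_zero_rep : RayRep (momentRay 0 f) (fun z => form0 (hatField f) z.1 z.2 z.2) := by
  have H := RayRep.sum Finset.univ fun i : Fin n => RayRep.sum Finset.univ fun j : Fin n =>
    (RayRep.ray_rep (f i j)).mul_dir
      ((RayRep.contDiff_coord i).mul (RayRep.contDiff_coord j))
  refine Eq.subst (motive := fun φ => RayRep φ _) ?_ H
  ext q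
  symm
  simp only [momentRay, pow_zero, one_mul, ray, ← integral_const_mul]
  rw [integral_finsetSum _ fun i _ => ?_]
  · refine Finset.sum_congr rfl fun i _ => ?_
    rw [integral_finsetSum _ fun j _ => ?_]
    · refine Finset.sum_congr rfl fun j _ => integral_congr_ae (Eventually.of_forall fun t => ?_)
      simp only
      ring
    · exact ((integrable_line (f i j) q.1 q.2.1).mul_const _).mul_const _
  · exact integrable_finsetSum _ fun j _ =>
      ((integrable_line (f i j) q.1 q.2.1).mul_const _).mul_const _

/-- A factor ξ^l z_l under the integral becomes iξ^l∂_l on the Fourier side; used once more, it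
gives the sign i² = -1 for I². -/
theorem momentRay_one_rep : RayRep (momentRay 1 f)
    (fun z => Complex.I * form1 (hatField f) z.1 z.2 z.2 z.2) := by
  have H := RayRep.sum Finset.univ fun l : Fin n =>
    (momentRay_zero_rep (fun i j => coordMul l (f i j))).mul_dir (RayRep.contDiff_coord l)
  convert H using 1
  · ext q
    rw [momentRay_succ f q (by norm_num)]
  · ext z
    rw [form1, Finset.mul_sum]
    refine Finset.sum_congr rfl fun l _ => ?_
    rw [form0_congr_mul (hatField_coordMul f l)]
    ring

theorem momentRay_two_rep : RayRep (momentRay 2 f)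
    (fun z => -form2 (hatField f) z.1 z.2 z.2 z.2 z.2) := by
  have H := RayRep.sum Finset.univ fun l : Fin n =>
    (momentRay_one_rep (fun i j => coordMul l (f i j))).mul_dir (RayRep.contDiff_coord l)
  convert H using 1
  · ext q
    rw [momentRay_succ f q le_rfl]
  · ext z
    rw [form2, ← Finset.sum_neg_distrib]
    refine Finset.sum_congr rfl fun l _ => ?_
    rw [form1_congr_mul (hatField_coordMul f l)]
    linear_combination (-((z.2 l : ℂ) * form1 (fun i j => partialD l (hatField f i j)) z.1 z.2 z.2
      z.2)) * Complex.I_sq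

/-- Ξ_i is tangent to T𝕊^{n-1}, so any differentiable function equal to Ψ there may be
differentiated. For second derivatives this is essential: the formula for the first derivative is
known on T𝕊^{n-1} only. -/
theorem RayRep.hat_opXi {φ : TS n → ℂ} {Ψ E : Rn n × Rn n → ℂ} (h : RayRep φ Ψ)
    (hE : ∀ q : TS n, E q.1 = Ψ q.1) (hd : Differentiable ℝ E) (i : Fin n) (q : TS n) :
    hat (RayTransform.opXi i φ) q = fderiv ℝ E q.1 (fieldXi i q.1) := by
  obtain ⟨Ψ', r, e⟩ := h.opXi i
  rw [r.hat_eq, e, ← opXi_eq i (fun q => E q.1) E (fun _ => rfl) q (hd _),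
    opXi_eq i (fun q => E q.1) Ψ (fun q => (hE q).symm) q (h.differentiable _)]

theorem RayRep.hat_mulX {φ : TS n → ℂ} {Ψ : Rn n × Rn n → ℂ} (h : RayRep φ Ψ)
    (i : Fin n) (q : TS n) :
    hat (RayTransform.mulX i φ) q = Complex.I * fderiv ℝ Ψ q.1 (fieldX i q.1) := by
  obtain ⟨Ψ', r, e⟩ := h.mulX i
  rw [r.hat_eq, e]

variable {f}

theorem hatField_symm (hf : ∀ i j, f i j = f j i) (i j : Fin n) :
    hatField f i j = hatField f j i := by
  rw [hatField, hf, hatField]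

theorem contDiff_form0_self (F : Fin n → Fin n → 𝓢(Rn n, ℂ)) :
    ContDiff ℝ ∞ (fun z : Rn n × Rn n => form0 F z.1 z.2 z.2) :=
  contDiff_form0_comp F contDiff_fst contDiff_snd contDiff_snd

theorem contDiff_form1_self (F : Fin n → Fin n → 𝓢(Rn n, ℂ)) :
    ContDiff ℝ ∞ (fun z : Rn n × Rn n => form1 F z.1 z.2 z.2 z.2) :=
  contDiff_form1_comp F contDiff_fst contDiff_snd contDiff_snd contDiff_snd

theorem hat_mulX_momentRay_zero (i : Fin n) (q : TS n) :
    hat (mulX i (momentRay 0 f)) q = Complex.I *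
      (form1 (hatField f) q.1.1 (EuclideanSpace.single i 1) q.1.2 q.1.2
        - q.1.2 i * form1 (hatField f) q.1.1 q.1.2 q.1.2 q.1.2) := by
  rw [(momentRay_zero_rep f).hat_mulX]
  congr 1
  refine fderiv_eq_of_hasDerivAt ((contDiff_form0_self _).differentiable (by simp) _) ?_
  refine (hasDerivAt_form0 (hatField f) (hasDerivAt_line q.1.1 _) (hasDerivAt_line q.1.2 _)
    (hasDerivAt_line q.1.2 _)).congr_deriv ?_
  simp [fieldX, form1_sub_smul_dir, form0]

theorem hasDerivAt_form0_fieldXi (hf : ∀ i j, f i j = f j i) (i : Fin n) (q : TS n) :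
    HasDerivAt (fun r : ℝ => form0 (hatField f) (q.1.1 + r • (fieldXi i q.1).1)
      (q.1.2 + r • (fieldXi i q.1).2) (q.1.2 + r • (fieldXi i q.1).2))
      (2 * form0 (hatField f) q.1.1 (EuclideanSpace.single i 1) q.1.2
        - 2 * q.1.2 i * form0 (hatField f) q.1.1 q.1.2 q.1.2
        - q.1.1 i * form1 (hatField f) q.1.1 q.1.2 q.1.2 q.1.2) 0 := by
  refine (hasDerivAt_form0 (hatField f) (hasDerivAt_line q.1.1 _) (hasDerivAt_line q.1.2 _)
    (hasDerivAt_line q.1.2 _)).congr_deriv ?_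
  simp only [zero_smul, add_zero]
  rw [form0_symm (hatField f) q.1.1 (hatField_symm hf) q.1.2]
  simp only [fieldXi, form1_neg_smul_dir, form0_sub_smul]
  ring

theorem hasDerivAt_form1_fieldXi (hf : ∀ i j, f i j = f j i) (i : Fin n) (q : TS n) :
    HasDerivAt (fun r : ℝ => form1 (hatField f) (q.1.1 + r • (fieldXi i q.1).1)
      (q.1.2 + r • (fieldXi i q.1).2) (q.1.2 + r • (fieldXi i q.1).2)
      (q.1.2 + r • (fieldXi i q.1).2))
      (-(q.1.1 i * form2 (hatField f) q.1.1 q.1.2 q.1.2 q.1.2 q.1.2)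
        + form1 (hatField f) q.1.1 (EuclideanSpace.single i 1) q.1.2 q.1.2
        + 2 * form1 (hatField f) q.1.1 q.1.2 (EuclideanSpace.single i 1) q.1.2
        - 3 * q.1.2 i * form1 (hatField f) q.1.1 q.1.2 q.1.2 q.1.2) 0 := by
  refine (hasDerivAt_form1 (hatField f) (hasDerivAt_line q.1.1 _) (hasDerivAt_line q.1.2 _)
    (hasDerivAt_line q.1.2 _) (hasDerivAt_line q.1.2 _)).congr_deriv ?_
  simp only [zero_smul, add_zero]
  rw [form1_symm (hatField f) q.1.1 (hatField_symm hf) q.1.2 q.1.2 (fieldXi i q.1).2]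
  simp only [fieldXi, form2_neg_smul_dir, form1_sub_smul, form1_sub_smul_dir]
  ring

theorem hat_opXi_momentRay_zero (hf : ∀ i j, f i j = f j i) (i : Fin n) (q : TS n) :
    hat (opXi i (momentRay 0 f)) q =
      2 * form0 (hatField f) q.1.1 (EuclideanSpace.single i 1) q.1.2
        - 2 * q.1.2 i * form0 (hatField f) q.1.1 q.1.2 q.1.2
        - q.1.1 i * form1 (hatField f) q.1.1 q.1.2 q.1.2 q.1.2 := by
  have hd : Differentiable ℝ fun z : Rn n × Rn n => form0 (hatField f) z.1 z.2 z.2 :=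
    (contDiff_form0_self _).differentiable (by simp)
  rw [(momentRay_zero_rep f).hat_opXi (fun _ => rfl) hd]
  exact fderiv_eq_of_hasDerivAt (hd _) (hasDerivAt_form0_fieldXi hf i q)

theorem hat_opXi_momentRay_one (hf : ∀ i j, f i j = f j i) (i : Fin n) (q : TS n) :
    hat (opXi i (momentRay 1 f)) q = Complex.I *
      (-(q.1.1 i * form2 (hatField f) q.1.1 q.1.2 q.1.2 q.1.2 q.1.2)
        + form1 (hatField f) q.1.1 (EuclideanSpace.single i 1) q.1.2 q.1.2
        + 2 * form1 (hatField f) q.1.1 q.1.2 (EuclideanSpace.single i 1) q.1.2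
        - 3 * q.1.2 i * form1 (hatField f) q.1.1 q.1.2 q.1.2 q.1.2) := by
  have hd : Differentiable ℝ fun z : Rn n × Rn n =>
      Complex.I * form1 (hatField f) z.1 z.2 z.2 z.2 :=
    ((contDiff_form1_self _).differentiable (by simp)).const_mul _
  rw [(momentRay_one_rep f).hat_opXi (fun _ => rfl) hd]
  exact fderiv_eq_of_hasDerivAt (hd _) ((hasDerivAt_form1_fieldXi hf i q).const_mul _)

theorem hat_opXi_opXi_momentRay_zero (hf : ∀ i j, f i j = f j i) (i j : Fin n) (q : TS n) :
    hat (opXi i (opXi j (momentRay 0 f))) q =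
      2 * (hatField f j i q.1.1
        - q.1.2 i * form0 (hatField f) q.1.1 (EuclideanSpace.single j 1) q.1.2
        - q.1.1 i * form1 (hatField f) q.1.1 q.1.2 (EuclideanSpace.single j 1) q.1.2)
      - 2 * ((if i = j then 1 else 0) - q.1.2 i * q.1.2 j) *
        form0 (hatField f) q.1.1 q.1.2 q.1.2
      - 2 * q.1.2 j * (2 * form0 (hatField f) q.1.1 (EuclideanSpace.single i 1) q.1.2
        - 2 * q.1.2 i * form0 (hatField f) q.1.1 q.1.2 q.1.2
        - q.1.1 i * form1 (hatField f) q.1.1 q.1.2 q.1.2 q.1.2)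
      + q.1.1 i * q.1.2 j * form1 (hatField f) q.1.1 q.1.2 q.1.2 q.1.2
      - q.1.1 j * (-(q.1.1 i * form2 (hatField f) q.1.1 q.1.2 q.1.2 q.1.2 q.1.2)
        + form1 (hatField f) q.1.1 (EuclideanSpace.single i 1) q.1.2 q.1.2
        + 2 * form1 (hatField f) q.1.1 q.1.2 (EuclideanSpace.single i 1) q.1.2
        - 3 * q.1.2 i * form1 (hatField f) q.1.1 q.1.2 q.1.2 q.1.2) := by
  obtain ⟨Ψ', r, e⟩ := (momentRay_zero_rep f).opXi j
  -- The formula for Ξ_j I⁰, read on all of ℝⁿ × ℝⁿ, serves as the extension to be differentiated by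
  -- Ξ_i.
  have hc : ContDiff ℝ ∞ fun z : Rn n × Rn n =>
      2 * form0 (hatField f) z.1 (EuclideanSpace.single j 1) z.2
        - 2 * (z.2 j : ℂ) * form0 (hatField f) z.1 z.2 z.2
        - (z.1 j : ℂ) * form1 (hatField f) z.1 z.2 z.2 z.2 :=
    ((contDiff_const.mul (contDiff_form0_comp _ contDiff_fst contDiff_const contDiff_snd)).sub
      ((contDiff_const.mul ((RayRep.contDiff_coord j).comp contDiff_snd)).mul
        (contDiff_form0_self _))).sub
      (((RayRep.contDiff_coord j).comp contDiff_fst).mul (contDiff_form1_self _))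
  have hd := hc.differentiable (by simp)
  rw [r.hat_opXi (fun q => ?_) hd]
  · refine fderiv_eq_of_hasDerivAt (hd _) ?_
    have h1 := hasDerivAt_form0 (hatField f) (hasDerivAt_line q.1.1 (fieldXi i q.1).1)
      (hasDerivAt_const (0 : ℝ) (EuclideanSpace.single j 1 : Rn n))
      (hasDerivAt_line q.1.2 (fieldXi i q.1).2)
    have h2 := hasDerivAt_form0_fieldXi hf i q
    have h3 := hasDerivAt_form1_fieldXi hf i q
    have h4 := hasDerivAt_coord (hasDerivAt_line q.1.2 (fieldXi i q.1).2) j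
    have h5 := hasDerivAt_coord (hasDerivAt_line q.1.1 (fieldXi i q.1).1) j
    refine (((h1.const_mul 2).fun_sub ((h4.const_mul 2).fun_mul h2)).fun_sub
      (h5.fun_mul h3)).congr_deriv ?_
    simp only [zero_smul, add_zero]
    -- The argument e_j is constant, so the slot holding its velocity contributes nothing.
    have z0 : form0 (hatField f) q.1.1 0 q.1.2 = 0 := by simp [form0]
    rw [z0, form0_symm (hatField f) q.1.1 (hatField_symm hf) (EuclideanSpace.single j 1)
      (fieldXi i q.1).2]
    simp only [fieldXi, form1_neg_smul_dir, form0_sub_smul, form0_single_single]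
    rw [form0_symm (hatField f) q.1.1 (hatField_symm hf) q.1.2 (EuclideanSpace.single j 1),
      hatField_symm hf j i]
    simp only [PiLp.sub_apply, PiLp.smul_apply, PiLp.neg_apply, smul_eq_mul,
      PiLp.single_apply, eq_comm (a := j)]
    push_cast
    simp only [apply_ite Complex.ofReal, Complex.ofReal_one, Complex.ofReal_zero]
    ring
  · rw [← hat_opXi_momentRay_zero hf, r.hat_eq]

end Hat

end RayTransform

end

noncomputable section

namespace RayTransform

/-! ### The pointwise identity -/

section Algebra

open Matrix

variable {ι : Type*}

/-- The tensor product of two vectors. -/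
def tens (p q : ι → ℂ) : ι × ι → ℂ := fun ij => p ij.1 * q ij.2

/-- The Kronecker tensor. -/
def kron (ι : Type*) [DecidableEq ι] : ι × ι → ℂ := fun ij => if ij.1 = ij.2 then 1 else 0

/-- Twice the trace-shifted part of `M` that is orthogonal to `ξ`. -/
def tangPart [DecidableEq ι] (ξ : ι → ℂ) (M : ι → ι → ℂ) (u : ι → ℂ) (a : ℂ) : ι × ι → ℂ :=
  (2 : ℂ) • (fun ij => M ij.1 ij.2) - (2 * a) • kron ι - (2 : ℂ) • tens ξ u - (2 : ℂ) • tens u ξ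

theorem tangPart_symm [DecidableEq ι] {ξ : ι → ℂ} {M : ι → ι → ℂ} (u : ι → ℂ) (a : ℂ)
    (h : ∀ i j, M i j = M j i) (i j : ι) :
    tangPart ξ M u a (i, j) = tangPart ξ M u a (j, i) := by
  simp only [tangPart, Pi.sub_apply, Pi.smul_apply, tens, kron, smul_eq_mul, h i j,
    eq_comm (a := i)]
  ring

variable [Fintype ι]

theorem tens_dot_tens (p q r s : ι → ℂ) : tens p q ⬝ᵥ tens r s = (p ⬝ᵥ r) * (q ⬝ᵥ s) := by
  simp only [dotProduct, tens, Fintype.sum_prod_type, Finset.sum_mul_sum]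
  exact Finset.sum_congr rfl fun i _ => Finset.sum_congr rfl fun j _ => by ring

theorem kron_dot_tens [DecidableEq ι] (p q : ι → ℂ) : kron ι ⬝ᵥ tens p q = p ⬝ᵥ q := by
  simp [dotProduct, tens, kron, Fintype.sum_prod_type]

theorem kron_dot_kron [DecidableEq ι] : kron ι ⬝ᵥ kron ι = Fintype.card ι := by
  simp [dotProduct, kron, Fintype.sum_prod_type]

/-- The pointwise identity, polarized: primed and unprimed data are independent, so it is a bilinear
identity without conjugation. Here u, ω, δ are the parts orthogonal to ξ of F(·, ξ), (ξ·∂)F(·, ξ),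
∂F(ξ, ξ), and P is what remains of 2F after its ξ-components and a trace shift are removed. On the
diagonal, 4|M|² = |P|² + 4a·tr P + 8|u|² + 4·card·a². The term |T|² contains |P|², 2|B|² contains
8|u|², and a·tr T contains a·tr P; all surplus terms in b, c, g, ω are cancelled by the remaining
products. For instance 2|B|² + 4b(y·B) + 2Rb² = 8|u|². -/
theorem reshetnyak_polar [DecidableEq ι] {y ξ u ω g u' ω' g' p p' : ι → ℂ} {P P' : ι × ι → ℂ}
    {a b c a' b' c' R : ℂ}
    (hξξ : ξ ⬝ᵥ ξ = 1) (hξy : ξ ⬝ᵥ y = 0) (hyy : y ⬝ᵥ y = R)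
    (hu : ξ ⬝ᵥ u = 0) (hω : ξ ⬝ᵥ ω = 0) (hg : ξ ⬝ᵥ g = 0)
    (hu' : ξ ⬝ᵥ u' = 0) (hω' : ξ ⬝ᵥ ω' = 0) (hg' : ξ ⬝ᵥ g' = 0)
    (hP₁ : ∀ x, tens y x ⬝ᵥ P = p ⬝ᵥ x) (hP₂ : ∀ x, tens x y ⬝ᵥ P = p ⬝ᵥ x)
    (hP₃ : ∀ x, tens x ξ ⬝ᵥ P = 0) (hP₄ : ∀ x, tens ξ x ⬝ᵥ P = 0)
    (hP₁' : ∀ x, tens y x ⬝ᵥ P' = p' ⬝ᵥ x) (hP₂' : ∀ x, tens x y ⬝ᵥ P' = p' ⬝ᵥ x)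
    (hP₃' : ∀ x, tens x ξ ⬝ᵥ P' = 0) (hP₄' : ∀ x, tens ξ x ⬝ᵥ P' = 0)
    {B B' δ δ' q q' : ι → ℂ} {T T' M M' : ι × ι → ℂ}
    (hB : B = (2 : ℂ) • u - b • y) (hB' : B' = (2 : ℂ) • u' - b' • y)
    (hδ : δ = g - (2 : ℂ) • ω + c • y) (hδ' : δ' = g' - (2 : ℂ) • ω' + c' • y)
    (hT : T = P - (2 : ℂ) • tens y ω - tens g y - tens B ξ)
    (hT' : T' = P' - (2 : ℂ) • tens y ω' - tens g' y - tens B' ξ)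
    (hq : q = p - (2 * R) • ω - (y ⬝ᵥ g) • y - (y ⬝ᵥ B) • ξ)
    (hq' : q' = p' - (2 * R) • ω' - (y ⬝ᵥ g') • y - (y ⬝ᵥ B') • ξ)
    (hM : (2 : ℂ) • M = P + (2 * a) • kron ι + (2 : ℂ) • tens ξ u + (2 : ℂ) • tens u ξ)
    (hM' : (2 : ℂ) • M' = P' + (2 * a') • kron ι + (2 : ℂ) • tens ξ u' + (2 : ℂ) • tens u' ξ) :
    2 * R ^ 2 * (c * c') + 4 * R * (c * (y ⬝ᵥ g') + c' * (y ⬝ᵥ g)) + 4 * R * (g ⬝ᵥ g')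
      + 4 * R * (b * b') + 4 * ((y ⬝ᵥ g) * (y ⬝ᵥ g'))
      - 2 * R * (c * (y ⬝ᵥ δ') + c' * (y ⬝ᵥ δ)) + 4 * R * (c * a' + c' * a)
      + 2 * (c * (y ⬝ᵥ q') + c' * (y ⬝ᵥ q)) - 4 * R * (g ⬝ᵥ δ' + g' ⬝ᵥ δ)
      + 8 * ((y ⬝ᵥ g) * a' + (y ⬝ᵥ g') * a) + 4 * (b * (y ⬝ᵥ B') + b' * (y ⬝ᵥ B))
      + 4 * (g ⬝ᵥ q' + g' ⬝ᵥ q) + 2 * R * (δ ⬝ᵥ δ') - 2 * (δ ⬝ᵥ q' + δ' ⬝ᵥ q)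
      - 4 * ((y ⬝ᵥ δ) * a' + (y ⬝ᵥ δ') * a) + 2 * (T ⬝ᵥ T')
      + 4 * ((kron ι ⬝ᵥ T) * a' + (kron ι ⬝ᵥ T') * a) + 2 * (B ⬝ᵥ B')
      + 8 * Fintype.card ι * (a * a') = 8 * (M ⬝ᵥ M') := by
  -- The decomposition is given for 2M, so the factors of 2 are moved inside.
  have hMM : 8 * (M ⬝ᵥ M') = 2 * (((2 : ℂ) • M) ⬝ᵥ ((2 : ℂ) • M')) := by
    simp only [smul_dotProduct, dotProduct_smul, smul_eq_mul]
    ring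
  rw [hMM, hM, hM', hT, hT', hq, hq', hδ, hδ', hB, hB']
  -- Each symmetric product receives a fixed order of factors, so that equal scalars become equal
  -- atoms for `ring`.
  have c1 := fun x : ι → ℂ => dotProduct_comm x ξ
  have c2 := dotProduct_comm ω y
  have c3 := dotProduct_comm ω' y
  have c4 := dotProduct_comm g y
  have c5 := dotProduct_comm g' y
  have c6 := dotProduct_comm u y
  have d1 := fun x : ι → ℂ => (dotProduct_comm P (tens y x)).trans (hP₁ x)
  have d2 := fun x : ι → ℂ => (dotProduct_comm P (tens x y)).trans (hP₂ x)
  have d3 := fun x : ι → ℂ => (dotProduct_comm P (tens x ξ)).trans (hP₃ x)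
  have d4 := fun x : ι → ℂ => (dotProduct_comm P (tens ξ x)).trans (hP₄ x)
  have e1 := dotProduct_comm P (kron ι)
  have e2 := fun x z : ι → ℂ => dotProduct_comm (tens x z) (kron ι)
  have f1 := dotProduct_comm g' g
  have f2 := dotProduct_comm g' ω
  have f4 := dotProduct_comm ω' ω
  have f5 := dotProduct_comm g' p
  have f6 := dotProduct_comm p' g
  have f7 := dotProduct_comm ω' p
  have f8 := dotProduct_comm p' ω
  simp only [add_dotProduct, sub_dotProduct, smul_dotProduct, dotProduct_add, dotProduct_sub,
    dotProduct_smul, smul_eq_mul, hP₁', hP₂', hP₃', hP₄', d1, d2, d3, d4, e1, e2, tens_dot_tens,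
    kron_dot_tens, kron_dot_kron, c1, hξξ, hξy, hyy, hu, hω, hg, hu', hω', hg',
    c2, c3, c4, c5, c6, f1, f2, f4, f5, f6, f7, f8]
  ring

/-- Contractions of a symmetric tensor `M` and of its derivatives with a unit vector `ξ`. -/
structure Jet (ξ : ι → ℂ) (M : ι → ι → ℂ) (v w d : ι → ℂ) (a b : ℂ) : Prop where
  symm : ∀ i j, M i j = M j i
  v_eq : ∀ i, v i = ∑ j, M i j * ξ j
  a_eq : ξ ⬝ᵥ v = a
  w_dot : ξ ⬝ᵥ w = b
  d_dot : ξ ⬝ᵥ d = b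

/-- As ξ is real, the conjugate data form a jet as well; they play the part of the primed variables.
-/
theorem Jet.conj {ξ : ι → ℂ} {M : ι → ι → ℂ} {v w d : ι → ℂ} {a b : ℂ} (h : Jet ξ M v w d a b)
    (hξ : ∀ i, conj (ξ i) = ξ i) :
    Jet ξ (fun i j => conj (M i j)) (fun i => conj (v i)) (fun i => conj (w i))
      (fun i => conj (d i)) (conj a) (conj b) where
  symm i j := by rw [h.symm]
  v_eq i := by simp [h.v_eq, hξ]
  a_eq := by simp [← h.a_eq, dotProduct, hξ]
  w_dot := by simp [← h.w_dot, dotProduct, hξ]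
  d_dot := by simp [← h.d_dot, dotProduct, hξ]

theorem tens_dot_symm {P : ι × ι → ℂ} (h : ∀ i j, P (i, j) = P (j, i)) (x z : ι → ℂ) :
    tens x z ⬝ᵥ P = tens z x ⬝ᵥ P := by
  simp only [dotProduct, tens, Fintype.sum_prod_type]
  rw [Finset.sum_comm]
  refine Finset.sum_congr rfl fun i _ => Finset.sum_congr rfl fun j _ => ?_
  rw [h, mul_comm (x j)]

theorem tens_dot (P : ι × ι → ℂ) (x z : ι → ℂ) :
    tens x z ⬝ᵥ P = (fun j => ∑ i, x i * P (i, j)) ⬝ᵥ z := by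
  simp only [dotProduct, tens, Fintype.sum_prod_type, Finset.sum_mul]
  rw [Finset.sum_comm]
  refine Finset.sum_congr rfl fun i _ => Finset.sum_congr rfl fun j _ => ?_
  ring

/-- The subtractions in `tangPart` are chosen for this: contracting with ξ leaves 2v - 2aξ - 2(v -
aξ) = 0. -/
theorem Jet.tens_dot_tangPart [DecidableEq ι] {ξ : ι → ℂ} {M : ι → ι → ℂ} {v w d : ι → ℂ}
    {a b : ℂ} (h : Jet ξ M v w d a b) (hξ : ξ ⬝ᵥ ξ = 1) (x : ι → ℂ) :
    tens ξ x ⬝ᵥ tangPart ξ M (v - a • ξ) a = 0 := by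
  have e : tens ξ x ⬝ᵥ (fun ij => M ij.1 ij.2) = v ⬝ᵥ x := by
    rw [tens_dot]
    congr 1
    ext j
    rw [h.v_eq]
    exact Finset.sum_congr rfl fun i _ => by rw [h.symm i j, mul_comm]
  have e2 := dotProduct_comm (tens ξ x) (kron ι)
  have hv := h.a_eq
  rw [tangPart]
  simp only [dotProduct_sub, dotProduct_smul, smul_eq_mul, e, e2, kron_dot_tens, tens_dot_tens,
    hξ, hv, dotProduct_comm x]
  simp only [sub_dotProduct, smul_dotProduct, smul_eq_mul]
  ring

theorem ofReal_re_mul_conj (z w : ℂ) : (((z * conj w).re : ℝ) : ℂ) = (z * conj w + conj z * w) / 2 := by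
  rw [Complex.re_eq_add_conj]; simp

theorem ofReal_im_mul_conj (z w : ℂ) :
    (((z * conj w).im : ℝ) : ℂ) = -Complex.I * (z * conj w - conj z * w) / 2 := by
  rw [Complex.im_eq_sub_conj]
  have := Complex.I_ne_zero
  simp only [map_mul, Complex.conj_conj]
  field_simp
  linear_combination (z * conj w - conj z * w) * Complex.I_sq

theorem ofReal_norm_sq (z : ℂ) : ((‖z‖ ^ 2 : ℝ) : ℂ) = z * conj z := by
  rw [Complex.mul_conj']; simp

/-- This is `reshetnyak_polar` with the conjugate jet as primed data, R there being |y|². After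
cancellation of the factors i and the powers of |y|, each real or imaginary part is half the sum of
a product and its conjugate. -/
theorem reshetnyak_pointwise [DecidableEq ι] {y ξ : ι → ℝ} {R : ℝ} (hR : 0 < R)
    (hξξ : ∑ i, ξ i * ξ i = 1) (hξy : ∑ i, ξ i * y i = 0) (hyy : ∑ i, y i * y i = R ^ 2)
    {M : ι → ι → ℂ} {v w d : ι → ℂ} {a b : ℂ} (c : ℂ)
    (h : Jet (fun i => (ξ i : ℂ)) M v w d a b)
    {H0 H1 H2 Z0 Z1 Q0 W0 : ℂ} {A0 A1 X ZX : ι → ℂ} {T : ι → ι → ℂ}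
    (hH0 : H0 = a) (hH1 : H1 = Complex.I * b) (hH2 : H2 = -c)
    (hA0 : ∀ i, A0 i = 2 * v i - 2 * ξ i * a - y i * b)
    (hX : ∀ i, X i = Complex.I * (d i - ξ i * b))
    (hA1 : ∀ i, A1 i = Complex.I * (-(y i * c) + (d i - ξ i * b) + 2 * (w i - ξ i * b)))
    (hT : ∀ i j, T i j = 2 * (M j i - ξ i * v j - y i * w j)
      - 2 * ((if i = j then 1 else 0) - ξ i * ξ j) * a
      - 2 * ξ j * (2 * v i - 2 * ξ i * a - y i * b) + y i * ξ j * b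
      - y j * (-(y i * c) + d i + 2 * w i - 3 * ξ i * b))
    (hZ0 : Z0 = ∑ i, ((y i / R : ℝ) : ℂ) * A0 i) (hZ1 : Z1 = ∑ i, ((y i / R : ℝ) : ℂ) * A1 i)
    (hQ0 : Q0 = ∑ i, ∑ j, ((y i * y j / R ^ 2 : ℝ) : ℂ) * T i j)
    (hW0 : W0 = ∑ i, ((y i / R : ℝ) : ℂ) * (-Complex.I * X i))
    (hZX : ∀ i, ZX i = ∑ j, ((y j / R : ℝ) : ℂ) * T j i) :
    R ^ 4 * ‖H2‖ ^ 2 + 4 * (R ^ 3 * (H2 * conj Z1).im) + 2 * ∑ i, R ^ 2 * ‖A1 i‖ ^ 2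
      + 2 * (R ^ 2 * ‖H1‖ ^ 2) + 2 * (R ^ 2 * ‖Z1‖ ^ 2) + 2 * (R ^ 3 * (H2 * conj W0).re)
      - 4 * (R ^ 2 * (H2 * conj H0).re) - 2 * (R ^ 2 * (H2 * conj Q0).re)
      - 4 * ∑ i, R ^ 2 * (A1 i * conj (X i)).re + 8 * (R * (Z1 * conj H0).im)
      + 4 * (R * (H1 * conj Z0).im) + 4 * ∑ i, R * (A1 i * conj (ZX i)).im
      + ∑ i, R ^ 2 * ‖X i‖ ^ 2 - 2 * ∑ i, R * (X i * conj (ZX i)).im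
      - 4 * (R * (W0 * conj H0).re) + ∑ i, ∑ j, ‖T i j‖ ^ 2 + 4 * ∑ i, (T i i * conj H0).re
      + ∑ i, ‖A0 i‖ ^ 2 + 4 * Fintype.card ι * ‖H0‖ ^ 2 = 4 * ∑ i, ∑ j, ‖M i j‖ ^ 2 := by
  have hR' : (R : ℂ) ≠ 0 := by exact_mod_cast hR.ne'
  set yc : ι → ℂ := fun i => (y i : ℂ) with hyc
  set ξc : ι → ℂ := fun i => (ξ i : ℂ) with hξc
  have h1 : ξc ⬝ᵥ ξc = 1 := by simp only [dotProduct, hξc]; exact_mod_cast hξξ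
  have h2 : ξc ⬝ᵥ yc = 0 := by simp only [dotProduct, hξc, hyc]; exact_mod_cast hξy
  have h3 : yc ⬝ᵥ yc = (R : ℂ) ^ 2 := by simp only [dotProduct, hyc]; exact_mod_cast hyy
  have h' := h.conj (fun i => Complex.conj_ofReal _)
  set M' : ι → ι → ℂ := fun i j => conj (M i j) with hM'
  set v' : ι → ℂ := fun i => conj (v i) with hv'
  set w' : ι → ℂ := fun i => conj (w i) with hw'
  set d' : ι → ℂ := fun i => conj (d i) with hd'
  -- All three vectors are orthogonal to ξ: the ξ-components a and b have been subtracted, and y ⊥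
  -- ξ.
  have dots : ∀ {v w d : ι → ℂ} {a b : ℂ} {M : ι → ι → ℂ} (c : ℂ), Jet ξc M v w d a b →
      ξc ⬝ᵥ (v - a • ξc) = 0 ∧ ξc ⬝ᵥ (w - b • ξc) = 0 ∧
      ξc ⬝ᵥ (-(c • yc) + (d - b • ξc) + (2 : ℂ) • (w - b • ξc)) = 0 := by
    intro v w d a b M c h
    simp [dotProduct_sub, dotProduct_add, h1, h2, h.a_eq, h.w_dot, h.d_dot]
  obtain ⟨du, dω, dg⟩ := dots c h
  obtain ⟨du', dω', dg'⟩ := dots (conj c) h'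
  set u := v - a • ξc with hu
  set ω := w - b • ξc with hω
  set δ := d - b • ξc with hδ
  set g := -(c • yc) + δ + (2 : ℂ) • ω with hg
  set u' := v' - conj a • ξc with hu'
  set ω' := w' - conj b • ξc with hω'
  set δ' := d' - conj b • ξc with hδ'
  set g' := -(conj c • yc) + δ' + (2 : ℂ) • ω' with hg'
  set P := tangPart ξc M u a with hP
  set P' := tangPart ξc M' u' (conj a) with hP'
  have sP := tangPart_symm (ξ := ξc) u a h.symm
  have sP' := tangPart_symm (ξ := ξc) u' (conj a) h'.symm
  set B := (2 : ℂ) • u - b • yc with hB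
  set B' := (2 : ℂ) • u' - conj b • yc with hB'
  set p : ι → ℂ := fun j => ∑ i, yc i * P (i, j) with hp
  set p' : ι → ℂ := fun j => ∑ i, yc i * P' (i, j) with hp'
  set q := p - (2 * (R : ℂ) ^ 2) • ω - (yc ⬝ᵥ g) • yc - (yc ⬝ᵥ B) • ξc with hq
  set q' := p' - (2 * (R : ℂ) ^ 2) • ω' - (yc ⬝ᵥ g') • yc - (yc ⬝ᵥ B') • ξc with hq'
  set S : ι × ι → ℂ := P - (2 : ℂ) • tens yc ω - tens g yc - tens B ξc with hS
  set S' : ι × ι → ℂ := P' - (2 : ℂ) • tens yc ω' - tens g' yc - tens B' ξc with hS'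
  have key := reshetnyak_polar (y := yc) (ξ := ξc) (u := u) (ω := ω) (g := g) (u' := u') (ω' := ω')
    (g' := g') (p := p) (p' := p') (P := P) (P' := P') (a := a) (b := b) (c := c) (a' := conj a)
    (b' := conj b) (c' := conj c) (R := (R : ℂ) ^ 2) h1 h2 h3 du dω dg du' dω' dg'
    (fun x => tens_dot P yc x) (fun x => (tens_dot_symm sP x yc).trans (tens_dot P yc x))
    (fun x => (tens_dot_symm sP x ξc).trans (h.tens_dot_tangPart h1 x))
    (fun x => h.tens_dot_tangPart h1 x)
    (fun x => tens_dot P' yc x) (fun x => (tens_dot_symm sP' x yc).trans (tens_dot P' yc x))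
    (fun x => (tens_dot_symm sP' x ξc).trans (h'.tens_dot_tangPart h1 x))
    (fun x => h'.tens_dot_tangPart h1 x) (δ := δ) (δ' := δ')
    (M := fun ij => M ij.1 ij.2) (M' := fun ij => M' ij.1 ij.2)
    hB hB' (by rw [hg]; module) (by rw [hg']; module) hS hS' hq hq'
    (by rw [hP, tangPart]; module) (by rw [hP', tangPart]; module)
  -- Conjugation carries each derived quantity to its primed counterpart, because y and ξ are real.
  have c2 : conj (2 : ℂ) = 2 := map_ofNat _ 2
  have cB : ∀ i, conj (B i) = B' i := fun i => by
    simp [hB, hB', hu, hu', hv', hyc, hξc, c2]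
  have cδ : ∀ i, conj (δ i) = δ' i := fun i => by simp [hδ, hδ', hd', hξc]
  have cω : ∀ i, conj (ω i) = ω' i := fun i => by simp [hω, hω', hw', hξc]
  have cg : ∀ i, conj (g i) = g' i := fun i => by
    simp only [hg, hg', Pi.add_apply, Pi.neg_apply, Pi.smul_apply, smul_eq_mul, map_add, map_neg,
      map_mul, cδ, cω]
    simp [hyc, c2]
  have cS : ∀ i j, conj (S (i, j)) = S' (i, j) := fun i j => by
    simp only [hS, hS', hP, hP', tangPart, tens, kron, Pi.sub_apply, Pi.smul_apply, smul_eq_mul,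
      map_sub, map_mul, cω, cg, cB, apply_ite conj, map_one, map_zero, hu, hu', hv', hM', hξc, hyc,
      Complex.conj_ofReal, map_ofNat]
  have cy : ∀ x : ι → ℂ, conj (yc ⬝ᵥ x) = yc ⬝ᵥ fun i => conj (x i) := fun x => by
    simp [dotProduct, hyc]
  have cyg : conj (yc ⬝ᵥ g) = yc ⬝ᵥ g' := by rw [cy]; simp only [cg]
  have cyB : conj (yc ⬝ᵥ B) = yc ⬝ᵥ B' := by rw [cy]; simp only [cB]
  have cyδ : conj (yc ⬝ᵥ δ) = yc ⬝ᵥ δ' := by rw [cy]; simp only [cδ]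
  have ySq : ∀ i, ∑ j, yc j * S (j, i) = q i := fun i => by
    have e : ∀ j, yc j * S (j, i) = yc j * P (j, i) - (yc j * yc j) * (2 * ω i)
        - (yc j * g j) * yc i - (yc j * B j) * ξc i := fun j => by
      simp only [hS, Pi.sub_apply, Pi.smul_apply, tens, smul_eq_mul]
      ring
    simp only [e, Finset.sum_sub_distrib, ← Finset.sum_mul]
    have e3 : ∑ j, yc j * yc j = (R : ℂ) ^ 2 := h3
    rw [e3]
    simp only [hq, hp, Pi.sub_apply, Pi.smul_apply, smul_eq_mul, dotProduct]
    ring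
  have ySq' : ∀ i, ∑ j, yc j * S' (j, i) = q' i := fun i => by
    have e : ∀ j, yc j * S' (j, i) = yc j * P' (j, i) - (yc j * yc j) * (2 * ω' i)
        - (yc j * g' j) * yc i - (yc j * B' j) * ξc i := fun j => by
      simp only [hS', Pi.sub_apply, Pi.smul_apply, tens, smul_eq_mul]
      ring
    simp only [e, Finset.sum_sub_distrib, ← Finset.sum_mul]
    have e3 : ∑ j, yc j * yc j = (R : ℂ) ^ 2 := h3
    rw [e3]
    simp only [hq', hp', Pi.sub_apply, Pi.smul_apply, smul_eq_mul, dotProduct]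
    ring
  have cq : ∀ i, conj (q i) = q' i := fun i => by
    rw [← ySq, ← ySq', map_sum]
    simp only [map_mul, cS]
    simp [hyc]
  have cyq : conj (yc ⬝ᵥ q) = yc ⬝ᵥ q' := by rw [cy]; simp only [cq]
  -- The given transforms are rewritten in the tangential variables: B, ig, iδ and the tensor S,
  -- with contractions by y/R for Z, W, Q.
  have EA0 : ∀ i, A0 i = B i := fun i => by
    rw [hA0]; simp only [hB, hu, Pi.sub_apply, Pi.smul_apply, smul_eq_mul, hyc, hξc]; ring
  have EA1 : ∀ i, A1 i = Complex.I * g i := fun i => by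
    rw [hA1]
    simp only [hg, hω, hδ, Pi.sub_apply, Pi.smul_apply, Pi.add_apply, Pi.neg_apply, smul_eq_mul,
      hyc, hξc]
    ring
  have EX : ∀ i, X i = Complex.I * δ i := fun i => by
    rw [hX]; simp only [hδ, Pi.sub_apply, Pi.smul_apply, smul_eq_mul, hξc]; ring
  have ET : ∀ i j, T i j = S (i, j) := fun i j => by
    rw [hT, h.symm j i]
    simp only [hS, hP, tangPart, hB, hg, hω, hδ, hu, tens, kron, Pi.sub_apply, Pi.smul_apply,
      Pi.add_apply, Pi.neg_apply, smul_eq_mul, hyc, hξc]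
    ring
  have EZ0 : Z0 = (yc ⬝ᵥ B) / R := by
    rw [hZ0, dotProduct, Finset.sum_div]
    refine Finset.sum_congr rfl fun i _ => ?_
    rw [EA0]; push_cast; ring
  have EZ1 : Z1 = Complex.I * (yc ⬝ᵥ g) / R := by
    rw [hZ1, dotProduct, Finset.mul_sum, Finset.sum_div]
    refine Finset.sum_congr rfl fun i _ => ?_
    rw [EA1]; push_cast; ring
  have EW0 : W0 = (yc ⬝ᵥ δ) / R := by
    rw [hW0, dotProduct, Finset.sum_div]
    refine Finset.sum_congr rfl fun i _ => ?_
    rw [EX]; push_cast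
    linear_combination (-(y i : ℂ) / R * δ i) * Complex.I_sq
  have EZX : ∀ i, ZX i = q i / R := fun i => by
    rw [hZX, ← ySq, Finset.sum_div]
    refine Finset.sum_congr rfl fun j _ => ?_
    rw [ET]; push_cast; ring
  have EQ0 : Q0 = (yc ⬝ᵥ q) / R ^ 2 := by
    rw [hQ0, dotProduct, Finset.sum_comm, Finset.sum_div]
    refine Finset.sum_congr rfl fun j _ => ?_
    rw [← ySq, Finset.mul_sum, Finset.sum_div]
    refine Finset.sum_congr rfl fun i _ => ?_
    rw [ET]; push_cast; ring
  -- Each summand, cast to ℂ, becomes a term of the polarized identity divided by two.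
  have t1 : ((R ^ 4 * ‖H2‖ ^ 2 : ℝ) : ℂ) = ((R : ℂ) ^ 2) ^ 2 * (c * conj c) := by
    rw [Complex.ofReal_mul, ofReal_norm_sq, hH2]; push_cast; simp only [map_neg]; ring
  have t2 : ((R ^ 3 * (H2 * conj Z1).im : ℝ) : ℂ) =
      (R : ℂ) ^ 2 / 2 * (c * (yc ⬝ᵥ g') + conj c * (yc ⬝ᵥ g)) := by
    rw [Complex.ofReal_mul, ofReal_im_mul_conj, hH2, EZ1]
    simp only [map_div₀, map_mul, Complex.conj_I, Complex.conj_ofReal, cyg, map_neg]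
    push_cast
    field_simp
    linear_combination (-(c * (yc ⬝ᵥ g') + conj c * (yc ⬝ᵥ g))) * Complex.I_sq
  have t3 : ((∑ i, R ^ 2 * ‖A1 i‖ ^ 2 : ℝ) : ℂ) = (R : ℂ) ^ 2 * (g ⬝ᵥ g') := by
    rw [Complex.ofReal_sum, dotProduct, Finset.mul_sum]
    refine Finset.sum_congr rfl fun i _ => ?_
    rw [Complex.ofReal_mul, ofReal_norm_sq, EA1, map_mul, Complex.conj_I, cg]
    push_cast
    linear_combination (-(R : ℂ) ^ 2 * (g i * g' i)) * Complex.I_sq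
  have t4 : ((R ^ 2 * ‖H1‖ ^ 2 : ℝ) : ℂ) = (R : ℂ) ^ 2 * (b * conj b) := by
    rw [Complex.ofReal_mul, ofReal_norm_sq, hH1, map_mul, Complex.conj_I]; push_cast
    linear_combination (-(R : ℂ) ^ 2 * (b * conj b)) * Complex.I_sq
  have t5 : ((R ^ 2 * ‖Z1‖ ^ 2 : ℝ) : ℂ) = (yc ⬝ᵥ g) * (yc ⬝ᵥ g') := by
    rw [Complex.ofReal_mul, ofReal_norm_sq, EZ1]
    simp only [map_div₀, map_mul, Complex.conj_I, Complex.conj_ofReal, cyg]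
    push_cast
    field_simp
    linear_combination (-((yc ⬝ᵥ g) * (yc ⬝ᵥ g'))) * Complex.I_sq
  have t6 : ((R ^ 3 * (H2 * conj W0).re : ℝ) : ℂ) =
      -((R : ℂ) ^ 2 / 2) * (c * (yc ⬝ᵥ δ') + conj c * (yc ⬝ᵥ δ)) := by
    rw [Complex.ofReal_mul, ofReal_re_mul_conj, hH2, EW0]
    simp only [map_div₀, Complex.conj_ofReal, cyδ, map_neg]
    push_cast
    field_simp
    ring
  have t7 : ((R ^ 2 * (H2 * conj H0).re : ℝ) : ℂ) =
      -((R : ℂ) ^ 2 / 2) * (c * conj a + conj c * a) := by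
    rw [Complex.ofReal_mul, ofReal_re_mul_conj, hH2, hH0, map_neg]
    push_cast
    ring
  have t8 : ((R ^ 2 * (H2 * conj Q0).re : ℝ) : ℂ) =
      -(1 / 2) * (c * (yc ⬝ᵥ q') + conj c * (yc ⬝ᵥ q)) := by
    rw [Complex.ofReal_mul, ofReal_re_mul_conj, hH2, EQ0]
    simp only [map_div₀, map_pow, Complex.conj_ofReal, cyq, map_neg]
    push_cast
    field_simp
    ring
  have t9 : ((∑ i, R ^ 2 * (A1 i * conj (X i)).re : ℝ) : ℂ) =
      (R : ℂ) ^ 2 / 2 * (g ⬝ᵥ δ' + g' ⬝ᵥ δ) := by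
    rw [Complex.ofReal_sum, dotProduct, dotProduct, ← Finset.sum_add_distrib, Finset.mul_sum]
    refine Finset.sum_congr rfl fun i _ => ?_
    rw [Complex.ofReal_mul, ofReal_re_mul_conj, EA1, EX]
    simp only [map_mul, Complex.conj_I, cg, cδ]
    push_cast
    linear_combination (-(R : ℂ) ^ 2 / 2 * (g i * δ' i + g' i * δ i)) * Complex.I_sq
  have t10 : ((R * (Z1 * conj H0).im : ℝ) : ℂ) =
      1 / 2 * ((yc ⬝ᵥ g) * conj a + (yc ⬝ᵥ g') * a) := by
    rw [Complex.ofReal_mul, ofReal_im_mul_conj, EZ1, hH0]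
    simp only [map_div₀, map_mul, Complex.conj_I, Complex.conj_ofReal, cyg]
    field_simp
    linear_combination (-((yc ⬝ᵥ g) * conj a + (yc ⬝ᵥ g') * a)) * Complex.I_sq
  have t11 : ((R * (H1 * conj Z0).im : ℝ) : ℂ) =
      1 / 2 * (b * (yc ⬝ᵥ B') + conj b * (yc ⬝ᵥ B)) := by
    rw [Complex.ofReal_mul, ofReal_im_mul_conj, EZ0, hH1]
    simp only [map_div₀, map_mul, Complex.conj_I, Complex.conj_ofReal, cyB]
    field_simp
    linear_combination (-(b * (yc ⬝ᵥ B') + conj b * (yc ⬝ᵥ B))) * Complex.I_sq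
  have t12 : ((∑ i, R * (A1 i * conj (ZX i)).im : ℝ) : ℂ) = 1 / 2 * (g ⬝ᵥ q' + g' ⬝ᵥ q) := by
    rw [Complex.ofReal_sum, dotProduct, dotProduct, ← Finset.sum_add_distrib, Finset.mul_sum]
    refine Finset.sum_congr rfl fun i _ => ?_
    rw [Complex.ofReal_mul, ofReal_im_mul_conj, EA1, EZX]
    simp only [map_div₀, map_mul, Complex.conj_I, Complex.conj_ofReal, cg, cq]
    field_simp
    linear_combination (-(g i * q' i + g' i * q i)) * Complex.I_sq
  have t13 : ((∑ i, R ^ 2 * ‖X i‖ ^ 2 : ℝ) : ℂ) = (R : ℂ) ^ 2 * (δ ⬝ᵥ δ') := by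
    rw [Complex.ofReal_sum, dotProduct, Finset.mul_sum]
    refine Finset.sum_congr rfl fun i _ => ?_
    rw [Complex.ofReal_mul, ofReal_norm_sq, EX, map_mul, Complex.conj_I, cδ]
    push_cast
    linear_combination (-(R : ℂ) ^ 2 * (δ i * δ' i)) * Complex.I_sq
  have t14 : ((∑ i, R * (X i * conj (ZX i)).im : ℝ) : ℂ) = 1 / 2 * (δ ⬝ᵥ q' + δ' ⬝ᵥ q) := by
    rw [Complex.ofReal_sum, dotProduct, dotProduct, ← Finset.sum_add_distrib, Finset.mul_sum]
    refine Finset.sum_congr rfl fun i _ => ?_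
    rw [Complex.ofReal_mul, ofReal_im_mul_conj, EX, EZX]
    simp only [map_div₀, map_mul, Complex.conj_I, Complex.conj_ofReal, cδ, cq]
    field_simp
    linear_combination (-(δ i * q' i + δ' i * q i)) * Complex.I_sq
  have t15 : ((R * (W0 * conj H0).re : ℝ) : ℂ) =
      1 / 2 * ((yc ⬝ᵥ δ) * conj a + (yc ⬝ᵥ δ') * a) := by
    rw [Complex.ofReal_mul, ofReal_re_mul_conj, EW0, hH0]
    simp only [map_div₀, Complex.conj_ofReal, cyδ]
    field_simp
  have t16 : ((∑ i, ∑ j, ‖T i j‖ ^ 2 : ℝ) : ℂ) = S ⬝ᵥ S' := by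
    rw [Complex.ofReal_sum, dotProduct, Fintype.sum_prod_type]
    refine Finset.sum_congr rfl fun i _ => ?_
    rw [Complex.ofReal_sum]
    refine Finset.sum_congr rfl fun j _ => ?_
    rw [ofReal_norm_sq, ET, cS]
  have t17 : ((∑ i, (T i i * conj H0).re : ℝ) : ℂ) =
      1 / 2 * ((kron ι ⬝ᵥ S) * conj a + (kron ι ⬝ᵥ S') * a) := by
    have e : ∀ S : ι × ι → ℂ, kron ι ⬝ᵥ S = ∑ i, S (i, i) := fun S => by
      simp [dotProduct, kron, Fintype.sum_prod_type]
    rw [Complex.ofReal_sum, e, e, Finset.sum_mul, Finset.sum_mul, ← Finset.sum_add_distrib,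
      Finset.mul_sum]
    refine Finset.sum_congr rfl fun i _ => ?_
    rw [ofReal_re_mul_conj, ET, cS, hH0]
    ring
  have t18 : ((∑ i, ‖A0 i‖ ^ 2 : ℝ) : ℂ) = B ⬝ᵥ B' := by
    rw [Complex.ofReal_sum, dotProduct]
    refine Finset.sum_congr rfl fun i _ => ?_
    rw [ofReal_norm_sq, EA0, cB]
  have t19 : ((‖H0‖ ^ 2 : ℝ) : ℂ) = a * conj a := by rw [ofReal_norm_sq, hH0]
  have t20 : ((∑ i, ∑ j, ‖M i j‖ ^ 2 : ℝ) : ℂ) =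
      (fun ij : ι × ι => M ij.1 ij.2) ⬝ᵥ fun ij => M' ij.1 ij.2 := by
    rw [Complex.ofReal_sum, dotProduct, Fintype.sum_prod_type]
    refine Finset.sum_congr rfl fun i _ => ?_
    rw [Complex.ofReal_sum]
    exact Finset.sum_congr rfl fun j _ => ofReal_norm_sq _
  refine Complex.ofReal_injective ?_
  push_cast at t1 t2 t3 t4 t5 t6 t7 t8 t9 t10 t11 t12 t13 t14 t15 t16 t17 t18 t19 t20 ⊢
  rw [t1, t2, t3, t4, t5, t6, t7, t8, t9, t10, t11, t12, t13, t14, t15, t16, t17, t18, t19, t20]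
  linear_combination key / 2

end Algebra

end RayTransform

end

noncomputable section

namespace RayTransform

open scoped ENNReal

variable {n : ℕ}

/-! ### The measure `dy dξ` on `T𝕊^{n-1}` -/

instance : IsFiniteMeasure (surface n) := by unfold surface lebesgue; infer_instance

instance (V : Type*) [NormedAddCommGroup V] [InnerProductSpace ℝ V] [FiniteDimensional ℝ V]
    [MeasurableSpace V] [BorelSpace V] : (lebesgue V).IsAddHaarMeasure := by
  unfold lebesgue; infer_instance

theorem Sph.norm_eq (ξ : Sph n) : ‖(ξ : Rn n)‖ = 1 := by simp

/-- The reflection that interchanges two vectors of equal length. -/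
def swapRefl (ξ₀ ξ : Rn n) : Rn n ≃ₗᵢ[ℝ] Rn n := (Submodule.span ℝ {ξ₀ - ξ})ᗮ.reflection

theorem swapRefl_left {ξ₀ ξ : Rn n} (h : ‖ξ₀‖ = ‖ξ‖) : swapRefl ξ₀ ξ ξ₀ = ξ :=
  Submodule.reflection_sub h

/-- The explicit formula shows measurability in (ξ, v) jointly. At ξ = ξ₀ division by zero returns
zero and the map is the identity, as it should be. -/
theorem swapRefl_apply (ξ₀ ξ v : Rn n) : swapRefl ξ₀ ξ v =
    v - (2 * (inner ℝ (ξ₀ - ξ) v / ‖ξ₀ - ξ‖ ^ 2)) • (ξ₀ - ξ) := by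
  rw [swapRefl, Submodule.reflection_orthogonal_apply, Submodule.reflection_singleton_apply,
    neg_sub, ← Nat.cast_smul_eq_nsmul ℝ, smul_smul]
  rfl

theorem measurable_swapRefl (ξ₀ : Rn n) :
    Measurable fun p : Rn n × Rn n => swapRefl ξ₀ p.1 p.2 := by
  simp only [swapRefl_apply]
  have h1 : Measurable fun p : Rn n × Rn n => inner ℝ (ξ₀ - p.1) p.2 / ‖ξ₀ - p.1‖ ^ 2 :=
    Measurable.div (Continuous.measurable (by fun_prop)) (Continuous.measurable (by fun_prop))
  exact measurable_snd.sub (Measurable.smul (h1.const_mul 2) (Continuous.measurable (by fun_prop)))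

/-- The isometry of the hyperplanes `ξ₀^⊥`, `ξ^⊥` induced by `swapRefl ξ₀ ξ`. -/
def hyperplaneEquiv {ξ₀ ξ : Rn n} (h : ‖ξ₀‖ = ‖ξ‖) : hyperplane ξ₀ ≃ₗᵢ[ℝ] hyperplane ξ :=
  ((swapRefl ξ₀ ξ).submoduleMap (hyperplane ξ₀)).trans
    (LinearIsometryEquiv.ofEq _ _ (by
      have e := Submodule.map_orthogonal_equiv (Submodule.span ℝ {ξ₀}) (swapRefl ξ₀ ξ)
      rw [Submodule.map_span, Set.image_singleton] at e
      refine e.trans ?_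
      change (Submodule.span ℝ {swapRefl ξ₀ ξ ξ₀})ᗮ = _
      rw [swapRefl_left h]))

theorem coe_hyperplaneEquiv {ξ₀ ξ : Rn n} (h : ‖ξ₀‖ = ‖ξ‖) (v : hyperplane ξ₀) :
    (hyperplaneEquiv h v : Rn n) = swapRefl ξ₀ ξ v := rfl

theorem lintegral_hyperplane {ξ₀ ξ : Rn n} (h : ‖ξ₀‖ = ‖ξ‖) (F : Rn n → ℝ≥0∞) :
    ∫⁻ y : hyperplane ξ, F y ∂(lebesgue _) =
      ∫⁻ v : hyperplane ξ₀, F (swapRefl ξ₀ ξ v) ∂(lebesgue _) :=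
  ((hyperplaneEquiv h).measurePreserving.lintegral_comp_emb
    (hyperplaneEquiv h).toHomeomorph.measurableEmbedding (fun y : hyperplane ξ => F y)).symm

theorem integrable_hyperplane {ξ₀ ξ : Rn n} (h : ‖ξ₀‖ = ‖ξ‖) {F : Rn n → ℂ} :
    Integrable (fun v : hyperplane ξ₀ => F (swapRefl ξ₀ ξ v)) (lebesgue _) ↔
      Integrable (fun y : hyperplane ξ => F y) (lebesgue _) :=
  (hyperplaneEquiv h).measurePreserving.integrable_comp_emb
    (hyperplaneEquiv h).toHomeomorph.measurableEmbedding (g := fun y : hyperplane ξ => F y)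

theorem integral_hyperplane {G : Type*} [NormedAddCommGroup G] [NormedSpace ℝ G]
    {ξ₀ ξ : Rn n} (h : ‖ξ₀‖ = ‖ξ‖) (F : Rn n → G) :
    ∫ y : hyperplane ξ, F y ∂(lebesgue _) =
      ∫ v : hyperplane ξ₀, F (swapRefl ξ₀ ξ v) ∂(lebesgue _) :=
  ((hyperplaneEquiv h).measurePreserving.integral_comp
    (hyperplaneEquiv h).toHomeomorph.measurableEmbedding (fun y : hyperplane ξ => F y)).symm

/-- The measure `dy dξ` on `T𝕊^{n-1}`, as a measure on `ℝⁿ × ℝⁿ`. -/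
def flagMeasure (ξ₀ : Rn n) : Measure (Rn n × Rn n) :=
  ((surface n).prod (lebesgue (hyperplane ξ₀))).map
    fun p => (swapRefl ξ₀ p.1 p.2, (p.1 : Rn n))

theorem measurable_flag (ξ₀ : Rn n) : Measurable
    fun p : Sph n × hyperplane ξ₀ => (swapRefl ξ₀ p.1 p.2, (p.1 : Rn n)) := by
  refine Measurable.prodMk ((measurable_swapRefl ξ₀).comp
    (f := fun p : Sph n × hyperplane ξ₀ => ((p.1 : Rn n), (p.2 : Rn n))) ?_) ?_ <;> fun_prop

/-- The fibres ξ^⊥ vary with ξ; reflections identify them isometrically with the single hyperplane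
ξ₀^⊥, so that dy dξ is the image of a product measure and Tonelli applies. The value does not depend
on the choice of ξ₀. -/
theorem lintegral_flagMeasure {ξ₀ : Rn n} (hξ₀ : ‖ξ₀‖ = 1) {k : Rn n × Rn n → ℝ≥0∞}
    (hk : Measurable k) : ∫⁻ z, k z ∂(flagMeasure ξ₀) =
      ∫⁻ ξ, ∫⁻ y : hyperplane (ξ : Rn n), k (y, ξ) ∂(lebesgue _) ∂(surface n) := by
  rw [flagMeasure, lintegral_map hk (measurable_flag ξ₀)]
  refine (lintegral_prod _ (hk.comp (measurable_flag ξ₀)).aemeasurable).trans ?_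
  refine lintegral_congr fun ξ => ?_
  rw [lintegral_hyperplane (hξ₀.trans ξ.norm_eq.symm) fun y => k (y, ξ)]
  rfl

theorem integral_flagMeasure {ξ₀ : Rn n} (hξ₀ : ‖ξ₀‖ = 1) {G : Type*} [NormedAddCommGroup G]
    [NormedSpace ℝ G] {k : Rn n × Rn n → G} (hk : Integrable k (flagMeasure ξ₀)) :
    ∫ z, k z ∂(flagMeasure ξ₀) =
      ∫ ξ, ∫ y : hyperplane (ξ : Rn n), k (y, ξ) ∂(lebesgue _) ∂(surface n) := by
  have hk' := hk.comp_measurable (measurable_flag ξ₀)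
  rw [flagMeasure, integral_map (measurable_flag ξ₀).aemeasurable hk.1]
  refine (integral_prod _ hk').trans (integral_congr_ae (Eventually.of_forall fun ξ => ?_))
  simp only
  rw [integral_hyperplane (hξ₀.trans ξ.norm_eq.symm) fun y => k (y, ξ)]
  rfl

theorem integrable_fibre_ae {ξ₀ : Rn n} (hξ₀ : ‖ξ₀‖ = 1) {k : Rn n × Rn n → ℂ}
    (hk : Integrable k (flagMeasure ξ₀)) : ∀ᵐ ξ : Sph n ∂(surface n),
      Integrable (fun y : hyperplane (ξ : Rn n) => k (y, ξ)) (lebesgue _) := by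
  refine (hk.comp_measurable (measurable_flag ξ₀)).prod_right_ae.mono fun ξ hξ => ?_
  exact (integrable_hyperplane (hξ₀.trans ξ.norm_eq.symm) (F := fun y => k (y, (ξ : Rn n)))).1 hξ

theorem integrable_integral_fibre {ξ₀ : Rn n} (hξ₀ : ‖ξ₀‖ = 1) {G : Type*} [NormedAddCommGroup G]
    [NormedSpace ℝ G] {k : Rn n × Rn n → G} (hk : Integrable k (flagMeasure ξ₀)) :
    Integrable (fun ξ : Sph n => ∫ y : hyperplane (ξ : Rn n), k (y, ξ) ∂(lebesgue _))
      (surface n) := by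
  refine (hk.comp_measurable (measurable_flag ξ₀)).integral_prod_left.congr
    (Eventually.of_forall fun ξ => ?_)
  simp only
  rw [integral_hyperplane (hξ₀.trans ξ.norm_eq.symm) fun y => k (y, ξ)]
  rfl

/-! ### Radial majorants -/

/-- In polar coordinates the integrand is at most r^{d+a} near 0 and r^{d+a+b} at infinity; the two
hypotheses place these exponents on the convergent side of -1. -/
theorem integrable_rpow_mul_one_add_rpow {V : Type*} [NormedAddCommGroup V]
    [InnerProductSpace ℝ V] [FiniteDimensional ℝ V] [MeasurableSpace V] [BorelSpace V]
    {d : ℕ} (hd : finrank ℝ V = d + 1) {a b : ℝ} (ha : -(d + 1 : ℝ) < a)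
    (hb : a + b < -(d + 1 : ℝ)) :
    Integrable (fun y : V => ‖y‖ ^ a * (1 + ‖y‖) ^ b) (lebesgue V) := by
  have : Nontrivial V := Module.nontrivial_of_finrank_pos (R := ℝ) (by omega)
  refine (integrable_fun_norm_addHaar (lebesgue V) (f := fun r => r ^ a * (1 + r) ^ b)).2 ?_
  rw [hd, Nat.add_sub_cancel, ← Set.Ioc_union_Ioi_eq_Ioi zero_le_one]
  have hm : Measurable fun r : ℝ => r ^ d • (r ^ a * (1 + r) ^ b) := by fun_prop
  have hb0 : b ≤ 0 := by linarith
  refine IntegrableOn.union ?_ ?_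
  · have h1 : IntegrableOn (fun r : ℝ => r ^ (d + a)) (Set.Ioc 0 1) :=
      (intervalIntegrable_iff_integrableOn_Ioc_of_le zero_le_one).1
        (intervalIntegral.intervalIntegrable_rpow' (by linarith))
    refine Integrable.mono' h1 hm.aestronglyMeasurable
      ((ae_restrict_iff' measurableSet_Ioc).2 (Eventually.of_forall fun r hr => ?_))
    have hr0 : 0 < r := hr.1
    have h2 : (1 + r) ^ b ≤ 1 := Real.rpow_le_one_of_one_le_of_nonpos (by linarith) hb0
    rw [Real.norm_of_nonneg (by positivity), Real.rpow_add hr0, Real.rpow_natCast, smul_eq_mul]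
    gcongr
    exact mul_le_of_le_one_right (by positivity) h2
  · have h1 : IntegrableOn (fun r : ℝ => r ^ (d + a + b)) (Set.Ioi 1) :=
      integrableOn_Ioi_rpow_of_lt (by linarith) one_pos
    refine Integrable.mono' h1 hm.aestronglyMeasurable
      ((ae_restrict_iff' measurableSet_Ioi).2 (Eventually.of_forall fun r hr => ?_))
    have hr0 : 0 < r := one_pos.trans hr
    have h2 : (1 + r) ^ b ≤ r ^ b := Real.rpow_le_rpow_of_nonpos hr0 (by linarith) hb0
    rw [Real.norm_of_nonneg (by positivity), Real.rpow_add hr0, Real.rpow_add hr0,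
      Real.rpow_natCast, smul_eq_mul, mul_assoc]
    gcongr

theorem one_add_sq_rpow_le {r : ℝ} (hr : 0 ≤ r) (e : ℝ) :
    (1 + r ^ 2) ^ e ≤ (1 + r) ^ (2 * |e|) := by
  calc (1 + r ^ 2) ^ e ≤ (1 + r ^ 2) ^ |e| :=
        Real.rpow_le_rpow_of_exponent_le (by nlinarith) (le_abs_self e)
    _ ≤ ((1 + r) ^ (2 : ℝ)) ^ |e| := by
        refine Real.rpow_le_rpow (by positivity) ?_ (abs_nonneg e)
        rw [show (2 : ℝ) = ((2 : ℕ) : ℝ) by norm_num, Real.rpow_natCast]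
        nlinarith
    _ = _ := by rw [← Real.rpow_mul (by positivity)]

/-- The weight `|y|^a (1+|y|²)^e`. -/
def weight (a e r : ℝ) : ℝ := r ^ a * (1 + r ^ 2) ^ e

theorem weight_nonneg (a e : ℝ) {r : ℝ} (hr : 0 ≤ r) : 0 ≤ weight a e r := by
  unfold weight; positivity

theorem measurable_weight (a e : ℝ) : Measurable (weight a e) := by
  unfold weight; fun_prop

/-- The power k depends on the dimension and the exponents only, not on the space. -/
theorem exists_integrable_weight (d : ℕ) {a : ℝ} (ha : -(d + 1 : ℝ) < a) (e : ℝ) :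
    ∃ k : ℕ, ∀ (V : Type) [NormedAddCommGroup V]
      [InnerProductSpace ℝ V] [FiniteDimensional ℝ V] [MeasurableSpace V] [BorelSpace V],
      finrank ℝ V = d + 1 →
      Integrable (fun y : V => weight a e ‖y‖ * ((1 + ‖y‖) ^ k)⁻¹) (lebesgue V) := by
  -- The weight grows at most like (1+r)^{2|e|} r^a, so this k leaves a total exponent below -(d+1).
  obtain ⟨k, hk⟩ := exists_nat_gt (a + 2 * |e| + (d + 1))
  refine ⟨k, fun V _ _ _ _ _ hd => ?_⟩
  refine (integrable_rpow_mul_one_add_rpow hd ha (b := 2 * |e| - k) (by linarith)).mono' ?_ ?_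
  · have h1 : Measurable fun r : ℝ => weight a e r * ((1 + r) ^ k)⁻¹ :=
      (measurable_weight a e).mul (by fun_prop)
    exact (h1.comp measurable_norm).aestronglyMeasurable
  · refine Eventually.of_forall fun y => ?_
    have h0 : 0 < 1 + ‖y‖ := by positivity
    have h1 := weight_nonneg a e (norm_nonneg y)
    rw [Real.norm_of_nonneg (mul_nonneg h1 (by positivity)), Real.rpow_sub h0, Real.rpow_natCast, weight,
      div_eq_mul_inv, mul_assoc]
    gcongr
    exact one_add_sq_rpow_le (norm_nonneg y) e

/-- A function on `T𝕊^{n-1}` with an integrable radial majorant is integrable. -/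
theorem integrable_flagMeasure {ξ₀ : Rn n} {k : Rn n × Rn n → ℂ}
    (hk : Measurable k) {ρ : ℝ → ℝ}
    (hρ : Integrable (fun v : hyperplane ξ₀ => ρ ‖v‖) (lebesgue _))
    (h : ∀ z : Rn n × Rn n, ‖z.2‖ = 1 → ‖k z‖ ≤ ρ ‖z.1‖) : Integrable k (flagMeasure ξ₀) := by
  rw [flagMeasure, integrable_map_measure hk.aestronglyMeasurable (measurable_flag ξ₀).aemeasurable]
  have hρ' : Integrable (fun p : Sph n × hyperplane ξ₀ => ρ ‖p.2‖)
    ((surface n).prod (lebesgue (hyperplane ξ₀))) := hρ.comp_snd (surface n)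
  have hm := (hk.comp (measurable_flag ξ₀)).aestronglyMeasurable
    (μ := (surface n).prod (lebesgue (hyperplane ξ₀)))
  refine hρ'.mono' hm (Eventually.of_forall fun p => ?_)
  have := h (swapRefl ξ₀ p.1 p.2, (p.1 : Rn n)) p.1.norm_eq
  rwa [LinearIsometryEquiv.norm_map] at this

end RayTransform

end

noncomputable section

namespace RayTransform

open scoped ENNReal NNReal BoundedContinuousFunction

variable {n : ℕ}

/-! ### Gaussian integrals -/

theorem lintegral_gaussian {c : ℝ} (hc : 0 < c) :
    ∫⁻ s : ℝ, ENNReal.ofReal (Real.exp (-c * s ^ 2)) = ENNReal.ofReal (Real.sqrt (Real.pi / c)) := by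
  rw [← integral_gaussian, ofReal_integral_eq_lintegral_ofReal (integrable_exp_neg_mul_sq hc)]
  exact Eventually.of_forall fun s => (Real.exp_pos _).le

theorem lintegral_gaussian_norm (V : Type*) [NormedAddCommGroup V] [InnerProductSpace ℝ V]
    [FiniteDimensional ℝ V] [MeasurableSpace V] [BorelSpace V] :
    ∫⁻ v : V, ENNReal.ofReal (Real.exp (-‖v‖ ^ 2)) ∂(lebesgue V) =
      ENNReal.ofReal (Real.pi ^ ((finrank ℝ V : ℝ) / 2)) := by
  have h := GaussianFourier.integral_rexp_neg_mul_sq_norm (V := V) one_pos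
  have hi : Integrable fun v : V => Real.exp (-‖v‖ ^ 2) := by
    -- A function that is not integrable has integral zero by convention, which contradicts the
    -- positive value in `h`.
    by_contra hi
    simp only [neg_mul, one_mul, integral_undef hi, div_one] at h
    have : 0 < Real.pi ^ ((finrank ℝ V : ℝ) / 2) := by positivity
    exact this.ne h
  simp only [neg_mul, one_mul, div_one] at h
  rw [← h, lebesgue, ofReal_integral_eq_lintegral_ofReal hi]
  exact Eventually.of_forall fun s => (Real.exp_pos _).le

theorem lintegral_comp_mul_left {c : ℝ} (hc : 0 < c) {G : ℝ → ℝ≥0∞} (hG : Measurable G) :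
    ∫⁻ u, G u = ENNReal.ofReal c * ∫⁻ s, G (c * s) := by
  rw [← lintegral_map hG (measurable_const_mul c), Real.map_volume_mul_left hc.ne', lintegral_smul_measure,
    abs_of_pos (by positivity), smul_eq_mul, ← mul_assoc, ← ENNReal.ofReal_mul hc.le,
    mul_inv_cancel₀ hc.ne', ENNReal.ofReal_one, one_mul]

theorem lintegral_slice {ω : Rn n} (hω : ‖ω‖ = 1) {F : Rn n → ℝ≥0∞} (hF : Measurable F) :
    ∫⁻ y, F y ∂(lebesgue _) =
      ∫⁻ v : hyperplane ω, (∫⁻ u : ℝ, F ((v : Rn n) + u • ω)) ∂(lebesgue _) := by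
  have h := (measurePreserving_splitEquiv ω hω).lintegral_comp_emb
    (splitEquiv ω hω).measurableEmbedding F
  rw [lebesgue, ← h]
  refine (lintegral_prod _ (hF.comp (splitEquiv ω hω).measurable).aemeasurable).trans ?_
  simp only [Function.comp, splitEquiv_apply]
  rfl

theorem lintegral_polar (hn : n ≠ 0) {F : Rn n → ℝ≥0∞} (hF : Measurable F) :
    ∫⁻ y, F y ∂(lebesgue _) = ∫⁻ ξ : Sph n, (∫⁻ r in Set.Ioi (0 : ℝ),
      ENNReal.ofReal (r ^ (n - 1)) * F (r • (ξ : Rn n))) ∂(surface n) := by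
  have : Nontrivial (Rn n) := Module.nontrivial_of_finrank_pos (R := ℝ) (by
    rw [finrank_euclideanSpace_fin]; omega)
  have h := ((lebesgue (Rn n)).measurePreserving_homeomorphUnitSphereProd.symm
    (homeomorphUnitSphereProd (Rn n)).toMeasurableEquiv).lintegral_comp_emb
    (homeomorphUnitSphereProd (Rn n)).symm.measurableEmbedding (fun y => F y)
  rw [lintegral_subtype_comap (measurableSet_singleton _).compl, restrict_compl_singleton] at h
  have hm : Measurable fun a : Sph n × Set.Ioi (0 : ℝ) =>
      F ((homeomorphUnitSphereProd (Rn n)).toMeasurableEquiv.symm a) :=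
    hF.comp (measurable_subtype_coe.comp (MeasurableEquiv.measurable _))
  rw [← h, lintegral_prod]
  · refine lintegral_congr fun ξ => ?_
    rw [Measure.volumeIoiPow, lintegral_withDensity_eq_lintegral_mul,
      ← lintegral_subtype_comap measurableSet_Ioi]
    · simp only [finrank_euclideanSpace_fin]
      refine lintegral_congr fun r => ?_
      rfl
    · fun_prop
    · exact hm.comp measurable_prodMk_left
  · exact hm.aemeasurable

/-- The kernel `exp(-(u/ε)²)/(ε√π)` has integral one and is small away from zero. -/
def bump (ε u : ℝ) : ℝ := Real.exp (-(u / ε) ^ 2) / (ε * Real.sqrt Real.pi)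

theorem measurable_bump (ε : ℝ) : Measurable (bump ε) := by unfold bump; fun_prop

/-- Split η along y and y^⊥. The Gaussian on y^⊥ gives π^{(n-1)/2}; along y the two exponentials
merge into a Gaussian with coefficient 1 + (|y|/ε)², whose integral produces (ε² + |y|²)^{-1/2}, a
regularized 1/|y|. -/
theorem lintegral_bump_inner {y : Rn n} (hy : y ≠ 0) {ε : ℝ} (hε : 0 < ε) :
    ∫⁻ η : Rn n, ENNReal.ofReal (Real.exp (-‖η‖ ^ 2)) * ENNReal.ofReal (bump ε (inner ℝ y η))
      ∂(lebesgue _) =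
    ENNReal.ofReal (Real.pi ^ (((n : ℝ) - 1) / 2)) *
      ENNReal.ofReal ((Real.sqrt (ε ^ 2 + ‖y‖ ^ 2))⁻¹) := by
  have hy0 : 0 < ‖y‖ := norm_pos_iff.2 hy
  set ω : Rn n := ‖y‖⁻¹ • y with hωd
  have hω : ‖ω‖ = 1 := by simp [ω, norm_smul, hy0.ne']
  have hyω : y = ‖y‖ • ω := by rw [hωd, smul_smul, mul_inv_cancel₀ hy0.ne', one_smul]
  have hpi := Real.pi_pos
  rw [lintegral_slice hω]
  · have key : ∀ (v : hyperplane ω) (u : ℝ),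
        ENNReal.ofReal (Real.exp (-‖(v : Rn n) + u • ω‖ ^ 2)) *
          ENNReal.ofReal (bump ε (inner ℝ y ((v : Rn n) + u • ω))) =
        ENNReal.ofReal (Real.exp (-‖v‖ ^ 2)) * (ENNReal.ofReal ((ε * Real.sqrt Real.pi)⁻¹) *
          ENNReal.ofReal (Real.exp (-(1 + (‖y‖ / ε) ^ 2) * u ^ 2))) := by
      intro v u
      have hv : inner ℝ ω (v : Rn n) = 0 := Submodule.mem_orthogonal_singleton_iff_inner_right.1 v.2
      have hv' : inner ℝ (v : Rn n) (u • ω) = 0 := by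
        rw [inner_smul_right, real_inner_comm, hv, mul_zero]
      have e1 : ‖(v : Rn n) + u • ω‖ ^ 2 = ‖v‖ ^ 2 + u ^ 2 := by
        have := norm_add_sq_eq_norm_sq_add_norm_sq_of_inner_eq_zero _ _ hv'
        rw [norm_smul, hω, mul_one, Real.norm_eq_abs, abs_mul_abs_self] at this
        rw [pow_two, this, Submodule.coe_norm]
        ring
      have e2 : inner ℝ y ((v : Rn n) + u • ω) = ‖y‖ * u := by
        conv_lhs => rw [hyω]
        rw [inner_smul_left, inner_add_right, hv, inner_smul_right, real_inner_self_eq_norm_sq, hω]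
        simp
      rw [e1, e2, bump, ← ENNReal.ofReal_mul (by positivity), ← ENNReal.ofReal_mul (by positivity),
        ← ENNReal.ofReal_mul (by positivity)]
      congr 1
      have : Real.exp (-(‖v‖ ^ 2 + u ^ 2)) * Real.exp (-(‖y‖ * u / ε) ^ 2) =
          Real.exp (-‖v‖ ^ 2) * Real.exp (-(1 + (‖y‖ / ε) ^ 2) * u ^ 2) := by
        rw [← Real.exp_add, ← Real.exp_add]
        congr 1
        ring
      rw [mul_div_assoc', this]
      field_simp
    simp only [key]
    have hd : (finrank ℝ (hyperplane ω) : ℝ) = n - 1 := by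
      have : ((finrank ℝ (hyperplane ω) + 1 : ℕ) : ℝ) = n := by
        exact_mod_cast finrank_hyperplane_add_one hω
      push_cast at this
      linarith
    have hm : Measurable fun v : hyperplane ω => ENNReal.ofReal (Real.exp (-‖v‖ ^ 2)) := by fun_prop
    have hm' : Measurable fun u : ℝ =>
      ENNReal.ofReal (Real.exp (-(1 + (‖y‖ / ε) ^ 2) * u ^ 2)) := by fun_prop
    simp only [lintegral_const_mul _ (hm'.const_mul _), lintegral_const_mul _ hm']
    rw [lintegral_mul_const _ hm, lintegral_gaussian_norm, hd, lintegral_gaussian (by positivity),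
      ← ENNReal.ofReal_mul (by positivity)]
    congr 2
    have : ε ^ 2 + ‖y‖ ^ 2 = ε ^ 2 * (1 + (‖y‖ / ε) ^ 2) := by field_simp
    rw [this, Real.sqrt_div' _ (by positivity), Real.sqrt_mul' _ (by positivity),
      Real.sqrt_sq hε.le]
    field_simp
  · have h1 : Measurable fun η : Rn n => ENNReal.ofReal (Real.exp (-‖η‖ ^ 2)) := by fun_prop
    exact h1.mul ((measurable_bump ε).comp (by fun_prop : Measurable fun η : Rn n => inner ℝ y η)).ennreal_ofReal

/-- For η = rξ the bump depends only on the component u of y along ξ. The substitution u = (ε/r)s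
makes it independent of ε and yields the Jacobian factor 1/r; as ε → 0, the points approach the
hyperplane ξ^⊥. -/
theorem lintegral_mul_bump {ξ₀ ξ : Rn n} (h₀ : ‖ξ₀‖ = 1) (hξ : ‖ξ‖ = 1) {ε r : ℝ} (hε : 0 < ε)
    (hr : 0 < r) {h : Rn n → ℝ≥0∞} (hh : Measurable h) :
    ∫⁻ y, h y * ENNReal.ofReal (bump ε (inner ℝ y (r • ξ))) ∂(lebesgue _) =
      ENNReal.ofReal r⁻¹ * ∫⁻ v : hyperplane ξ₀, (∫⁻ s : ℝ,
        h (swapRefl ξ₀ ξ v + (ε / r * s) • ξ) * ENNReal.ofReal (bump 1 s)) ∂(lebesgue _) := by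
  have hc : 0 < ε / r := by positivity
  have hm : Measurable fun y => h y * ENNReal.ofReal (bump ε (inner ℝ y (r • ξ))) :=
    hh.mul ((measurable_bump ε).comp
      (by fun_prop : Measurable fun y : Rn n => inner ℝ y (r • ξ))).ennreal_ofReal
  rw [lintegral_slice hξ hm, lintegral_hyperplane (h₀.trans hξ.symm)
    fun x => ∫⁻ u : ℝ, h (x + u • ξ) * ENNReal.ofReal (bump ε (inner ℝ (x + u • ξ) (r • ξ))),
    ← lintegral_const_mul']
  · refine lintegral_congr fun v => ?_
    have hv : inner ℝ (swapRefl ξ₀ ξ v) ξ = 0 := by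
      rw [real_inner_comm, ← coe_hyperplaneEquiv (h₀.trans hξ.symm)]
      exact Submodule.mem_orthogonal_singleton_iff_inner_right.1 (Subtype.property _)
    have hm' : Measurable fun u : ℝ => swapRefl ξ₀ ξ v + u • ξ := by fun_prop
    refine (lintegral_comp_mul_left hc (hm.comp hm')).trans ?_
    rw [← lintegral_const_mul',
      ← lintegral_const_mul']
    · refine lintegral_congr fun s => ?_
      have e : inner ℝ (swapRefl ξ₀ ξ v + (ε / r * s) • ξ) (r • ξ) = ε * s := by
        rw [inner_smul_right, inner_add_left, hv, inner_smul_left, real_inner_self_eq_norm_sq, hξ]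
        simp
        field_simp
      simp only [Function.comp]
      rw [e, mul_left_comm, mul_left_comm (ENNReal.ofReal r⁻¹)]
      congr 1
      rw [← ENNReal.ofReal_mul (by positivity), ← ENNReal.ofReal_mul (by positivity)]
      congr 1
      simp only [bump]
      rw [mul_div_cancel_left₀ _ hε.ne']
      field_simp
    · exact ENNReal.ofReal_ne_top
    · exact ENNReal.ofReal_ne_top
  · exact ENNReal.ofReal_ne_top

/-! ### Integration over pairs of orthogonal vectors -/

theorem lintegral_bump_one : ∫⁻ s : ℝ, ENNReal.ofReal (bump 1 s) = 1 := by
  have h : ∀ s : ℝ, ENNReal.ofReal (bump 1 s) = ENNReal.ofReal ((Real.sqrt Real.pi)⁻¹) *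
      ENNReal.ofReal (Real.exp (-1 * s ^ 2)) := fun s => by
    rw [← ENNReal.ofReal_mul (by positivity), bump]
    congr 1
    rw [div_one, one_mul, neg_one_mul, mul_comm, div_eq_mul_inv]
  have hpi : 0 < Real.sqrt Real.pi := Real.sqrt_pos.2 Real.pi_pos
  simp only [h]
  rw [lintegral_const_mul _ (by fun_prop), lintegral_gaussian one_pos,
    ← ENNReal.ofReal_mul (by positivity), div_one, inv_mul_cancel₀ hpi.ne', ENNReal.ofReal_one]

/-- The power r^{n-1} of polar coordinates meets the factor r⁻¹ of the bump; n ≥ 2 makes r^{n-2}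
integrable at 0. -/
theorem lintegral_pow_mul_gaussian (hn : 2 ≤ n) :
    ∫⁻ r in Set.Ioi (0 : ℝ), ENNReal.ofReal (r ^ (n - 1) * Real.exp (-r ^ 2) * r⁻¹) =
      ENNReal.ofReal (Real.Gamma (((n : ℝ) - 1) / 2) / 2) := by
  have hq : (-1 : ℝ) < n - 2 := by
    have : (2 : ℝ) ≤ n := by exact_mod_cast hn
    linarith
  have h := integral_rpow_mul_exp_neg_rpow (p := 2) two_pos hq
  have hG : 0 < Real.Gamma (((n : ℝ) - 2 + 1) / 2) := Real.Gamma_pos_of_pos (by linarith)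
  have e : ∀ r ∈ Set.Ioi (0 : ℝ), r ^ ((n : ℝ) - 2) * Real.exp (-r ^ (2 : ℝ)) =
      r ^ (n - 1) * Real.exp (-r ^ 2) * r⁻¹ := fun r hr => by
    have hr0 : (0 : ℝ) < r := hr
    obtain ⟨m, rfl⟩ := Nat.exists_eq_add_of_le hn
    rw [show ((2 + m : ℕ) : ℝ) - 2 = m by push_cast; ring, Real.rpow_natCast,
      show (2 : ℝ) = ((2 : ℕ) : ℝ) by norm_num, Real.rpow_natCast,
      show 2 + m - 1 = m + 1 by omega, pow_succ]
    field_simp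
    ring
  rw [setIntegral_congr_fun measurableSet_Ioi e] at h
  have hi : IntegrableOn (fun r : ℝ => r ^ (n - 1) * Real.exp (-r ^ 2) * r⁻¹) (Set.Ioi 0) := by
    by_contra hi
    rw [integral_undef hi] at h
    have : 0 < 1 / 2 * Real.Gamma (((n : ℝ) - 2 + 1) / 2) := by positivity
    exact this.ne h
  rw [← ofReal_integral_eq_lintegral_ofReal hi, h]
  · congr 1
    rw [show (n : ℝ) - 2 + 1 = n - 1 by ring]
    ring
  · refine (ae_restrict_iff' measurableSet_Ioi).2 (Eventually.of_forall fun r hr => ?_)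
    have hr0 : (0 : ℝ) < r := hr
    change 0 ≤ r ^ (n - 1) * Real.exp (-r ^ 2) * r⁻¹
    positivity

/-- The integrand of the Gaussian average of `h` over pairs of almost orthogonal vectors. -/
def pairKernel (ξ₀ : Rn n) (h : Rn n → ℝ≥0∞) (ε : ℝ)
    (p : (Sph n × ℝ) × (hyperplane ξ₀ × ℝ)) : ℝ≥0∞ :=
  ENNReal.ofReal (p.1.2 ^ (n - 1) * Real.exp (-p.1.2 ^ 2) * p.1.2⁻¹) *
    (h (swapRefl ξ₀ p.1.1 p.2.1 + (ε / p.1.2 * p.2.2) • (p.1.1 : Rn n)) *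
      ENNReal.ofReal (bump 1 p.2.2))

theorem measurable_pairKernel (ξ₀ : Rn n) {h : Rn n → ℝ≥0∞} (hh : Measurable h) (ε : ℝ) :
    Measurable (pairKernel ξ₀ h ε) := by
  have h1 : Measurable fun p : (Sph n × ℝ) × (hyperplane ξ₀ × ℝ) => swapRefl ξ₀ p.1.1 p.2.1 :=
    (measurable_swapRefl ξ₀).comp
      (f := fun p : (Sph n × ℝ) × (hyperplane ξ₀ × ℝ) => ((p.1.1 : Rn n), (p.2.1 : Rn n)))
      (by fun_prop)
  have h2 : Measurable fun p : (Sph n × ℝ) × (hyperplane ξ₀ × ℝ) =>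
    (ε / p.1.2 * p.2.2) • (p.1.1 : Rn n) := by fun_prop
  have h3 : Measurable fun p : (Sph n × ℝ) × (hyperplane ξ₀ × ℝ) => bump 1 p.2.2 :=
    (measurable_bump 1).comp (by fun_prop)
  have h4 : Measurable fun p : (Sph n × ℝ) × (hyperplane ξ₀ × ℝ) =>
    ENNReal.ofReal (p.1.2 ^ (n - 1) * Real.exp (-p.1.2 ^ 2) * p.1.2⁻¹) := by fun_prop
  exact h4.mul ((hh.comp (h1.add h2)).mul h3.ennreal_ofReal)

/-- Tonelli for e^{-|η|²} h(y) δ_ε(⟨y, η⟩), with δ_ε the bump: integrating in η first gives the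
right side; integrating in y first, with polar coordinates η = rξ, gives the left. -/
theorem lintegral_pairKernel (hn : n ≠ 0) {ξ₀ : Rn n} (h₀ : ‖ξ₀‖ = 1) {h : Rn n → ℝ≥0∞}
    (hh : Measurable h) {ε : ℝ} (hε : 0 < ε) :
    ∫⁻ p, pairKernel ξ₀ h ε p ∂(((surface n).prod (volume.restrict (Set.Ioi 0))).prod
      ((lebesgue (hyperplane ξ₀)).prod volume)) =
    ENNReal.ofReal (Real.pi ^ (((n : ℝ) - 1) / 2)) *
      ∫⁻ y, h y * ENNReal.ofReal ((Real.sqrt (ε ^ 2 + ‖y‖ ^ 2))⁻¹) ∂(lebesgue _) := by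
  have : Nontrivial (Rn n) := Module.nontrivial_of_finrank_pos (R := ℝ) (by
    rw [finrank_euclideanSpace_fin]; omega)
  have hb : Measurable fun q : Rn n × Rn n => ENNReal.ofReal (bump ε (inner ℝ q.1 q.2)) :=
    ((measurable_bump ε).comp
      (by fun_prop : Measurable fun q : Rn n × Rn n => inner ℝ q.1 q.2)).ennreal_ofReal
  have hg : Measurable fun η : Rn n => ENNReal.ofReal (Real.exp (-‖η‖ ^ 2)) := by fun_prop
  have hF : Measurable fun q : Rn n × Rn n => ENNReal.ofReal (Real.exp (-‖q.2‖ ^ 2)) *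
      (h q.1 * ENNReal.ofReal (bump ε (inner ℝ q.1 q.2))) :=
    (hg.comp measurable_snd).mul ((hh.comp measurable_fst).mul hb)
  have hrhs : ENNReal.ofReal (Real.pi ^ (((n : ℝ) - 1) / 2)) *
      ∫⁻ y, h y * ENNReal.ofReal ((Real.sqrt (ε ^ 2 + ‖y‖ ^ 2))⁻¹) ∂(lebesgue _) =
      ∫⁻ y, (∫⁻ η, ENNReal.ofReal (Real.exp (-‖η‖ ^ 2)) *
        (h y * ENNReal.ofReal (bump ε (inner ℝ y η))) ∂(lebesgue _)) ∂(lebesgue _) := by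
    rw [← lintegral_const_mul' _ _ ENNReal.ofReal_ne_top]
    have hne : ∀ᵐ y : Rn n ∂(lebesgue _), y ≠ 0 := Measure.ae_ne _ 0
    refine lintegral_congr_ae (hne.mono fun y hy => ?_)
    simp only
    rw [mul_left_comm, ← lintegral_bump_inner hy hε, ← lintegral_const_mul]
    · refine lintegral_congr fun η => ?_
      ring
    · exact hg.mul ((measurable_bump ε).comp
        (by fun_prop : Measurable fun η : Rn n => inner ℝ y η)).ennreal_ofReal
  rw [hrhs, lintegral_lintegral_swap hF.aemeasurable]
  have hη : ∀ η : Rn n, ∫⁻ y, ENNReal.ofReal (Real.exp (-‖η‖ ^ 2)) *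
      (h y * ENNReal.ofReal (bump ε (inner ℝ y η))) ∂(lebesgue _) =
      ENNReal.ofReal (Real.exp (-‖η‖ ^ 2)) *
        ∫⁻ y, h y * ENNReal.ofReal (bump ε (inner ℝ y η)) ∂(lebesgue _) := fun η =>
    lintegral_const_mul' _ _ ENNReal.ofReal_ne_top
  refine Eq.trans ?_ (lintegral_polar hn (hF.lintegral_prod_left' (μ := lebesgue (Rn n)))).symm
  rw [lintegral_prod _ (measurable_pairKernel ξ₀ hh ε).aemeasurable,
    lintegral_prod _ (measurable_pairKernel ξ₀ hh ε).lintegral_prod_right'.aemeasurable]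
  refine lintegral_congr fun ξ => ?_
  refine setLIntegral_congr_fun measurableSet_Ioi fun r hr => ?_
  have hr0 : (0 : ℝ) < r := hr
  simp only
  rw [hη, lintegral_mul_bump h₀ ξ.norm_eq hε hr0 hh]
  refine (lintegral_prod _
    ((measurable_pairKernel ξ₀ hh ε).comp measurable_prodMk_left).aemeasurable).trans ?_
  simp only [pairKernel, Function.comp]
  rw [norm_smul, ξ.norm_eq, mul_one, Real.norm_of_nonneg hr0.le]
  simp only [lintegral_const_mul' _ _ ENNReal.ofReal_ne_top]
  rw [← mul_assoc, ← mul_assoc, ← ENNReal.ofReal_mul (by positivity),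
    ← ENNReal.ofReal_mul (by positivity)]

/-- At ε = 0 the variables r and s separate from (y, ξ); their integrals are Γ((n-1)/2)/2 and 1. -/
theorem lintegral_pairKernel_zero (hn : 2 ≤ n) {ξ₀ : Rn n} (h₀ : ‖ξ₀‖ = 1) {h : Rn n → ℝ≥0∞}
    (hh : Measurable h) :
    ∫⁻ p, pairKernel ξ₀ h 0 p ∂(((surface n).prod (volume.restrict (Set.Ioi 0))).prod
      ((lebesgue (hyperplane ξ₀)).prod volume)) =
    ENNReal.ofReal (Real.Gamma (((n : ℝ) - 1) / 2) / 2) *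
      ∫⁻ z, h z.1 ∂(flagMeasure ξ₀) := by
  have hfl := lintegral_flagMeasure h₀ (k := fun z => h z.1) (hh.comp measurable_fst)
  rw [hfl, lintegral_prod _ (measurable_pairKernel ξ₀ hh 0).aemeasurable,
    lintegral_prod _ (measurable_pairKernel ξ₀ hh 0).lintegral_prod_right'.aemeasurable,
    ← lintegral_const_mul' _ _ ENNReal.ofReal_ne_top]
  refine lintegral_congr fun ξ => ?_
  rw [lintegral_hyperplane (h₀.trans ξ.norm_eq.symm) h, ← lintegral_pow_mul_gaussian hn,
    ← lintegral_mul_const _ (by fun_prop)]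
  refine lintegral_congr fun r => ?_
  refine (lintegral_prod _
    ((measurable_pairKernel ξ₀ hh 0).comp measurable_prodMk_left).aemeasurable).trans ?_
  simp only [pairKernel, Function.comp, zero_div, zero_mul, zero_smul, add_zero]
  have hb : Measurable fun s : ℝ => ENNReal.ofReal (bump 1 s) := (measurable_bump 1).ennreal_ofReal
  simp only [lintegral_const_mul' _ _ ENNReal.ofReal_ne_top, lintegral_const_mul _ hb,
    lintegral_bump_one, mul_one]

end RayTransform

end

/-! ### The limit of the Gaussian averages and the integration formula -/

noncomputable section

namespace RayTransform

open scoped ENNReal NNReal BoundedContinuousFunction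

variable {n : ℕ}

theorem measurable_gaussian_norm :
    Measurable fun y : Rn n => ENNReal.ofReal (Real.exp (-‖y‖ ^ 2)) := by fun_prop

theorem lintegral_gaussian_flagMeasure_ne_top {ξ₀ : Rn n} (h₀ : ‖ξ₀‖ = 1) :
    ∫⁻ z, ENNReal.ofReal (Real.exp (-‖z.1‖ ^ 2)) ∂(flagMeasure ξ₀) ≠ ∞ := by
  have h := lintegral_flagMeasure h₀
    (k := fun z => ENNReal.ofReal (Real.exp (-‖z.1‖ ^ 2))) (by fun_prop)
  rw [h]
  have e : ∀ ξ : Sph n, ∫⁻ y : hyperplane (ξ : Rn n), ENNReal.ofReal (Real.exp (-‖(y : Rn n)‖ ^ 2))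
      ∂(lebesgue _) = ENNReal.ofReal (Real.pi ^ ((finrank ℝ (hyperplane ξ₀) : ℝ) / 2)) := by
    intro ξ
    rw [lintegral_hyperplane (h₀.trans ξ.norm_eq.symm)
      fun y => ENNReal.ofReal (Real.exp (-‖y‖ ^ 2)), ← lintegral_gaussian_norm]
    simp only [LinearIsometryEquiv.norm_map, Submodule.coe_norm]
  simp only [e, lintegral_const]
  exact ENNReal.mul_ne_top ENNReal.ofReal_ne_top (measure_ne_top _ _)

/-- By Pythagoras, leaving the hyperplane in the normal direction increases the norm, so the
Gaussian factor is largest at ε = 0 and dominates. -/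
theorem norm_le_norm_add_smul {ξ₀ ξ : Rn n} (h : ‖ξ₀‖ = ‖ξ‖) (v : hyperplane ξ₀) (c : ℝ) :
    ‖(v : Rn n)‖ ≤ ‖swapRefl ξ₀ ξ v + c • ξ‖ := by
  have hv : inner ℝ (swapRefl ξ₀ ξ v) (c • ξ) = 0 := by
    rw [inner_smul_right, real_inner_comm, ← coe_hyperplaneEquiv h,
      Submodule.mem_orthogonal_singleton_iff_inner_right.1 (Subtype.property _), mul_zero]
  have := norm_add_sq_eq_norm_sq_add_norm_sq_of_inner_eq_zero _ _ hv
  rw [LinearIsometryEquiv.norm_map] at this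
  refine abs_le_of_sq_le_sq' (a := ‖(v : Rn n)‖) ?_ (norm_nonneg _) |>.2
  nlinarith [norm_nonneg (c • ξ)]

/-- Dominated convergence, with the kernel at ε = 0 for a constant bound of f as majorant.
Continuity of f is needed for the pointwise limit, hence test functions first and measurable
functions later. -/
theorem tendsto_lintegral_pairKernel (hn : 2 ≤ n) {ξ₀ : Rn n} (h₀ : ‖ξ₀‖ = 1) (f : Rn n →ᵇ ℝ≥0) :
    Tendsto (fun k : ℕ => ∫⁻ p, pairKernel ξ₀
        (fun y => ENNReal.ofReal (Real.exp (-‖y‖ ^ 2)) * f y) (1 / ((k : ℝ) + 1)) p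
      ∂(((surface n).prod (volume.restrict (Set.Ioi 0))).prod
        ((lebesgue (hyperplane ξ₀)).prod volume))) atTop
      (𝓝 (∫⁻ p, pairKernel ξ₀ (fun y => ENNReal.ofReal (Real.exp (-‖y‖ ^ 2)) * f y) 0 p
        ∂(((surface n).prod (volume.restrict (Set.Ioi 0))).prod
          ((lebesgue (hyperplane ξ₀)).prod volume)))) := by
  have hf : Measurable fun y : Rn n => (f y : ℝ≥0∞) :=
    measurable_coe_nnreal_ennreal.comp f.continuous.measurable
  have hh := measurable_gaussian_norm.mul hf
  obtain ⟨C, hC⟩ := f.isBounded_range.bddAbove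
  refine tendsto_lintegral_of_dominated_convergence
    (pairKernel ξ₀ (fun y => ENNReal.ofReal (Real.exp (-‖y‖ ^ 2)) * (C : ℝ≥0∞)) 0)
    (fun k => measurable_pairKernel ξ₀ hh _) ?_ ?_ ?_
  · refine fun k => Eventually.of_forall fun p => ?_
    simp only [pairKernel, zero_div, zero_mul, zero_smul, add_zero, LinearIsometryEquiv.norm_map]
    gcongr
    · exact norm_le_norm_add_smul (h₀.trans p.1.1.norm_eq.symm) _ _
    · exact hC ⟨_, rfl⟩
  · rw [lintegral_pairKernel_zero hn h₀ (measurable_gaussian_norm.mul_const _)]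
    refine ENNReal.mul_ne_top ENNReal.ofReal_ne_top ?_
    rw [lintegral_mul_const' _ _ ENNReal.coe_ne_top]
    exact ENNReal.mul_ne_top (lintegral_gaussian_flagMeasure_ne_top h₀) ENNReal.coe_ne_top
  · refine Eventually.of_forall fun p => ?_
    have hc : Continuous fun ε : ℝ => pairKernel ξ₀
        (fun y => ENNReal.ofReal (Real.exp (-‖y‖ ^ 2)) * f y) ε p := by
      simp only [pairKernel]
      refine ENNReal.continuous_const_mul ENNReal.ofReal_ne_top |>.comp ?_
      refine ENNReal.continuous_mul_const ENNReal.ofReal_ne_top |>.comp ?_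
      have e : ∀ y : Rn n, ENNReal.ofReal (Real.exp (-‖y‖ ^ 2)) * (f y : ℝ≥0∞) =
          ((Real.toNNReal (Real.exp (-‖y‖ ^ 2)) * f y : ℝ≥0) : ℝ≥0∞) := fun y => by
        rw [ENNReal.coe_mul]; rfl
      simp only [e]
      refine ENNReal.continuous_coe.comp (Continuous.mul ?_ ?_)
      · exact continuous_real_toNNReal.comp (by fun_prop)
      · exact f.continuous.comp (by fun_prop)
    exact (hc.tendsto 0).comp tendsto_one_div_add_atTop_nhds_zero_nat

/-- Monotone convergence: the regularized 1/|y| increases as ε decreases. -/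
theorem tendsto_lintegral_inv_sqrt (hn : n ≠ 0) {h : Rn n → ℝ≥0∞} (hh : Measurable h) :
    Tendsto (fun k : ℕ => ∫⁻ y, h y *
        ENNReal.ofReal ((Real.sqrt ((1 / ((k : ℝ) + 1)) ^ 2 + ‖y‖ ^ 2))⁻¹) ∂(lebesgue _)) atTop
      (𝓝 (∫⁻ y, h y * ENNReal.ofReal ‖y‖⁻¹ ∂(lebesgue _))) := by
  have : Nontrivial (Rn n) := Module.nontrivial_of_finrank_pos (R := ℝ) (by
    rw [finrank_euclideanSpace_fin]; omega)
  have hne : ∀ᵐ y : Rn n ∂(lebesgue _), y ≠ 0 := Measure.ae_ne _ 0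
  refine lintegral_tendsto_of_tendsto_of_monotone (fun k => ?_) ?_ ?_
  · exact (hh.mul (by fun_prop)).aemeasurable
  · refine hne.mono fun y hy k l hkl => ?_
    have hy0 : 0 < ‖y‖ := norm_pos_iff.2 hy
    simp only
    gcongr
  · refine hne.mono fun y hy => ?_
    have hy0 : 0 < ‖y‖ := norm_pos_iff.2 hy
    have h1 : Tendsto (fun ε : ℝ => (Real.sqrt (ε ^ 2 + ‖y‖ ^ 2))⁻¹) (𝓝 0) (𝓝 ‖y‖⁻¹) := by
      have hc : ContinuousAt (fun ε : ℝ => (Real.sqrt (ε ^ 2 + ‖y‖ ^ 2))⁻¹) 0 := by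
        refine ContinuousAt.inv₀ (Continuous.continuousAt (by fun_prop)) ?_
        rw [zero_pow two_ne_zero, zero_add, Real.sqrt_sq hy0.le]
        exact hy0.ne'
      have := hc.tendsto
      rwa [zero_pow two_ne_zero, zero_add, Real.sqrt_sq hy0.le] at this
    refine ENNReal.Tendsto.const_mul ?_ (Or.inl ?_)
    · exact ENNReal.tendsto_ofReal (h1.comp tendsto_one_div_add_atTop_nhds_zero_nat)
    · simpa using hy

theorem lintegral_flagMeasure_gaussian (hn : 2 ≤ n) {ξ₀ : Rn n} (h₀ : ‖ξ₀‖ = 1)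
    (f : Rn n →ᵇ ℝ≥0) :
    ENNReal.ofReal (Real.Gamma (((n : ℝ) - 1) / 2) / 2) *
      ∫⁻ z, ENNReal.ofReal (Real.exp (-‖z.1‖ ^ 2)) * f z.1 ∂(flagMeasure ξ₀) =
    ENNReal.ofReal (Real.pi ^ (((n : ℝ) - 1) / 2)) *
      ∫⁻ y, ENNReal.ofReal (Real.exp (-‖y‖ ^ 2)) * f y * ENNReal.ofReal ‖y‖⁻¹ ∂(lebesgue _) := by
  have hf : Measurable fun y : Rn n => (f y : ℝ≥0∞) :=
    measurable_coe_nnreal_ennreal.comp f.continuous.measurable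
  have hh := measurable_gaussian_norm.mul hf
  have h1 := tendsto_lintegral_pairKernel hn h₀ f
  have h2 := ENNReal.Tendsto.const_mul (a := ENNReal.ofReal (Real.pi ^ (((n : ℝ) - 1) / 2)))
    (tendsto_lintegral_inv_sqrt (by omega) hh) (Or.inr ENNReal.ofReal_ne_top)
  refine ((lintegral_pairKernel_zero hn h₀ hh).symm.trans ?_)
  refine tendsto_nhds_unique h1 (h2.congr fun k => ?_)
  exact (lintegral_pairKernel (by omega) h₀ hh (by positivity)).symm

/-- Bounded continuous functions determine a finite measure; the Gaussian weight is there to make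
the measures finite. -/
theorem gaussian_measures_eq (hn : 2 ≤ n) {ξ₀ : Rn n} (h₀ : ‖ξ₀‖ = 1) :
    ENNReal.ofReal (Real.Gamma (((n : ℝ) - 1) / 2) / 2) •
      ((flagMeasure ξ₀).map Prod.fst).withDensity
        (fun y => ENNReal.ofReal (Real.exp (-‖y‖ ^ 2))) =
    ENNReal.ofReal (Real.pi ^ (((n : ℝ) - 1) / 2)) • (lebesgue (Rn n)).withDensity
        (fun y => ENNReal.ofReal (Real.exp (-‖y‖ ^ 2)) * ENNReal.ofReal ‖y‖⁻¹) := by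
  have hw : Measurable fun y : Rn n =>
    ENNReal.ofReal (Real.exp (-‖y‖ ^ 2)) * ENNReal.ofReal ‖y‖⁻¹ := by fun_prop
  have hfin : IsFiniteMeasure (((flagMeasure ξ₀).map Prod.fst).withDensity
      fun y => ENNReal.ofReal (Real.exp (-‖y‖ ^ 2))) := by
    refine isFiniteMeasure_withDensity ?_
    rw [lintegral_map measurable_gaussian_norm measurable_fst]
    exact lintegral_gaussian_flagMeasure_ne_top h₀
  have := Measure.smul_finite (((flagMeasure ξ₀).map Prod.fst).withDensity
      fun y => ENNReal.ofReal (Real.exp (-‖y‖ ^ 2))) (c := ENNReal.ofReal (Real.Gamma (((n : ℝ) - 1) / 2) / 2))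
    ENNReal.ofReal_ne_top
  refine ext_of_forall_lintegral_eq_of_IsFiniteMeasure fun f => ?_
  have hf : Measurable fun y : Rn n => (f y : ℝ≥0∞) :=
    measurable_coe_nnreal_ennreal.comp f.continuous.measurable
  rw [lintegral_smul_measure, lintegral_smul_measure,
    lintegral_withDensity_eq_lintegral_mul _ measurable_gaussian_norm hf,
    lintegral_withDensity_eq_lintegral_mul _ hw hf,
    lintegral_map (measurable_gaussian_norm.mul hf) measurable_fst]
  refine (lintegral_flagMeasure_gaussian hn h₀ f).trans ?_
  congr 1
  refine lintegral_congr fun y => ?_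
  simp only [Pi.mul_apply]
  ring

/-- Integration over all pairs `(y, ξ)` with `ξ ∈ 𝕊^{n-1}`, `y ∈ ξ^⊥` of a function of `y`. -/
theorem lintegral_norm_mul_flagMeasure (hn : 2 ≤ n) {ξ₀ : Rn n} (h₀ : ‖ξ₀‖ = 1)
    {h : Rn n → ℝ≥0∞} (hh : Measurable h) :
    ENNReal.ofReal (Real.Gamma (((n : ℝ) - 1) / 2) / 2) *
      ∫⁻ z, ENNReal.ofReal ‖z.1‖ * h z.1 ∂(flagMeasure ξ₀) =
    ENNReal.ofReal (Real.pi ^ (((n : ℝ) - 1) / 2)) * ∫⁻ y, h y ∂(lebesgue _) := by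
  have : Nontrivial (Rn n) := Module.nontrivial_of_finrank_pos (R := ℝ) (by
    rw [finrank_euclideanSpace_fin]; omega)
  have hne : ∀ᵐ y : Rn n ∂(lebesgue _), y ≠ 0 := Measure.ae_ne _ 0
  have hw : Measurable fun y : Rn n =>
    ENNReal.ofReal (Real.exp (-‖y‖ ^ 2)) * ENNReal.ofReal ‖y‖⁻¹ := by fun_prop
  have hg : Measurable fun y : Rn n =>
      ENNReal.ofReal (Real.exp (‖y‖ ^ 2)) * (ENNReal.ofReal ‖y‖ * h y) :=
    Measurable.mul (by fun_prop) (Measurable.mul (by fun_prop) hh)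
  have hexp : ∀ y : Rn n, ENNReal.ofReal (Real.exp (-‖y‖ ^ 2)) *
      ENNReal.ofReal (Real.exp (‖y‖ ^ 2)) = 1 := fun y => by
    rw [← ENNReal.ofReal_mul (Real.exp_pos _).le, ← Real.exp_add]
    simp
  -- Testing against e^{|y|²}|y|h removes the Gaussian weight and the density 1/|y|.
  have key := congrArg (fun μ => ∫⁻ y, ENNReal.ofReal (Real.exp (‖y‖ ^ 2)) *
    (ENNReal.ofReal ‖y‖ * h y) ∂μ) (gaussian_measures_eq hn h₀)
  simp only at key
  rw [lintegral_smul_measure, lintegral_smul_measure,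
    lintegral_withDensity_eq_lintegral_mul _ measurable_gaussian_norm hg,
    lintegral_withDensity_eq_lintegral_mul _ hw hg,
    lintegral_map (measurable_gaussian_norm.mul hg) measurable_fst] at key
  refine Eq.trans ?_ (key.trans ?_)
  · rw [smul_eq_mul]
    congr 1
    refine lintegral_congr fun z => ?_
    simp only [Pi.mul_apply]
    rw [← mul_assoc, hexp, one_mul]
  · rw [smul_eq_mul]
    congr 1
    refine lintegral_congr_ae (hne.mono fun y hy => ?_)
    simp only [Pi.mul_apply]
    have h1 : ENNReal.ofReal ‖y‖⁻¹ * ENNReal.ofReal ‖y‖ = 1 := by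
      rw [← ENNReal.ofReal_mul (by positivity), inv_mul_cancel₀ (norm_ne_zero_iff.2 hy),
        ENNReal.ofReal_one]
    calc _ = (ENNReal.ofReal (Real.exp (-‖y‖ ^ 2)) * ENNReal.ofReal (Real.exp (‖y‖ ^ 2))) *
          (ENNReal.ofReal ‖y‖⁻¹ * ENNReal.ofReal ‖y‖) * h y := by ring
      _ = h y := by rw [hexp, h1, one_mul, one_mul]

theorem constA_pos (hn : 2 ≤ n) : 0 < constA n := by
  have : (2 : ℝ) ≤ n := by exact_mod_cast hn
  have := Real.Gamma_pos_of_pos (s := ((n : ℝ) - 1) / 2) (by linarith)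
  have := Real.pi_pos
  unfold constA
  positivity

/-- a_n is the ratio of Γ((n-1)/2)/2 to π^{(n-1)/2}. No integrability is needed: for a nonnegative g
the two sides diverge together. -/
theorem constA_mul_integral_flagMeasure (hn : 2 ≤ n) {ξ₀ : Rn n} (h₀ : ‖ξ₀‖ = 1)
    {g : Rn n → ℝ} (hg : Measurable g) (hg0 : ∀ y, 0 ≤ g y) :
    constA n * ∫ z, ‖z.1‖ * g z.1 ∂(flagMeasure ξ₀) = ∫ y, g y ∂(lebesgue _) := by
  have key := congrArg ENNReal.toReal (lintegral_norm_mul_flagMeasure hn h₀ hg.ennreal_ofReal)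
  have h2 : (2 : ℝ) ≤ n := by exact_mod_cast hn
  have hG := Real.Gamma_pos_of_pos (s := ((n : ℝ) - 1) / 2) (by linarith)
  have hpi := Real.pi_pos
  have hP : 0 < Real.pi ^ (((n : ℝ) - 1) / 2) := by positivity
  rw [integral_eq_lintegral_of_nonneg_ae
      (Eventually.of_forall fun z => mul_nonneg (norm_nonneg _) (hg0 _))
      (Measurable.aestronglyMeasurable (by fun_prop)),
    integral_eq_lintegral_of_nonneg_ae (Eventually.of_forall hg0) hg.aestronglyMeasurable]
  simp only [ENNReal.ofReal_mul (norm_nonneg _)]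
  rw [ENNReal.toReal_mul, ENNReal.toReal_mul, ENNReal.toReal_ofReal (by positivity),
    ENNReal.toReal_ofReal hP.le] at key
  rw [constA, div_mul_eq_mul_div, div_eq_iff (by positivity)]
  linear_combination 2 * key

end RayTransform

end

noncomputable section

namespace RayTransform

variable {n : ℕ}

/-! ### Functions whose Fourier transform decays rapidly, uniformly in the direction -/

/-- Rapid decay in `y` on `{(y, ξ) : |ξ| = 1}`, uniformly in `ξ`. -/
def RapidDecay (G : Rn n × Rn n → ℂ) : Prop :=
  ∀ k : ℕ, ∃ C : ℝ, 0 < C ∧ ∀ z : Rn n × Rn n, ‖z.2‖ = 1 → (1 + ‖z.1‖) ^ k * ‖G z‖ ≤ C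

theorem RapidDecay.sum {ι : Type*} (s : Finset ι) {G : ι → Rn n × Rn n → ℂ}
    (h : ∀ i, RapidDecay (G i)) : RapidDecay (fun z => ∑ i ∈ s, G i z) := by
  intro k
  choose C hC hG using fun i => h i k
  refine ⟨∑ i ∈ s, C i + 1, add_pos_of_nonneg_of_pos
    (Finset.sum_nonneg fun i _ => (hC i).le) one_pos, fun z hz => ?_⟩
  calc _ ≤ (1 + ‖z.1‖) ^ k * ∑ i ∈ s, ‖G i z‖ := by gcongr; exact norm_sum_le _ _
    _ = ∑ i ∈ s, (1 + ‖z.1‖) ^ k * ‖G i z‖ := Finset.mul_sum _ _ _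
    _ ≤ ∑ i ∈ s, C i := Finset.sum_le_sum fun i _ => hG i z hz
    _ ≤ _ := by linarith

theorem RapidDecay.of_norm_le {G H : Rn n × Rn n → ℂ} (h : RapidDecay G)
    (hH : ∀ z, ‖H z‖ ≤ ‖G z‖) : RapidDecay H := by
  intro k
  obtain ⟨C, hC, hG⟩ := h k
  exact ⟨C, hC, fun z hz => le_trans (by gcongr; exact hH z) (hG z hz)⟩

theorem RapidDecay.mul {G H : Rn n × Rn n → ℂ} (hG : RapidDecay G) (hH : RapidDecay H) :
    RapidDecay (fun z => G z * H z) := by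
  intro k
  obtain ⟨C, hC, hG⟩ := hG k
  obtain ⟨D, hD, hH⟩ := hH 0
  refine ⟨C * D, by positivity, fun z hz => ?_⟩
  have h1 := hG z hz
  have h2 := hH z hz
  rw [pow_zero, one_mul] at h2
  rw [norm_mul, ← mul_assoc]
  gcongr

theorem integrable_weight_mul (hn : 2 ≤ n) {ξ₀ : Rn n} (h₀ : ‖ξ₀‖ = 1) {a : ℝ}
    (ha : 1 - (n : ℝ) < a) (e : ℝ) {G : Rn n × Rn n → ℂ} (hm : Measurable G)
    (hG : RapidDecay G) :
    Integrable (fun z => ((weight a e ‖z.1‖ : ℝ) : ℂ) * G z) (flagMeasure ξ₀) := by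
  -- With n = 2 + d the hyperplane has dimension d + 1, and 1 - n = -(d+1) is the threshold for
  -- integrability of |y|^a at the origin.
  obtain ⟨d, rfl⟩ := Nat.exists_eq_add_of_le hn
  have hd : finrank ℝ (hyperplane ξ₀) = d + 1 := by
    have := finrank_hyperplane_add_one h₀
    omega
  push_cast at ha
  obtain ⟨k, hk⟩ := exists_integrable_weight d (by linarith : -(d + 1 : ℝ) < a) e
  obtain ⟨C, hC, hb⟩ := hG k
  refine integrable_flagMeasure (ρ := fun r => C * (weight a e r * ((1 + r) ^ k)⁻¹)) ?_
    ((hk (hyperplane ξ₀) hd).const_mul C) fun z hz => ?_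
  · refine Measurable.mul ?_ hm
    exact Complex.measurable_ofReal.comp ((measurable_weight a e).comp (by fun_prop))
  · have hw := weight_nonneg a e (norm_nonneg z.1)
    rw [norm_mul, Complex.norm_real, Real.norm_of_nonneg hw]
    calc weight a e ‖z.1‖ * ‖G z‖
        = weight a e ‖z.1‖ * (((1 + ‖z.1‖) ^ k)⁻¹ * ((1 + ‖z.1‖) ^ k * ‖G z‖)) := by
          rw [inv_mul_cancel_left₀ (by positivity)]
      _ ≤ weight a e ‖z.1‖ * (((1 + ‖z.1‖) ^ k)⁻¹ * C) := by
          gcongr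
          exact hb z hz
      _ = _ := by ring

/-- The function `φ̂` is given, off the zero section, by the measurable function `G` of rapid
decay. -/
structure HasSymbol (φ : TS n → ℂ) (G : Rn n × Rn n → ℂ) : Prop where
  measurable : Measurable G
  rapidDecay : RapidDecay G
  hat_eq : ∀ p : TS n, p.1.1 ≠ 0 → hat φ p = G p.1

theorem RayRep.hasSymbol {φ : TS n → ℂ} {Ψ : Rn n × Rn n → ℂ} (h : RayRep φ Ψ) :
    HasSymbol φ Ψ :=
  ⟨h.contDiff.continuous.measurable, h.decay, fun p _ => h.hat_eq p⟩

/-- For n ≥ 2 the fibres have positive dimension, so the zero section is a null set. This is where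
the symbols of Z, Q, W are singular. -/
theorem ae_flagMeasure (hn : 2 ≤ n) {ξ₀ : Rn n} (h₀ : ‖ξ₀‖ = 1) :
    ∀ᵐ z ∂(flagMeasure ξ₀), ∃ p : TS n, p.1 = z ∧ p.1.1 ≠ 0 := by
  have hd := finrank_hyperplane_add_one h₀
  have : Nontrivial (hyperplane ξ₀) := Module.nontrivial_of_finrank_pos (R := ℝ) (by omega)
  have hne : ∀ᵐ v : hyperplane ξ₀ ∂(lebesgue _), v ≠ 0 := Measure.ae_ne _ 0
  have h1 : ∀ᵐ p ∂((surface n).prod (lebesgue (hyperplane ξ₀))), p.2 ≠ 0 :=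
    Measure.quasiMeasurePreserving_snd.ae hne
  have hm : MeasurableSet {z : Rn n × Rn n | (‖z.2‖ = 1 ∧ inner ℝ z.2 z.1 = 0) ∧ z.1 ≠ 0} := by
    refine MeasurableSet.inter (MeasurableSet.inter ?_ ?_) ?_
    · exact (isClosed_eq (by fun_prop) (by fun_prop)).measurableSet
    · exact (isClosed_eq (by fun_prop) (by fun_prop)).measurableSet
    · exact (isOpen_ne_fun (by fun_prop) (by fun_prop)).measurableSet
  have h2 : ∀ᵐ z ∂(flagMeasure ξ₀), (‖z.2‖ = 1 ∧ inner ℝ z.2 z.1 = 0) ∧ z.1 ≠ 0 := by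
    rw [flagMeasure, ae_map_iff (measurable_flag ξ₀).aemeasurable hm]
    refine h1.mono fun p hp => ⟨⟨p.1.norm_eq, ?_⟩, ?_⟩
    · exact Submodule.mem_orthogonal_singleton_iff_inner_right.1
        (hyperplaneEquiv (h₀.trans p.1.norm_eq.symm) p.2).2
    · simpa using hp
  exact h2.mono fun z hz => ⟨⟨z, hz.1⟩, rfl, hz.2⟩

theorem pairDensity_ae_eq (hn : 2 ≤ n) {σ τ : ℝ} {φ ψ : TS n → ℂ} {G H : Rn n × Rn n → ℂ}
    (hφ : HasSymbol φ G) (hψ : HasSymbol ψ H) (ξ : Sph n) :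
    pairDensity σ τ φ ψ ξ =ᵐ[lebesgue (hyperplane (ξ : Rn n))] fun y =>
      ((weight (2 * τ) (σ - τ) ‖(y : Rn n)‖ : ℝ) : ℂ) *
        (G ((y : Rn n), (ξ : Rn n)) * conj (H ((y : Rn n), (ξ : Rn n)))) := by
  have hd := finrank_hyperplane_add_one ξ.norm_eq
  have : Nontrivial (hyperplane (ξ : Rn n)) :=
    Module.nontrivial_of_finrank_pos (R := ℝ) (by omega)
  have hne : ∀ᵐ v : hyperplane (ξ : Rn n) ∂(lebesgue _), v ≠ 0 := Measure.ae_ne _ 0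
  refine hne.mono fun y hy => ?_
  have hy' : (TS.ofSphere ξ y).1.1 ≠ 0 := by simpa [TS.ofSphere, TS.mk] using hy
  simp only [pairDensity, hφ.hat_eq _ hy', hψ.hat_eq _ hy', weight, Submodule.coe_norm]
  rfl

theorem integrable_pair_symbol (hn : 2 ≤ n) {ξ₀ : Rn n} (h₀ : ‖ξ₀‖ = 1) {a : ℝ}
    (ha : 1 - (n : ℝ) < a) (e : ℝ) {φ ψ : TS n → ℂ} {G H : Rn n × Rn n → ℂ}
    (hφ : HasSymbol φ G) (hψ : HasSymbol ψ H) :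
    Integrable (fun z => ((weight a e ‖z.1‖ : ℝ) : ℂ) * (G z * conj (H z))) (flagMeasure ξ₀) :=
  integrable_weight_mul hn h₀ ha e
    (hφ.measurable.mul (Complex.continuous_conj.measurable.comp hψ.measurable))
    (hφ.rapidDecay.mul (hψ.rapidDecay.of_norm_le fun z => by simp))

theorem pairConverges_of_hasSymbol (hn : 2 ≤ n) {σ τ : ℝ} (hτ : 1 - (n : ℝ) < 2 * τ)
    {φ ψ : TS n → ℂ} {G H : Rn n × Rn n → ℂ} (hφ : HasSymbol φ G) (hψ : HasSymbol ψ H) :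
    PairConverges σ τ φ ψ := by
  obtain ⟨ξ₀, h₀⟩ : ∃ ξ₀ : Rn n, ‖ξ₀‖ = 1 := ⟨EuclideanSpace.single ⟨0, by omega⟩ 1, by simp⟩
  have hi := integrable_pair_symbol hn h₀ hτ (σ - τ) hφ hψ
  refine ⟨?_, ?_, ?_⟩
  · exact (integrable_fibre_ae h₀ hi).mono fun ξ hξ =>
      hξ.congr (pairDensity_ae_eq hn hφ hψ ξ).symm
  · refine (integrable_integral_fibre h₀ hi).congr (Eventually.of_forall fun ξ => ?_)
    exact integral_congr_ae (pairDensity_ae_eq hn hφ hψ ξ).symm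
  · refine (integrable_integral_fibre h₀ hi.norm).congr (Eventually.of_forall fun ξ => ?_)
    exact integral_congr_ae ((pairDensity_ae_eq hn hφ hψ ξ).fun_comp norm).symm

theorem pair_eq_integral (hn : 2 ≤ n) {ξ₀ : Rn n} (h₀ : ‖ξ₀‖ = 1) {σ τ : ℝ}
    (hτ : 1 - (n : ℝ) < 2 * τ) {φ ψ : TS n → ℂ} {G H : Rn n × Rn n → ℂ}
    (hφ : HasSymbol φ G) (hψ : HasSymbol ψ H) :
    pair σ τ φ ψ = ((1 / (2 * Real.pi) : ℝ) : ℂ) *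
      ∫ z, ((weight (2 * τ) (σ - τ) ‖z.1‖ : ℝ) : ℂ) * (G z * conj (H z)) ∂(flagMeasure ξ₀) := by
  rw [pair, integral_flagMeasure h₀ (integrable_pair_symbol hn h₀ hτ (σ - τ) hφ hψ)]
  congr 1
  refine integral_congr_ae (Eventually.of_forall fun ξ => ?_)
  exact integral_congr_ae (pairDensity_ae_eq hn hφ hψ ξ)

theorem pair_self (σ τ : ℝ) (φ : TS n → ℂ) : pair σ τ φ φ = (normSq σ τ φ : ℂ) := by
  rw [pair, normSq, Complex.ofReal_mul, ← integral_complex_ofReal]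
  congr 1
  refine integral_congr_ae (Eventually.of_forall fun ξ => ?_)
  simp only
  rw [← integral_complex_ofReal]
  refine integral_congr_ae (Eventually.of_forall fun y => ?_)
  simp only [pairDensity, Complex.mul_conj']
  push_cast
  rfl

/-! ### The operators `Z`, `Q`, `W` on sums of ray transforms -/

theorem integrable_of_rapidDecay {G : Rn n × Rn n → ℂ} (hm : Measurable G) (hG : RapidDecay G)
    {ξ : Rn n} (hξ : ‖ξ‖ = 1) :
    Integrable (fun y : hyperplane ξ => G ((y : Rn n), ξ)) (lebesgue _) := by
  obtain ⟨C, hC, hb⟩ := hG (finrank ℝ (hyperplane ξ) + 1)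
  have h1 : Integrable (fun y : hyperplane ξ =>
      C * (1 + ‖y‖) ^ (-((finrank ℝ (hyperplane ξ) + 1 : ℕ) : ℝ))) (lebesgue _) :=
    (integrable_one_add_norm (by push_cast; linarith)).const_mul C
  refine h1.mono' (hm.comp (by fun_prop)).aestronglyMeasurable (Eventually.of_forall fun y => ?_)
  have h2 := hb ((y : Rn n), ξ) hξ
  rw [Real.rpow_neg (by positivity), Real.rpow_natCast, ← div_eq_mul_inv,
    le_div_iff₀ (by positivity), mul_comm]
  exact h2

/-- The inverse transform of a discontinuous multiplier need not be integrable, but Gaussian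
summation recovers the multiplier wherever it is continuous, thus for all y ≠ 0. The coefficients c
stand for y_i/|y| and y_iy_j/|y|². -/
theorem hasSymbol_invHat {ι : Type*} [Fintype ι] {c : ι → Rn n → ℝ} (hc : ∀ i y, |c i y| ≤ 1)
    (hcm : ∀ i, Measurable (c i)) (hcc : ∀ i y, y ≠ 0 → ContinuousAt (c i) y)
    {φ : ι → TS n → ℂ} {Ψ : ι → Rn n × Rn n → ℂ} (h : ∀ i, RayRep (φ i) (Ψ i)) :
    HasSymbol (invHat fun p => ∑ i, ((c i p.1.1 : ℝ) : ℂ) * hat (φ i) p)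
      (fun z => ∑ i, ((c i z.1 : ℝ) : ℂ) * Ψ i z) := by
  have hm : Measurable fun z : Rn n × Rn n => ∑ i, ((c i z.1 : ℝ) : ℂ) * Ψ i z :=
    Finset.measurable_sum _ fun i _ => Measurable.mul
      (Complex.measurable_ofReal.comp ((hcm i).comp measurable_fst))
      (h i).contDiff.continuous.measurable
  have hr : RapidDecay fun z : Rn n × Rn n => ∑ i, ((c i z.1 : ℝ) : ℂ) * Ψ i z := by
    refine RapidDecay.sum _ fun i => RapidDecay.of_norm_le (h i).decay fun z => ?_
    rw [norm_mul, Complex.norm_real]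
    exact mul_le_of_le_one_left (norm_nonneg _) (hc i z.1)
  refine ⟨hm, hr, fun p hp => ?_⟩
  have e : (fun p : TS n => ∑ i, ((c i p.1.1 : ℝ) : ℂ) * hat (φ i) p) =
      fun p => ∑ i, ((c i p.1.1 : ℝ) : ℂ) * Ψ i p.1 := by
    ext p
    simp only [(h _).hat_eq]
  rw [e]
  refine hat_invHat _ p (integrable_of_rapidDecay hm hr p.2.1) ?_
  refine tendsto_finsetSum _ fun i _ => ContinuousAt.mul ?_ ?_
  · refine Complex.continuous_ofReal.continuousAt.comp ?_
    exact ContinuousAt.comp (f := fun y : hyperplane p.1.2 => (y : Rn n)) (hcc i _ hp)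
      continuous_subtype_val.continuousAt
  · have : Continuous fun y : hyperplane p.1.2 => Ψ i ((y : Rn n), p.1.2) :=
      (h i).contDiff.continuous.comp (by fun_prop)
    exact this.continuousAt

/-- The definitions of Z and Q differentiate φ̂; this brings them to the form treated by
`hasSymbol_invHat`. -/
theorem RayRep.opXi_hat {φ : TS n → ℂ} {Ψ : Rn n × Rn n → ℂ} (h : RayRep φ Ψ) (i : Fin n) :
    RayTransform.opXi i (hat φ) = hat (RayTransform.opXi i φ) := by
  obtain ⟨Ψ', r, e⟩ := h.opXi i
  ext q
  rw [h.hat_eq_fun, r.hat_eq, e, opXi_eq i _ Ψ (fun _ => rfl) q (h.differentiable _)]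

theorem RayRep.opX_hat {φ : TS n → ℂ} {Ψ : Rn n × Rn n → ℂ} (h : RayRep φ Ψ) (i : Fin n)
    (q : TS n) : opX i (hat φ) q = -Complex.I * hat (RayTransform.mulX i φ) q := by
  obtain ⟨Ψ', r, e⟩ := h.mulX i
  rw [h.hat_eq_fun, r.hat_eq, e, opX_eq i _ Ψ (fun _ => rfl) q (h.differentiable _),
    ← mul_assoc, neg_mul, Complex.I_mul_I, neg_neg, one_mul]

theorem abs_coord_div_norm_le (i : Fin n) (y : Rn n) : |y i / ‖y‖| ≤ 1 := by
  rw [abs_div, abs_norm]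
  exact div_le_one_of_le₀ (PiLp.norm_apply_le y i) (norm_nonneg _)

theorem continuousAt_coord_div_norm (i : Fin n) {y : Rn n} (hy : y ≠ 0) :
    ContinuousAt (fun y : Rn n => y i / ‖y‖) y := by
  have h1 : Continuous fun y : Rn n => y i := by fun_prop
  exact h1.continuousAt.div continuous_norm.continuousAt (norm_ne_zero_iff.2 hy)

theorem measurable_coord_div_norm (i : Fin n) : Measurable fun y : Rn n => y i / ‖y‖ := by
  fun_prop

/-- The function `φ` is a finite sum of ray transforms with smooth coefficients. -/
def IsRaySum (φ : TS n → ℂ) : Prop := ∃ Ψ, RayRep φ Ψ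

theorem IsRaySum.opXi {φ : TS n → ℂ} (h : IsRaySum φ) (i : Fin n) :
    IsRaySum (RayTransform.opXi i φ) := by
  obtain ⟨Ψ, h⟩ := h
  obtain ⟨Ψ', r, -⟩ := h.opXi i
  exact ⟨Ψ', r⟩

theorem IsRaySum.mulX {φ : TS n → ℂ} (h : IsRaySum φ) (i : Fin n) :
    IsRaySum (RayTransform.mulX i φ) := by
  obtain ⟨Ψ, h⟩ := h
  obtain ⟨Ψ', r, -⟩ := h.mulX i
  exact ⟨Ψ', r⟩

theorem IsRaySum.exists_hasSymbol {φ : TS n → ℂ} (h : IsRaySum φ) : ∃ G, HasSymbol φ G := by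
  obtain ⟨Ψ, h⟩ := h
  exact ⟨Ψ, h.hasSymbol⟩

theorem IsRaySum.opZ_hasSymbol {φ : TS n → ℂ} (h : IsRaySum φ) : ∃ G, HasSymbol (opZ φ) G ∧
    ∀ p : TS n, G p.1 = ∑ i, ((p.1.1 i / ‖p.1.1‖ : ℝ) : ℂ) * hat (RayTransform.opXi i φ) p := by
  choose Ψ' r using fun i => h.opXi i
  obtain ⟨Ψ, h⟩ := h
  refine ⟨fun z => ∑ i, ((z.1 i / ‖z.1‖ : ℝ) : ℂ) * Ψ' i z, ?_, ?_⟩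
  · have := hasSymbol_invHat (c := fun i (y : Rn n) => y i / ‖y‖) abs_coord_div_norm_le
      measurable_coord_div_norm (fun i y hy => continuousAt_coord_div_norm i hy) r
    simpa only [opZ, h.opXi_hat] using this
  · intro p
    simp only [(r _).hat_eq]

theorem IsRaySum.opW_hasSymbol {φ : TS n → ℂ} (h : IsRaySum φ) : ∃ G, HasSymbol (opW φ) G ∧
    ∀ p : TS n, G p.1 = ∑ i, ((p.1.1 i / ‖p.1.1‖ : ℝ) : ℂ) *
      (-Complex.I * hat (RayTransform.mulX i φ) p) := by
  choose Ψ' r using fun i => h.mulX i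
  obtain ⟨Ψ, h⟩ := h
  -- The factor -i from X_i φ̂ = -i (x_iφ)^ is absorbed into the representation as a constant
  -- coefficient.
  have r' := fun i => (r i).mul_dir (p := fun _ => -Complex.I) contDiff_const
  have e : ∀ i p, hat (fun q => -Complex.I * RayTransform.mulX i φ q) p =
      -Complex.I * hat (RayTransform.mulX i φ) p := fun i p => by
    rw [(r' i).hat_eq, (r i).hat_eq]
  refine ⟨fun z => ∑ i, ((z.1 i / ‖z.1‖ : ℝ) : ℂ) * (-Complex.I * Ψ' i z), ?_, ?_⟩
  · have := hasSymbol_invHat (c := fun i (y : Rn n) => y i / ‖y‖) abs_coord_div_norm_le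
      measurable_coord_div_norm (fun i y hy => continuousAt_coord_div_norm i hy) r'
    simpa only [opW, h.opX_hat, e] using this
  · intro p
    simp only [(r _).hat_eq]

theorem IsRaySum.opQ_hasSymbol {φ : TS n → ℂ} (h : IsRaySum φ) : ∃ G, HasSymbol (opQ φ) G ∧
    ∀ p : TS n, G p.1 = ∑ i, ∑ j, ((p.1.1 i * p.1.1 j / ‖p.1.1‖ ^ 2 : ℝ) : ℂ) *
      hat (RayTransform.opXi i (RayTransform.opXi j φ)) p := by
  choose Ψ' r using fun ij : Fin n × Fin n => (h.opXi ij.2).opXi ij.1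
  choose Ψ₁ r₁ using fun i => h.opXi i
  obtain ⟨Ψ, h⟩ := h
  have e : ∀ (ij : Fin n × Fin n) (y : Rn n), y ij.1 * y ij.2 / ‖y‖ ^ 2 =
      y ij.1 / ‖y‖ * (y ij.2 / ‖y‖) := fun ij y => by rw [div_mul_div_comm, pow_two]
  refine ⟨fun z => ∑ ij, ((z.1 ij.1 * z.1 ij.2 / ‖z.1‖ ^ 2 : ℝ) : ℂ) * Ψ' ij z, ?_, ?_⟩
  · have := hasSymbol_invHat (c := fun (ij : Fin n × Fin n) (y : Rn n) =>
        y ij.1 * y ij.2 / ‖y‖ ^ 2) (fun ij y => ?_) (fun ij => by fun_prop)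
        (fun ij y hy => ?_) r
    · simpa only [opQ, h.opXi_hat, (r₁ _).opXi_hat, Fintype.sum_prod_type] using this
    · rw [e, abs_mul]
      exact mul_le_one₀ (abs_coord_div_norm_le _ _) (abs_nonneg _) (abs_coord_div_norm_le _ _)
    · simp only [e]
      exact (continuousAt_coord_div_norm _ hy).mul (continuousAt_coord_div_norm _ hy)
  · intro p
    refine (Fintype.sum_prod_type _).trans ?_
    exact Finset.sum_congr rfl fun i _ => Finset.sum_congr rfl fun j _ => by rw [(r (i, j)).hat_eq]

end RayTransform

end

noncomputable section

namespace RayTransform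

variable {n : ℕ}

/-! ### The density of the Reshetnyak formula -/

/-- The computed transforms satisfy the hypotheses of `reshetnyak_pointwise` with M = F(y), v = F(·,
ξ), w = (ξ·∂)F(·, ξ), d = ∂F(ξ, ξ) and c = (ξ·∂)²F(ξ, ξ). -/
theorem reshetnyak_density (f : Fin n → Fin n → 𝓢(Rn n, ℂ)) (hf : ∀ i j, f i j = f j i)
    (p : TS n) (hp : p.1.1 ≠ 0) {H0 H1 H2 Z0 Z1 Q0 W0 : ℂ} {A0 A1 X ZX : Fin n → ℂ}
    {T : Fin n → Fin n → ℂ} (hH0 : H0 = hat (momentRay 0 f) p) (hH1 : H1 = hat (momentRay 1 f) p)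
    (hH2 : H2 = hat (momentRay 2 f) p) (hA0 : ∀ i, A0 i = hat (opXi i (momentRay 0 f)) p)
    (hX : ∀ i, X i = hat (mulX i (momentRay 0 f)) p)
    (hA1 : ∀ i, A1 i = hat (opXi i (momentRay 1 f)) p)
    (hT : ∀ i j, T i j = hat (opXi i (opXi j (momentRay 0 f))) p)
    (hZ0 : Z0 = ∑ i, ((p.1.1 i / ‖p.1.1‖ : ℝ) : ℂ) * A0 i)
    (hZ1 : Z1 = ∑ i, ((p.1.1 i / ‖p.1.1‖ : ℝ) : ℂ) * A1 i)
    (hQ0 : Q0 = ∑ i, ∑ j, ((p.1.1 i * p.1.1 j / ‖p.1.1‖ ^ 2 : ℝ) : ℂ) * T i j)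
    (hW0 : W0 = ∑ i, ((p.1.1 i / ‖p.1.1‖ : ℝ) : ℂ) * (-Complex.I * X i))
    (hZX : ∀ i, ZX i = ∑ j, ((p.1.1 j / ‖p.1.1‖ : ℝ) : ℂ) * T j i) :
    ‖p.1.1‖ ^ 4 * ‖H2‖ ^ 2 + 4 * (‖p.1.1‖ ^ 3 * (H2 * conj Z1).im)
      + 2 * ∑ i, ‖p.1.1‖ ^ 2 * ‖A1 i‖ ^ 2 + 2 * (‖p.1.1‖ ^ 2 * ‖H1‖ ^ 2)
      + 2 * (‖p.1.1‖ ^ 2 * ‖Z1‖ ^ 2) + 2 * (‖p.1.1‖ ^ 3 * (H2 * conj W0).re)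
      - 4 * (‖p.1.1‖ ^ 2 * (H2 * conj H0).re) - 2 * (‖p.1.1‖ ^ 2 * (H2 * conj Q0).re)
      - 4 * ∑ i, ‖p.1.1‖ ^ 2 * (A1 i * conj (X i)).re + 8 * (‖p.1.1‖ * (Z1 * conj H0).im)
      + 4 * (‖p.1.1‖ * (H1 * conj Z0).im) + 4 * ∑ i, ‖p.1.1‖ * (A1 i * conj (ZX i)).im
      + ∑ i, ‖p.1.1‖ ^ 2 * ‖X i‖ ^ 2 - 2 * ∑ i, ‖p.1.1‖ * (X i * conj (ZX i)).im
      - 4 * (‖p.1.1‖ * (W0 * conj H0).re) + ∑ i, ∑ j, ‖T i j‖ ^ 2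
      + 4 * ∑ i, (T i i * conj H0).re + ∑ i, ‖A0 i‖ ^ 2 + 4 * n * ‖H0‖ ^ 2 =
    4 * ∑ i, ∑ j, ‖hatField f i j p.1.1‖ ^ 2 := by
  have hjet : Jet (fun i => (p.1.2 i : ℂ)) (fun i j => hatField f i j p.1.1)
      (fun i => form0 (hatField f) p.1.1 (EuclideanSpace.single i 1) p.1.2)
      (fun i => form1 (hatField f) p.1.1 p.1.2 (EuclideanSpace.single i 1) p.1.2)
      (fun i => form1 (hatField f) p.1.1 (EuclideanSpace.single i 1) p.1.2 p.1.2)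
      (form0 (hatField f) p.1.1 p.1.2 p.1.2) (form1 (hatField f) p.1.1 p.1.2 p.1.2 p.1.2) :=
    { symm := fun i j => by rw [hatField_symm hf]
      v_eq := fun i => form0_single _ _ i p.1.2
      a_eq := sum_form0_single _ _ p.1.2 p.1.2
      w_dot := sum_form1_single _ _ p.1.2 p.1.2 p.1.2
      d_dot := sum_form1_single_dir _ _ p.1.2 p.1.2 p.1.2 }
  have hξξ : ∑ i, p.1.2 i * p.1.2 i = 1 := by exact_mod_cast sum_sq_eq_one p
  have hξy : ∑ i, p.1.2 i * p.1.1 i = 0 := by exact_mod_cast sum_mul_eq_zero p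
  have hyy : ∑ i, p.1.1 i * p.1.1 i = ‖p.1.1‖ ^ 2 := by
    rw [EuclideanSpace.real_norm_sq_eq]
    exact Finset.sum_congr rfl fun i _ => (pow_two _).symm
  have key := reshetnyak_pointwise (norm_pos_iff.2 hp) hξξ hξy hyy
    (form2 (hatField f) p.1.1 p.1.2 p.1.2 p.1.2 p.1.2) hjet
    (hH0.trans ((momentRay_zero_rep f).hat_eq p)) (hH1.trans ((momentRay_one_rep f).hat_eq p))
    (hH2.trans ((momentRay_two_rep f).hat_eq p))
    (fun i => (hA0 i).trans (hat_opXi_momentRay_zero hf i p))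
    (fun i => (hX i).trans (hat_mulX_momentRay_zero i p))
    (fun i => (hA1 i).trans ((hat_opXi_momentRay_one hf i p).trans (by ring)))
    (fun i j => (hT i j).trans ((hat_opXi_opXi_momentRay_zero hf i j p).trans (by ring)))
    hZ0 hZ1 hQ0 hW0 hZX
  rw [Fintype.card_fin] at key
  exact key

/-- `x` is `(2π)⁻¹` times the (absolutely convergent) integral over `T𝕊^{n-1}` of `w(|y|) g`. -/
def IsFlagIntegral (ξ₀ : Rn n) (w : ℝ → ℝ) (g : Rn n × Rn n → ℝ) (x : ℝ) : Prop :=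
  Integrable (fun z => w ‖z.1‖ * g z) (flagMeasure ξ₀) ∧
    1 / (2 * Real.pi) * ∫ z, w ‖z.1‖ * g z ∂(flagMeasure ξ₀) = x

/-! ### Linearity of the weighted integrals over the tangent bundle of the sphere -/

namespace IsFlagIntegral

variable {ξ₀ : Rn n} {w : ℝ → ℝ} {g h : Rn n × Rn n → ℝ} {x y : ℝ}

theorem add (hg : IsFlagIntegral ξ₀ w g x) (hh : IsFlagIntegral ξ₀ w h y) :
    IsFlagIntegral ξ₀ w (fun z => g z + h z) (x + y) := by
  refine ⟨?_, ?_⟩ <;> simp only [mul_add]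
  · exact hg.1.add hh.1
  · rw [integral_add hg.1 hh.1, mul_add, hg.2, hh.2]

theorem const_mul (hg : IsFlagIntegral ξ₀ w g x) (c : ℝ) :
    IsFlagIntegral ξ₀ w (fun z => c * g z) (c * x) := by
  refine ⟨?_, ?_⟩ <;> simp only [mul_left_comm _ c]
  · exact hg.1.const_mul c
  · rw [integral_const_mul, mul_left_comm, hg.2]

theorem sub (hg : IsFlagIntegral ξ₀ w g x) (hh : IsFlagIntegral ξ₀ w h y) :
    IsFlagIntegral ξ₀ w (fun z => g z - h z) (x - y) := by
  simpa only [sub_eq_add_neg, neg_one_mul] using hg.add (hh.const_mul (-1))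

theorem sum {ι : Type*} (s : Finset ι) {g : ι → Rn n × Rn n → ℝ} {x : ι → ℝ}
    (hg : ∀ i, IsFlagIntegral ξ₀ w (g i) (x i)) :
    IsFlagIntegral ξ₀ w (fun z => ∑ i ∈ s, g i z) (∑ i ∈ s, x i) := by
  refine ⟨?_, ?_⟩ <;> simp only [Finset.mul_sum]
  · exact integrable_finsetSum _ fun i _ => (hg i).1
  · rw [integral_finsetSum _ fun i _ => (hg i).1, Finset.mul_sum]
    exact Finset.sum_congr rfl fun i _ => (hg i).2

theorem unique (hg : IsFlagIntegral ξ₀ w g x) (hh : IsFlagIntegral ξ₀ w h y)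
    (hgh : g =ᵐ[flagMeasure ξ₀] h) : x = y := by
  rw [← hg.2, ← hh.2]
  congr 1
  refine integral_congr_ae (hgh.mono fun z hz => ?_)
  simp only [hz]

end IsFlagIntegral

theorem weight_shift {a e R : ℝ} (hR : 0 < R) {a' e' : ℝ} {m : ℕ} (ha : a' = a + m)
    (he : e' = e) : weight a' e' R = weight a e R * R ^ m := by
  rw [weight, weight, ha, he, Real.rpow_add hR, Real.rpow_natCast]
  ring

/-- Shifting both orders by (m+1)/2 keeps s - t and turns |y|^{2t} into |y|^{2t+1}|y|^m. All terms
of the formula thus become integrals against one weight, and |y|^m joins the integrand. The map L is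
the real or the imaginary part. -/
theorem isFlagIntegral_pair (hn : 2 ≤ n) {ξ₀ : Rn n} (h₀ : ‖ξ₀‖ = 1) {s t : ℝ}
    (ht : -(n : ℝ) / 2 < t) (m : ℕ) {σ τ : ℝ} (hσ : σ = s + (m + 1) / 2) (hτ : τ = t + (m + 1) / 2)
    {φ ψ : TS n → ℂ} {G H : Rn n × Rn n → ℂ} (hφ : HasSymbol φ G) (hψ : HasSymbol ψ H)
    (L : ℂ →L[ℝ] ℝ) :
    IsFlagIntegral ξ₀ (weight (2 * t + 1) (s - t)) (fun z => ‖z.1‖ ^ m * L (G z * conj (H z)))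
      (L (pair σ τ φ ψ)) := by
  have hm : (0 : ℝ) ≤ m := Nat.cast_nonneg m
  have hτ' : 1 - (n : ℝ) < 2 * τ := by linarith
  have hi := integrable_pair_symbol hn h₀ hτ' (σ - τ) hφ hψ
  have hae : (fun z => L (((weight (2 * τ) (σ - τ) ‖z.1‖ : ℝ) : ℂ) * (G z * conj (H z))))
      =ᵐ[flagMeasure ξ₀] fun z => weight (2 * t + 1) (s - t) ‖z.1‖ *
        (‖z.1‖ ^ m * L (G z * conj (H z))) := by
    refine (ae_flagMeasure hn h₀).mono ?_
    rintro z ⟨p, rfl, hp⟩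
    simp only
    rw [weight_shift (norm_pos_iff.2 hp) (a := 2 * t + 1) (e := s - t) (m := m)
      (by linarith) (by linarith), ← Complex.real_smul, map_smul, smul_eq_mul, mul_assoc]
  refine ⟨(L.integrable_comp hi).congr hae, ?_⟩
  rw [← integral_congr_ae hae, L.integral_comp_comm hi, pair_eq_integral hn h₀ hτ' hφ hψ,
    ← Complex.real_smul, map_smul, smul_eq_mul]

theorem isFlagIntegral_normSq (hn : 2 ≤ n) {ξ₀ : Rn n} (h₀ : ‖ξ₀‖ = 1) {s t : ℝ}
    (ht : -(n : ℝ) / 2 < t) (m : ℕ) {σ τ : ℝ} (hσ : σ = s + (m + 1) / 2) (hτ : τ = t + (m + 1) / 2)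
    {φ : TS n → ℂ} {G : Rn n × Rn n → ℂ} (hφ : HasSymbol φ G) :
    IsFlagIntegral ξ₀ (weight (2 * t + 1) (s - t)) (fun z => ‖z.1‖ ^ m * ‖G z‖ ^ 2)
      (normSq σ τ φ) := by
  have := isFlagIntegral_pair hn h₀ ht m hσ hτ hφ hφ Complex.reCLM
  rw [pair_self] at this
  simpa [Complex.mul_conj, Complex.normSq_eq_norm_sq, ← Complex.ofReal_pow] using this

/-! ### The `H^s_t` norm of a Schwartz function -/

theorem sobolevDensity_eq (s t : ℝ) (g : 𝓢(Rn n, ℂ)) (y : Rn n) :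
    sobolevDensity s t g y = weight (2 * t) (s - t) ‖y‖ * ‖sFourier g y‖ ^ 2 := by
  rw [sobolevDensity, fourier_schwartz, weight]

theorem measurable_sobolevDensity (s t : ℝ) (g : 𝓢(Rn n, ℂ)) :
    Measurable (sobolevDensity s t g) := by
  have e : sobolevDensity s t g = fun y => weight (2 * t) (s - t) ‖y‖ * ‖sFourier g y‖ ^ 2 :=
    funext (sobolevDensity_eq s t g)
  rw [e]
  exact ((measurable_weight _ _).comp measurable_norm).mul
    ((sFourier g).continuous.norm.pow 2).measurable

theorem integrable_sobolevDensity (hn : 2 ≤ n) (s : ℝ) {t : ℝ} (ht : -(n : ℝ) / 2 < t)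
    (g : 𝓢(Rn n, ℂ)) : Integrable (sobolevDensity s t g) (lebesgue (Rn n)) := by
  obtain ⟨d, rfl⟩ := Nat.exists_eq_add_of_le' (show 1 ≤ n by omega)
  push_cast at ht
  obtain ⟨k, hk⟩ := exists_integrable_weight d (by linarith : -(d + 1 : ℝ) < 2 * t) (s - t)
  obtain ⟨C, hC, hb⟩ := schwartz_decay (sFourier g) k
  obtain ⟨D, hD, hb'⟩ := schwartz_decay (sFourier g) 0
  refine ((hk (Rn (d + 1)) finrank_euclideanSpace_fin).const_mul (C * D)).mono'
    (measurable_sobolevDensity s t g).aestronglyMeasurable (Eventually.of_forall fun y => ?_)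
  have hw := weight_nonneg (2 * t) (s - t) (norm_nonneg y)
  have h1 := hb' y
  rw [pow_zero, one_mul] at h1
  rw [sobolevDensity_eq, Real.norm_of_nonneg (mul_nonneg hw (by positivity))]
  calc weight (2 * t) (s - t) ‖y‖ * ‖sFourier g y‖ ^ 2
      = weight (2 * t) (s - t) ‖y‖ * (((1 + ‖y‖) ^ k)⁻¹ *
          ((1 + ‖y‖) ^ k * ‖sFourier g y‖) * ‖sFourier g y‖) := by
        rw [inv_mul_cancel_left₀ (by positivity), pow_two]
    _ ≤ weight (2 * t) (s - t) ‖y‖ * (((1 + ‖y‖) ^ k)⁻¹ * C * D) := by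
        gcongr
        exact hb y
    _ = _ := by ring

/-- The extra factor |y| in the weight is the one in `constA_mul_integral_flagMeasure`, and |√(2π)
f̂|² cancels 1/(2π). -/
theorem isFlagIntegral_hatField (hn : 2 ≤ n) {ξ₀ : Rn n} (h₀ : ‖ξ₀‖ = 1) (s : ℝ) {t : ℝ}
    (ht : -(n : ℝ) / 2 < t) (f : Fin n → Fin n → 𝓢(Rn n, ℂ)) (i j : Fin n) :
    IsFlagIntegral ξ₀ (weight (2 * t + 1) (s - t)) (fun z => ‖hatField f i j z.1‖ ^ 2)
      ((constA n)⁻¹ * ∫ y, sobolevDensity s t (f i j) y ∂(lebesgue (Rn n))) := by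
  have hrep : RayRep (fun q : TS n => ray (f i j) q.1) fun z => hatField f i j z.1 :=
    RayRep.ray_rep (f i j)
  have hpi := Real.pi_pos
  have hi := (integrable_pair_symbol hn h₀ (a := 2 * t + 1) (by linarith) (s - t)
    hrep.hasSymbol hrep.hasSymbol).re
  have e1 : (fun z : Rn n × Rn n => weight (2 * t + 1) (s - t) ‖z.1‖ * ‖hatField f i j z.1‖ ^ 2) =
      fun z => RCLike.re (((weight (2 * t + 1) (s - t) ‖z.1‖ : ℝ) : ℂ) *
        (hatField f i j z.1 * conj (hatField f i j z.1))) := by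
    ext z
    rw [Complex.mul_conj', ← Complex.ofReal_pow, ← Complex.ofReal_mul]
    rfl
  have e2 : (fun z : Rn n × Rn n => weight (2 * t + 1) (s - t) ‖z.1‖ * ‖hatField f i j z.1‖ ^ 2)
      =ᵐ[flagMeasure ξ₀] fun z => 2 * Real.pi * (‖z.1‖ * sobolevDensity s t (f i j) z.1) := by
    refine (ae_flagMeasure hn h₀).mono ?_
    rintro z ⟨p, rfl, hp⟩
    simp only
    rw [weight_shift (norm_pos_iff.2 hp) (a := 2 * t) (e := s - t) (m := 1) (by simp) rfl,
      sobolevDensity_eq, hatField_apply, norm_mul, Complex.norm_real, mul_pow, Real.norm_eq_abs,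
      sq_abs, Real.sq_sqrt (by positivity)]
    ring
  refine ⟨e1 ▸ hi, ?_⟩
  rw [integral_congr_ae e2, integral_const_mul, ← constA_mul_integral_flagMeasure hn h₀
    (measurable_sobolevDensity s t (f i j)) fun y => by unfold sobolevDensity; positivity,
    inv_mul_cancel_left₀ (constA_pos hn).ne']
  field_simp

end RayTransform

end

/-! ### Proof of the Reshetnyak formula -/

theorem mainTheorem7 (n : ℕ) (hn : 2 ≤ n) (f : Fin n → Fin n → 𝓢(Rn n, ℂ))
    (hf : ∀ i j, f i j = f j i) (s t : ℝ) (ht : -(n : ℝ) / 2 < t)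
    (I0 I1 I2 : TS n → ℂ)
    (hI0 : I0 = momentRay 0 f) (hI1 : I1 = momentRay 1 f) (hI2 : I2 = momentRay 2 f) :
    -- all the integrals that define the norms and inner products converge absolutely
    (∀ i j, Integrable (sobolevDensity s t (f i j)) (lebesgue (Rn n))) ∧
    (∀ r : ℝ, 1 / 2 ≤ r → ∀ u ∈ formulaTerms I0 I1 I2, ∀ v ∈ formulaTerms I0 I1 I2,
      PairConverges (s + r) (t + r) u v) ∧
    -- the Reshetnyak formula
    tensorNormSq s t f = constA n / 4 *
      (normSq (s + 5 / 2) (t + 5 / 2) I2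
        + 4 * (pair (s + 2) (t + 2) I2 (opZ I1)).im
        + 2 * ∑ i, normSq (s + 3 / 2) (t + 3 / 2) (opXi i I1)
        + 2 * normSq (s + 3 / 2) (t + 3 / 2) I1
        + 2 * normSq (s + 3 / 2) (t + 3 / 2) (opZ I1)
        + 2 * (pair (s + 2) (t + 2) I2 (opW I0)).re
        - 4 * (pair (s + 3 / 2) (t + 3 / 2) I2 I0).re
        - 2 * (pair (s + 3 / 2) (t + 3 / 2) I2 (opQ I0)).re
        - 4 * (∑ i, pair (s + 3 / 2) (t + 3 / 2) (opXi i I1) (mulX i I0)).re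
        + 8 * (pair (s + 1) (t + 1) (opZ I1) I0).im
        + 4 * (pair (s + 1) (t + 1) I1 (opZ I0)).im
        + 4 * (∑ i, pair (s + 1) (t + 1) (opXi i I1) (opZ (opXi i I0))).im
        + ∑ i, normSq (s + 3 / 2) (t + 3 / 2) (mulX i I0)
        - 2 * (∑ i, pair (s + 1) (t + 1) (mulX i I0) (opZ (opXi i I0))).im
        - 4 * (pair (s + 1) (t + 1) (opW I0) I0).re
        + ∑ i, ∑ j, normSq (s + 1 / 2) (t + 1 / 2) (opXi i (opXi j I0))
        + 4 * (∑ i, pair (s + 1 / 2) (t + 1 / 2) (opXi i (opXi i I0)) I0).re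
        + ∑ i, normSq (s + 1 / 2) (t + 1 / 2) (opXi i I0)
        + 4 * n * normSq (s + 1 / 2) (t + 1 / 2) I0) := by
  have r0 : IsRaySum I0 := ⟨_, hI0 ▸ momentRay_zero_rep f⟩
  have r1 : IsRaySum I1 := ⟨_, hI1 ▸ momentRay_one_rep f⟩
  have r2 : IsRaySum I2 := ⟨_, hI2 ▸ momentRay_two_rep f⟩
  obtain ⟨H0, s0⟩ := r0.exists_hasSymbol
  obtain ⟨H1, s1⟩ := r1.exists_hasSymbol
  obtain ⟨H2, s2⟩ := r2.exists_hasSymbol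
  choose X sX using fun i => (r0.mulX i).exists_hasSymbol
  choose A0 sA0 using fun i => (r0.opXi i).exists_hasSymbol
  choose A1 sA1 using fun i => (r1.opXi i).exists_hasSymbol
  choose T sT using fun i j => ((r0.opXi j).opXi i).exists_hasSymbol
  obtain ⟨Z0, sZ0, eZ0⟩ := r0.opZ_hasSymbol
  obtain ⟨Z1, sZ1, eZ1⟩ := r1.opZ_hasSymbol
  obtain ⟨Q0, sQ0, eQ0⟩ := r0.opQ_hasSymbol
  obtain ⟨W0, sW0, eW0⟩ := r0.opW_hasSymbol
  choose ZX sZX eZX using fun i => (r0.opXi i).opZ_hasSymbol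
  refine ⟨fun i j => integrable_sobolevDensity hn s ht (f i j), ?_, ?_⟩
  · have hsym : ∀ u ∈ formulaTerms I0 I1 I2, ∃ G, HasSymbol u G := by
      rintro u (((((hu | ⟨i, rfl⟩) | ⟨i, rfl⟩) | ⟨i, rfl⟩) | ⟨i, rfl⟩) | ⟨ij, rfl⟩)
      · rcases hu with rfl | rfl | rfl | rfl | rfl | rfl | rfl
        exacts [⟨_, s0⟩, ⟨_, s1⟩, ⟨_, s2⟩, ⟨_, sZ0⟩, ⟨_, sZ1⟩, ⟨_, sQ0⟩, ⟨_, sW0⟩]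
      exacts [⟨_, sX i⟩, ⟨_, sA0 i⟩, ⟨_, sA1 i⟩, ⟨_, sZX i⟩, ⟨_, sT ij.1 ij.2⟩]
    intro r hr u hu v hv
    obtain ⟨G, hG⟩ := hsym u hu
    obtain ⟨H, hH⟩ := hsym v hv
    -- From r ≥ 1/2 and t > -n/2 follows 2(t + r) > 1 - n, the threshold in dimension n - 1.
    exact pairConverges_of_hasSymbol hn (by linarith) hG hH
  · obtain ⟨ξ₀, h₀⟩ : ∃ ξ₀ : Rn n, ‖ξ₀‖ = 1 :=
      ⟨EuclideanSpace.single ⟨0, by omega⟩ 1, by simp⟩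
    have hN : ∀ (m : ℕ) {σ τ : ℝ}, σ = s + (m + 1) / 2 → τ = t + (m + 1) / 2 →
        ∀ {φ : TS n → ℂ} {G : Rn n × Rn n → ℂ}, HasSymbol φ G → _ :=
      fun m _ _ hσ hτ _ _ hφ => isFlagIntegral_normSq hn h₀ ht m hσ hτ hφ
    have hR : ∀ (m : ℕ) {σ τ : ℝ}, σ = s + (m + 1) / 2 → τ = t + (m + 1) / 2 →
        ∀ {φ ψ : TS n → ℂ} {G H : Rn n × Rn n → ℂ}, HasSymbol φ G → HasSymbol ψ H → _ :=
      fun m _ _ hσ hτ _ _ _ _ hφ hψ => isFlagIntegral_pair hn h₀ ht m hσ hτ hφ hψ Complex.reCLM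
    have hI : ∀ (m : ℕ) {σ τ : ℝ}, σ = s + (m + 1) / 2 → τ = t + (m + 1) / 2 →
        ∀ {φ ψ : TS n → ℂ} {G H : Rn n × Rn n → ℂ}, HasSymbol φ G → HasSymbol ψ H → _ :=
      fun m _ _ hσ hτ _ _ _ _ hφ hψ => isFlagIntegral_pair hn h₀ ht m hσ hτ hφ hψ Complex.imCLM
    simp only [Complex.re_sum, Complex.im_sum]
    -- The shifts are (m+1)/2 with m = 4, …, 0; then |y|^m is the power attached to the term in
    -- `reshetnyak_density`.
    have e5 : ∀ x : ℝ, x + 5 / 2 = x + ((4 : ℕ) + 1) / 2 := fun x => by norm_num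
    have e4 : ∀ x : ℝ, x + 2 = x + ((3 : ℕ) + 1) / 2 := fun x => by norm_num
    have e3 : ∀ x : ℝ, x + 3 / 2 = x + ((2 : ℕ) + 1) / 2 := fun x => by norm_num
    have e2 : ∀ x : ℝ, x + 1 = x + ((1 : ℕ) + 1) / 2 := fun x => by norm_num
    have e1 : ∀ x : ℝ, x + 1 / 2 = x + ((0 : ℕ) + 1) / 2 := fun x => by norm_num
    -- Built in the order of the formula, so that the resulting integrand is literally the left side
    -- of `reshetnyak_density`.
    have lhs := (hN 4 (e5 s) (e5 t) s2).add ((hI 3 (e4 s) (e4 t) s2 sZ1).const_mul 4)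
      |>.add ((IsFlagIntegral.sum Finset.univ fun i => hN 2 (e3 s) (e3 t) (sA1 i)).const_mul 2)
      |>.add ((hN 2 (e3 s) (e3 t) s1).const_mul 2)
      |>.add ((hN 2 (e3 s) (e3 t) sZ1).const_mul 2)
      |>.add ((hR 3 (e4 s) (e4 t) s2 sW0).const_mul 2)
      |>.sub ((hR 2 (e3 s) (e3 t) s2 s0).const_mul 4)
      |>.sub ((hR 2 (e3 s) (e3 t) s2 sQ0).const_mul 2)
      |>.sub ((IsFlagIntegral.sum Finset.univ fun i =>
        hR 2 (e3 s) (e3 t) (sA1 i) (sX i)).const_mul 4)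
      |>.add ((hI 1 (e2 s) (e2 t) sZ1 s0).const_mul 8)
      |>.add ((hI 1 (e2 s) (e2 t) s1 sZ0).const_mul 4)
      |>.add ((IsFlagIntegral.sum Finset.univ fun i =>
        hI 1 (e2 s) (e2 t) (sA1 i) (sZX i)).const_mul 4)
      |>.add (IsFlagIntegral.sum Finset.univ fun i => hN 2 (e3 s) (e3 t) (sX i))
      |>.sub ((IsFlagIntegral.sum Finset.univ fun i =>
        hI 1 (e2 s) (e2 t) (sX i) (sZX i)).const_mul 2)
      |>.sub ((hR 1 (e2 s) (e2 t) sW0 s0).const_mul 4)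
      |>.add (IsFlagIntegral.sum Finset.univ fun i => IsFlagIntegral.sum Finset.univ fun j =>
        hN 0 (e1 s) (e1 t) (sT i j))
      |>.add ((IsFlagIntegral.sum Finset.univ fun i =>
        hR 0 (e1 s) (e1 t) (sT i i) s0).const_mul 4)
      |>.add (IsFlagIntegral.sum Finset.univ fun i => hN 0 (e1 s) (e1 t) (sA0 i))
      |>.add ((hN 0 (e1 s) (e1 t) s0).const_mul (4 * n))
    have rhs := (IsFlagIntegral.sum Finset.univ fun i => IsFlagIntegral.sum Finset.univ fun j =>
      isFlagIntegral_hatField hn h₀ s ht f i j).const_mul 4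
    have key := lhs.unique rhs ?_
    · refine Eq.trans ?_ (congrArg (fun x => constA n / 4 * x) key).symm
      have hA := (constA_pos hn).ne'
      simp only [tensorNormSq, ← Finset.mul_sum]
      field_simp
    · refine (ae_flagMeasure hn h₀).mono ?_
      rintro z ⟨p, rfl, hp⟩
      have := reshetnyak_density f hf p hp
        (hI0 ▸ (s0.hat_eq p hp).symm) (hI1 ▸ (s1.hat_eq p hp).symm) (hI2 ▸ (s2.hat_eq p hp).symm)
        (fun i => hI0 ▸ ((sA0 i).hat_eq p hp).symm) (fun i => hI0 ▸ ((sX i).hat_eq p hp).symm)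
        (fun i => hI1 ▸ ((sA1 i).hat_eq p hp).symm) (fun i j => hI0 ▸ ((sT i j).hat_eq p hp).symm)
        ((eZ0 p).trans (by simp only [(sA0 _).hat_eq p hp]))
        ((eZ1 p).trans (by simp only [(sA1 _).hat_eq p hp]))
        ((eQ0 p).trans (by simp only [(sT _ _).hat_eq p hp]))
        ((eW0 p).trans (by simp only [(sX _).hat_eq p hp]))
        (fun i => (eZX i p).trans (by simp only [(sT _ _).hat_eq p hp]))
      simpa only [pow_zero, pow_one, one_mul, Complex.reCLM_apply, Complex.imCLM_apply] using this
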